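/- **Setting.** Let $g\ge 2$, let $M=\Gamma\backslash\mathbb D$ be a closed oriented hyperbolic surface of genus $g$, where $\Gamma$ is a discrete group of orientation-preserving isometries of the unit disk $\mathbb D$ acting freely, and let $\mathcal F\subset\mathbb D$ be an $(8g-4)$-sided fundamental polygon of $\Gamma$ satisfying the extension condition: the infinite geodesics that extend its sides never meet the interior of a tile $\gamma\mathcal F$, $\gamma\in\Gamma$. All indices are taken modulo $8g-4$. Side $i$ of $\mathcal F$ joins the vertices $v_i$ and $v_{i+1}$ (counterclockwise), and extends to the oriented geodesic from $P_i$ to $Q_{i+1}$ on the circle $\mathbb S=\partial\mathbb D$; the counterclockwise order of these end points is $P_1,Q_1,P_2,Q_2,\dots,P_{8g-4},Q_{8g-4}$. Put $\sigma(i)=4g-i$ for odd $i$, $\sigma(i)=2-i$ for even $i$, $\rho(i)=\sigma(i)+1$ and $\tau(i)=i+4g-2$. The side identifications $T_i$ are Möbius transformations generating $\Gamma$ with $T_i(v_i)=v_{\rho(i)}$, $T_{\sigma(i)}T_i=\mathrm{Id}$ and $T_{\rho^3(i)}T_{\rho^2(i)}T_{\rho(i)}T_i=\mathrm{Id}$.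 Here $[a,b]$ and $[a,b)$ denote counterclockwise arcs of $\mathbb S$, with $[a,a]=\{a\}$. For parameters $\bar A=\{A_i\}$ with $A_i\in[P_i,Q_i]$ let $F_{\bar A}:\mathbb S\times\mathbb S\to\mathbb S\times\mathbb S$, $F_{\bar A}(u,w)=(T_iu,T_iw)$ if $w\in[A_i,A_{i+1})$. The parameters $\bar A$ are *extremal* if $A_i\in\{P_i,Q_i\}$ for all $i$. A set $\Omega\subset\mathbb S\times\mathbb S$ is called a *bijectivity domain* for a map $F$ of $\mathbb S\times\mathbb S$ if $F$ maps $\Omega$ to itself bijectively up to boundary points, precisely: $F(\Omega)\subset\Omega=\overline{F(\Omega)}$, $F$ is injective on the interior of $\Omega$, the interior of $\Omega$ is contained in $F(\Omega)$, and there is a countable set $C\subset\mathbb S$ such that $F$ restricts to a bijection of $\{(u,w)\in\Omega: u\notin C,\ w\notin C\}$ onto itself. **Theorem.** Let $\bar A$ be extremal. There are unique points $G_1,\dots,G_{8g-4}\in\mathbb S$ such that for all $i$: $G_i\in[P_i,P_{i+1}]$; $G_{\sigma(i)}=T_iG_{i-2}$ if $A_i=P_i$; and $G_{\sigma(i)}=T_{\tau(i)+1}G_{\tau(i)}$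 if $A_i=Q_i$. With these points put $$H_i:=T_{\sigma(i-1)}T_{\tau(i)}G_{\tau(i)-1},\qquad D_i:=T_{\tau\sigma(i)+1}G_{\tau\sigma(i)} .$$ Then $D_i\in[P_i,Q_i]$ for all $i$, so $F_{\bar D}$ is defined for $\bar D=\{D_i\}$. The set $$\Omega_{\bar D}:=\bigcup_{i=1}^{8g-4}[Q_{i+2},P_{i-1}]\times[D_i,D_{i+1}]\ \cup\ [P_{i-1},P_i]\times[H_i,D_{i+1}]\ \cup\ [Q_{i+1},Q_{i+2}]\times[D_i,G_i]$$ equals the union of vertical strips $$\bigcup_{i=1}^{8g-4}[P_i,Q_i]\times[H_{i+1},G_{i-2}]\ \cup\ [Q_i,P_{i+1}]\times[H_{i+1},G_{i-1}],$$ and it is a bijectivity domain for $F_{\bar D}$. (Nothing further is assumed of $\bar D$, which need be neither extremal nor satisfy the short cycle property.) -/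

import Mathlib

noncomputable section

namespace BowenSeries

/-! ### Möbius transformations of the unit disk and of the circle at infinity -/

/-- The group `SU(1,1)` of matrices `!![a, b; conj b, conj a]` with `|a|² - |b|² = 1`; modulo
`±1` it is the group of orientation-preserving isometries of the hyperbolic disk. -/
def SU11 : Subgroup (Matrix.SpecialLinearGroup (Fin 2) ℂ) where
  carrier := {M | (M : Matrix (Fin 2) (Fin 2) ℂ) 1 0
      = (starRingEnd ℂ) ((M : Matrix (Fin 2) (Fin 2) ℂ) 0 1) ∧
    (M : Matrix (Fin 2) (Fin 2) ℂ) 1 1 = (starRingEnd ℂ) ((M : Matrix (Fin 2) (Fin 2) ℂ) 0 0)}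
  one_mem' := by simp
  mul_mem' := by
    rintro A B ⟨hA₁, hA₂⟩ ⟨hB₁, hB₂⟩
    constructor
    · simp only [Matrix.SpecialLinearGroup.coe_mul, Matrix.mul_apply, Fin.sum_univ_two, map_add,
        map_mul, hA₁, hA₂, hB₁, hB₂, Complex.conj_conj]
      ring
    · simp only [Matrix.SpecialLinearGroup.coe_mul, Matrix.mul_apply, Fin.sum_univ_two, map_add,
        map_mul, hA₁, hA₂, hB₁, hB₂, Complex.conj_conj]
      ring
  inv_mem' := by
    rintro A ⟨hA₁, hA₂⟩
    simp only [Set.mem_ofPred_eq, Matrix.SpecialLinearGroup.coe_inv, Matrix.adjugate_fin_two]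
    simp [hA₁, hA₂]

/-- The Möbius transformation `z ↦ (a z + b) / (conj b z + conj a)`. -/
def act (M : SU11) (z : ℂ) : ℂ :=
  ((M.1 : Matrix (Fin 2) (Fin 2) ℂ) 0 0 * z + (M.1 : Matrix (Fin 2) (Fin 2) ℂ) 0 1) /
    ((M.1 : Matrix (Fin 2) (Fin 2) ℂ) 1 0 * z + (M.1 : Matrix (Fin 2) (Fin 2) ℂ) 1 1)

theorem norm_act_circle (M : SU11) (x : Circle) : ‖act M x‖ = 1 := by
  have hdet : (M.1 : Matrix (Fin 2) (Fin 2) ℂ).det = 1 := M.1.2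
  have h₁ := M.2.1
  have h₂ := M.2.2
  rw [Matrix.det_fin_two] at hdet
  unfold act
  generalize (M.1 : Matrix (Fin 2) (Fin 2) ℂ) 0 0 = a at *
  generalize (M.1 : Matrix (Fin 2) (Fin 2) ℂ) 0 1 = b at *
  generalize (M.1 : Matrix (Fin 2) (Fin 2) ℂ) 1 0 = c at *
  generalize (M.1 : Matrix (Fin 2) (Fin 2) ℂ) 1 1 = d at *
  have hx : ‖(x : ℂ)‖ = 1 := Circle.norm_coe x
  have hxx : (starRingEnd ℂ) (x : ℂ) * (x : ℂ) = 1 := by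
    rw [mul_comm, Complex.mul_conj, Complex.normSq_eq_norm_sq, hx]; simp
  have key : c * (x : ℂ) + d = (starRingEnd ℂ) (a * (x : ℂ) + b) * (x : ℂ) := by
    rw [h₁, h₂, map_add, map_mul]
    linear_combination (-(starRingEnd ℂ) a) * hxx
  have hn : ‖c * (x : ℂ) + d‖ = ‖a * (x : ℂ) + b‖ := by
    rw [key, norm_mul, RCLike.norm_conj, hx, mul_one]
  have hne : ‖c * (x : ℂ) + d‖ ≠ 0 := by
    intro h0
    have e₁ : c * (x : ℂ) + d = 0 := norm_eq_zero.mp h0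
    have e₂ : a * (x : ℂ) + b = 0 := norm_eq_zero.mp (hn ▸ h0)
    have : (1 : ℂ) = 0 := by
      rw [← hdet]
      linear_combination a * e₁ - c * e₂
    exact one_ne_zero this
  rw [norm_div, ← hn, div_self hne]

/-- The action of `SU(1,1)` on the circle at infinity. -/
def actS (M : SU11) (x : Circle) : Circle :=
  ⟨act M x, mem_sphere_zero_iff_norm.mpr (norm_act_circle M x)⟩

/-- `M` is the identity as a Möbius transformation of the disk. -/
def ActsAsId (M : SU11) : Prop := ∀ z : ℂ, ‖z‖ < 1 → act M z = z

/-! ### Counterclockwise arcs of the circle -/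

/-- The counterclockwise angle from `a` to `x`, in `[0, 2π)`. -/
def ccw (a x : Circle) : ℝ :=
  toIcoMod Real.two_pi_pos 0 (Complex.arg ((x / a : Circle) : ℂ))

/-- The closed counterclockwise arc `[a, b]`; it is `{a}` if `a = b`. -/
def arcCC (a b : Circle) : Set Circle := {x | ccw a x ≤ ccw a b}

/-- The half-open counterclockwise arc `[a, b)`. -/
def arcCO (a b : Circle) : Set Circle := {x | ccw a x < ccw a b}

/-! ### Geodesics and half-planes of the disk -/

/-- A circle (or line) through `a` and `b` orthogonal to the unit circle has the equation
`Im (a conj b) (1 + |z|²) = 2 Im ((a - b) conj z)`. In the disk, the function below is positive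
exactly on the left of the oriented geodesic from `a` to `b` and negative on its right. -/
def sideFn (a b : Circle) (z : ℂ) : ℝ :=
  2 * (((a : ℂ) - b) * (starRingEnd ℂ) z).im
    - ((a : ℂ) * (starRingEnd ℂ) (b : ℂ)).im * (1 + ‖z‖ ^ 2)

/-- The infinite geodesic of the disk with end points `a ≠ b`. -/
def geodesic (a b : Circle) : Set ℂ := {z | ‖z‖ < 1 ∧ sideFn a b z = 0}

/-! ### Indices -/

/-- The indices `1, …, 8g-4`, taken modulo `8g-4`. -/
abbrev Idx (g : ℕ) : Type := ZMod (8 * g - 4)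

/-- `σ(i) = 4g - i` for odd `i` and `σ(i) = 2 - i` for even `i`, modulo `8g-4`. -/
def sig {g : ℕ} (i : Idx g) : Idx g :=
  if Odd i.val then ((4 * g : ℕ) : Idx g) - i else 2 - i

/-- `τ(i) = i + (4g-2)`, modulo `8g-4`. -/
def tau {g : ℕ} (i : Idx g) : Idx g := i + ((4 * g - 2 : ℕ) : Idx g)

/-- `ρ(i) = σ(i) + 1`. -/
def rho {g : ℕ} (i : Idx g) : Idx g := sig i + 1

/-! ### The fundamental polygon -/

/-- The convex polygon of the disk cut out by the geodesics `P i → Q (i+1)`: the points that lie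
on or to the left of each of them. -/
def polygon {g : ℕ} (P Q : Idx g → Circle) : Set ℂ :=
  {z | ‖z‖ < 1 ∧ ∀ i, 0 ≤ sideFn (P i) (Q (i + 1)) z}

/-- A closed oriented hyperbolic surface `Γ \ 𝔻` of genus `g ≥ 2`, presented by a fundamental
`(8g-4)`-gon with the extension condition. Side `i` joins `V i` to `V (i+1)` and extends to the
geodesic from `P i` to `Q (i+1)`; the polygon is convex by the extension condition, so it is the
intersection of the half-planes to the left of these geodesics. `T i` are the generators of `Γ`
that identify the sides; equalities between Möbius transformations are equalities of maps. -/
structure SurfacePolygon (g : ℕ) where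
  two_le : 2 ≤ g
  P : Idx g → Circle
  Q : Idx g → Circle
  V : Idx g → ℂ
  T : Idx g → SU11
  /-- The counterclockwise order on the circle is `P₁, Q₁, P₂, Q₂, …, P_{8g-4}, Q_{8g-4}`. -/
  order_PQ : ∀ k : ℕ, k < 8 * g - 4 →
    ccw (P 1) (P (1 + (k : Idx g))) < ccw (P 1) (Q (1 + (k : Idx g)))
  order_QP : ∀ k : ℕ, k + 1 < 8 * g - 4 →
    ccw (P 1) (Q (1 + (k : Idx g))) < ccw (P 1) (P (1 + ((k + 1 : ℕ) : Idx g)))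
  /-- The vertex `V i` is the common point of the lines of the sides `i - 1` and `i`. -/
  V_mem_left : ∀ i, V i ∈ geodesic (P (i - 1)) (Q i)
  V_mem_right : ∀ i, V i ∈ geodesic (P i) (Q (i + 1))
  /-- The side pairing and its relations. -/
  T_V : ∀ i, act (T i) (V i) = V (rho i)
  T_inv : ∀ i, ActsAsId (T (sig i) * T i)
  T_cycle : ∀ i, ActsAsId (T (rho (rho (rho i))) * T (rho (rho i)) * T (rho i) * T i)
  /-- The group `Γ` generated by the `T i` is discrete and acts freely on the disk. -/
  discrete : DiscreteTopology (Subgroup.closure (Set.range T))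
  free : ∀ γ ∈ Subgroup.closure (Set.range T), ∀ z : ℂ, ‖z‖ < 1 → act γ z = z → ActsAsId γ
  /-- The polygon is a fundamental domain of `Γ`: its images tile the disk. -/
  cover : ∀ z : ℂ, ‖z‖ < 1 →
    ∃ γ ∈ Subgroup.closure (Set.range T), z ∈ act γ '' polygon P Q
  tile : ∀ γ ∈ Subgroup.closure (Set.range T), ¬ ActsAsId γ →
    Disjoint (interior (polygon P Q)) (interior (act γ '' polygon P Q))
  /-- Extension condition: the lines of the sides never meet the interior of a tile. -/
  extension : ∀ γ ∈ Subgroup.closure (Set.range T), ∀ i,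
    Disjoint (geodesic (P i) (Q (i + 1))) (interior (act γ '' polygon P Q))

variable {g : ℕ}

/-! ### Parameters, natural extensions, bijectivity domains -/

/-- `A` is extremal: each `A i` is `P i` or `Q i`. -/
def SurfacePolygon.IsExtremal (S : SurfacePolygon g) (A : Idx g → Circle) : Prop :=
  ∀ i, A i = S.P i ∨ A i = S.Q i

open Classical in
/-- The map `F_A (u, w) = (T_i u, T_i w)` if `w ∈ [A_i, A_{i+1})`. For `A_i ∈ [P_i, Q_i]` these
arcs partition the circle, so that exactly one `i` qualifies. -/
def SurfacePolygon.natExt (S : SurfacePolygon g) (A : Idx g → Circle)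
    (p : Circle × Circle) : Circle × Circle :=
  if h : ∃ i, p.2 ∈ arcCO (A i) (A (i + 1)) then
    (actS (S.T h.choose) p.1, actS (S.T h.choose) p.2)
  else p

/-- `Ω` is a bijectivity domain of the piecewise continuous map `F` of the torus: `F` maps `Ω`
to `Ω` bijectively up to boundary points. That is, `Ω` is invariant and the closure of its image,
`F` is injective on the interior of `Ω`, every interior point of `Ω` has a preimage in `Ω`, and
`F` is a bijection of `Ω` onto itself once countably many horizontal and vertical lines are
removed. -/
structure IsBijectivityDomain (F : Circle × Circle → Circle × Circle)
    (Ω : Set (Circle × Circle)) : Prop where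
  mapsTo : Set.MapsTo F Ω Ω
  closure_image : closure (F '' Ω) = Ω
  injOn_interior : Set.InjOn F (interior Ω)
  interior_subset_image : interior Ω ⊆ F '' Ω
  bijOn : ∃ C : Set Circle, C.Countable ∧
    Set.BijOn F (Ω \ {p | p.1 ∈ C ∨ p.2 ∈ C}) (Ω \ {p | p.1 ∈ C ∨ p.2 ∈ C})

/-! ### The points `G`, `H`, `D` and the domain -/

/-- The system of equations that determines `G` from the extremal parameters `A`. -/
def SurfacePolygon.IsSystemSolution (S : SurfacePolygon g) (A G : Idx g → Circle) : Prop :=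
  ∀ i, G i ∈ arcCC (S.P i) (S.P (i + 1)) ∧
    (A i = S.P i → G (sig i) = actS (S.T i) (G (i - 2))) ∧
    (A i = S.Q i → G (sig i) = actS (S.T (tau i + 1)) (G (tau i)))

/-- `U_i = T_{σ(i-1)} T_{τ(i)}`. -/
def SurfacePolygon.U (S : SurfacePolygon g) (i : Idx g) : SU11 :=
  S.T (sig (i - 1)) * S.T (tau i)

/-- `H_i = U_i G_{τ(i)-1}`. -/
def SurfacePolygon.H (S : SurfacePolygon g) (G : Idx g → Circle) (i : Idx g) : Circle :=
  actS (S.U i) (G (tau i - 1))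

/-- `D_i = T_{τσ(i)+1} G_{τσ(i)}`. -/
def SurfacePolygon.D (S : SurfacePolygon g) (G : Idx g → Circle) (i : Idx g) : Circle :=
  actS (S.T (tau (sig i) + 1)) (G (tau (sig i)))

/-- The domain `Ω_D` as a union of rectangles. -/
def SurfacePolygon.omegaD (S : SurfacePolygon g) (G : Idx g → Circle) :
    Set (Circle × Circle) :=
  ⋃ i : Idx g,
    arcCC (S.Q (i + 2)) (S.P (i - 1)) ×ˢ arcCC (S.D G i) (S.D G (i + 1)) ∪
    arcCC (S.P (i - 1)) (S.P i) ×ˢ arcCC (S.H G i) (S.D G (i + 1)) ∪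
    arcCC (S.Q (i + 1)) (S.Q (i + 2)) ×ˢ arcCC (S.D G i) (G i)

/-- The union of the (closed) vertical strips `V_i` and `V_i'`. -/
def SurfacePolygon.verticalStrips (S : SurfacePolygon g) (G : Idx g → Circle) :
    Set (Circle × Circle) :=
  ⋃ i : Idx g,
    arcCC (S.P i) (S.Q i) ×ˢ arcCC (S.H G (i + 1)) (G (i - 2)) ∪
    arcCC (S.Q i) (S.P (i + 1)) ×ˢ arcCC (S.H G (i + 1)) (G (i - 1))

end BowenSeries

end

/-! ### Lifts of arcs and Möbius transformations to the universal cover of the circle. -/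

noncomputable section

namespace BowenSeries

open Real

/-! ### The universal cover of the circle -/

/-! Everything is lifted to the line, where arcs become intervals and cyclic order becomes `≤`. The
end points lift to sequences `p n < q n < p (n + 1)`, and each side pairing `T n` to an increasing
map `t n`.

Geometry. `T n` reverses the line of side `n` onto the line of side `σ(n)`, which gives `t_p` and
`t_q_succ`. The extension condition bounds the images of `p (n - 1)` and `q n` from one side.
Running these bounds once around the relation of length four leaves no slack, so they are equalities
(`t_p_pred`, `t_q`). From then on the hyperbolic geometry enters only through the values of `t n` at
end points and the invariance of the cross ratio.

The system. Its right hand side is a monotone self map `step` of the sequences with `p n ≤ x n ≤ p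
(n + 1)`, so it has a fixed point (`exists_isLiftedSolution`). Every branch maps an arc around the
source interval properly into the arc from `q (n - 1)` to `q (n + 1)`. Hence it strictly contracts
the Hilbert metric, and two solutions coincide (`exists_crossRatio_lt`,
`IsLiftedSolution.eq_of_sol`).

The domain. Let `x`, `d`, `h` lift `G`, `D`, `H`. The system yields `d n ≤ x n` and `h n ≤ d (n +
1)`; these inequalities and the images of `d`, `x`, `h` under `t` are collected in `IsDual`. Over
the interval from `d j` to `d (j + 1)` the domain consists of a left, a middle and a right
rectangle. With `k = σ(j) + per g`, the map `t j` sends the middle one to the strip over `[q k, p (k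
+ 1)]`, the left one to the lower part of the strip over `[p k, q k]`, and the right one to the
upper part of the strip over `[p (k + 1), q (k + 1)]`. The lower and the upper part of one strip
come from different indices and meet along a common edge; this is the identity `t_h`, a consequence
of the relation of length four. So the map cuts the domain into rectangles and reassembles it, up to
edges (`col_t`, `exists_preimage_of_strip`, `eq_of_t_eq`). The lifted domain lies in the strip `u -
2π < w < u`, so these statements descend to the torus. -/

theorem ccw_exp (x y : ℝ) :
    ccw (Circle.exp x) (Circle.exp y) = toIcoMod Real.two_pi_pos 0 (y - x) := by
  unfold ccw
  rw [← Circle.exp_sub, Circle.coe_exp, Complex.arg_exp_mul_I]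
  conv_lhs => rw [toIocMod, toIcoMod_sub_zsmul]

theorem mem_arcCC_exp {a b x : ℝ} (hab : a ≤ b) (hb : b < a + 2 * π) :
    Circle.exp x ∈ arcCC (Circle.exp a) (Circle.exp b) ↔
      ∃ n : ℤ, a ≤ x + n * (2 * π) ∧ x + n * (2 * π) ≤ b := by
  have h₁ : toIcoMod Real.two_pi_pos 0 (b - a) = b - a := by
    rw [toIcoMod_eq_self]
    constructor <;> linarith
  simp only [arcCC, Set.mem_ofPred_eq, ccw_exp, h₁]
  have h₂ := toIcoMod_mem_Ico Real.two_pi_pos 0 (x - a)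
  constructor
  · intro h
    refine ⟨-toIcoDiv Real.two_pi_pos 0 (x - a), ?_⟩
    rw [toIcoMod] at h h₂
    simp only [zsmul_eq_mul, Set.mem_Ico] at h h₂
    push_cast
    constructor <;> linarith
  · rintro ⟨n, h₃, h₄⟩
    have : toIcoMod Real.two_pi_pos 0 (x - a) = x + n * (2 * π) - a := by
      rw [toIcoMod_eq_iff]
      refine ⟨⟨by linarith, by linarith⟩, -n, ?_⟩
      simp only [zsmul_eq_mul]
      push_cast
      ring
    rw [this]
    linarith

theorem mem_arcCO_exp {a b x : ℝ} (hab : a ≤ b) (hb : b < a + 2 * π) :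
    Circle.exp x ∈ arcCO (Circle.exp a) (Circle.exp b) ↔
      ∃ n : ℤ, a ≤ x + n * (2 * π) ∧ x + n * (2 * π) < b := by
  have h₁ : toIcoMod Real.two_pi_pos 0 (b - a) = b - a := by
    rw [toIcoMod_eq_self]
    constructor <;> linarith
  simp only [arcCO, Set.mem_ofPred_eq, ccw_exp, h₁]
  have h₂ := toIcoMod_mem_Ico Real.two_pi_pos 0 (x - a)
  constructor
  · intro h
    refine ⟨-toIcoDiv Real.two_pi_pos 0 (x - a), ?_⟩
    rw [toIcoMod] at h h₂
    simp only [zsmul_eq_mul, Set.mem_Ico] at h h₂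
    push_cast
    constructor <;> linarith
  · rintro ⟨n, h₃, h₄⟩
    have : toIcoMod Real.two_pi_pos 0 (x - a) = x + n * (2 * π) - a := by
      rw [toIcoMod_eq_iff]
      refine ⟨⟨by linarith, by linarith⟩, -n, ?_⟩
      simp only [zsmul_eq_mul]
      push_cast
      ring
    rw [this]
    linarith

theorem exp_add_int_mul (x : ℝ) (n : ℤ) : Circle.exp (x + n * (2 * π)) = Circle.exp x :=
  Circle.exp_eq_exp.2 ⟨n, rfl⟩

/-- A point of the arc from `exp a` to `exp b` has a lift between `a` and `b`. -/
theorem exists_lift_of_mem_arcCC {a b : ℝ} {x : Circle} (hab : a ≤ b) (hb : b < a + 2 * π)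
    (hx : x ∈ arcCC (Circle.exp a) (Circle.exp b)) :
    ∃ y, a ≤ y ∧ y ≤ b ∧ Circle.exp y = x := by
  obtain ⟨z, rfl⟩ := Circle.exp_surjective x
  obtain ⟨n, h₁, h₂⟩ := (mem_arcCC_exp hab hb).1 hx
  exact ⟨_, h₁, h₂, exp_add_int_mul z n⟩

theorem exp_mem_arcCC {a b x : ℝ} (h₁ : a ≤ x) (h₂ : x ≤ b) (hb : b < a + 2 * π) :
    Circle.exp x ∈ arcCC (Circle.exp a) (Circle.exp b) :=
  (mem_arcCC_exp (h₁.trans h₂) hb).2 ⟨0, by simpa using h₁, by simpa using h₂⟩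

theorem exp_mem_arcCO {a b x : ℝ} (h₁ : a ≤ x) (h₂ : x < b) (hb : b < a + 2 * π) :
    Circle.exp x ∈ arcCO (Circle.exp a) (Circle.exp b) :=
  (mem_arcCO_exp (h₁.trans h₂.le) hb).2 ⟨0, by simpa using h₁, by simpa using h₂⟩

/-- Two lifts of one point that are closer than a full turn are equal. -/
theorem eq_of_exp_eq {x y : ℝ} (h : Circle.exp x = Circle.exp y) (h₁ : x < y + 2 * π)
    (h₂ : y < x + 2 * π) : x = y := by
  obtain ⟨n, rfl⟩ := Circle.exp_eq_exp.1 h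
  have hpi := Real.pi_pos
  have a₁ : n < 1 := by
    by_contra hn
    have : (1 : ℝ) ≤ n := by exact_mod_cast not_lt.1 hn
    nlinarith
  have a₂ : -1 < n := by
    by_contra hn
    have : (n : ℝ) ≤ -1 := by exact_mod_cast not_lt.1 hn
    nlinarith
  obtain rfl : n = 0 := by omega
  simp

theorem exists_exp_eq_mem_Ico (x : Circle) (a : ℝ) :
    ∃ y, a ≤ y ∧ y < a + 2 * π ∧ Circle.exp y = x := by
  obtain ⟨z, rfl⟩ := Circle.exp_surjective x
  refine ⟨toIcoMod Real.two_pi_pos a z, left_le_toIcoMod _ _ _, toIcoMod_lt_right _ _ _, ?_⟩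
  rw [toIcoMod, Circle.exp_eq_exp]
  exact ⟨-toIcoDiv Real.two_pi_pos a z, by push_cast; rw [zsmul_eq_mul]; ring⟩

/-- `f` is a lift of the orientation preserving circle map `M` to the universal cover. -/
structure IsLift (f : ℝ → ℝ) (M : Circle → Circle) : Prop where
  mono : StrictMono f
  add_two_pi : ∀ x, f (x + 2 * π) = f x + 2 * π
  exp_apply : ∀ x, Circle.exp (f x) = M (Circle.exp x)

namespace IsLift

variable {f f' : ℝ → ℝ} {M M' : Circle → Circle}

theorem add_int_mul (hf : IsLift f M) (x : ℝ) (n : ℤ) :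
    f (x + n * (2 * π)) = f x + n * (2 * π) := by
  induction n with
  | zero => simp
  | succ k ih =>
    have := hf.add_two_pi (x + (k : ℤ) * (2 * π))
    push_cast at this ih ⊢
    rw [ih] at this
    rw [show x + ((k : ℝ) + 1) * (2 * π) = x + k * (2 * π) + 2 * π by ring, this]
    ring
  | pred k ih =>
    have := hf.add_two_pi (x + (-(k : ℤ) - 1 : ℤ) * (2 * π))
    push_cast at this ih ⊢
    rw [show x + (-(k : ℝ) - 1) * (2 * π) + 2 * π = x + -k * (2 * π) by ring, ih] at this
    linarith

theorem sub_two_pi (hf : IsLift f M) (x : ℝ) : f (x - 2 * π) = f x - 2 * π := by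
  have := hf.add_two_pi (x - 2 * π)
  rw [sub_add_cancel] at this
  linarith

theorem comp (hf : IsLift f M) (hf' : IsLift f' M') : IsLift (f ∘ f') (M ∘ M') where
  mono := hf.mono.comp hf'.mono
  add_two_pi x := by simp [hf'.add_two_pi, hf.add_two_pi]
  exp_apply x := by simp [hf'.exp_apply, hf.exp_apply]

theorem add_const (hf : IsLift f M) (n : ℤ) : IsLift (fun x ↦ f x + n * (2 * π)) M where
  mono x y h := by simpa using hf.mono h
  add_two_pi x := by simp only [hf.add_two_pi]; ring
  exp_apply x := by rw [exp_add_int_mul, hf.exp_apply]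

theorem id_add (n : ℤ) : IsLift (fun x ↦ x + n * (2 * π)) id where
  mono x y h := by simpa using h
  add_two_pi x := by ring
  exp_apply x := by simp only [exp_add_int_mul, id]

/-- Lifts of one map that agree at a point are equal. -/
theorem eq_of_eq (hf : IsLift f M) (hf' : IsLift f' M) {x₀ : ℝ} (h : f x₀ = f' x₀) (x : ℝ) :
    f x = f' x := by
  obtain ⟨y, h₁, h₂, h₃⟩ := exists_exp_eq_mem_Ico (Circle.exp x) x₀
  -- Both values lie in the turn that starts at the common value at `x₀`, and they project to the
  -- same point.
  have key : f y = f' y := by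
    apply eq_of_exp_eq
    · rw [hf.exp_apply, hf'.exp_apply]
    · have := hf.mono h₂
      have := hf'.mono.monotone h₁
      rw [hf.add_two_pi] at *
      linarith
    · have := hf'.mono h₂
      have := hf.mono.monotone h₁
      rw [hf'.add_two_pi] at *
      linarith
  obtain ⟨n, rfl⟩ := Circle.exp_eq_exp.1 h₃.symm
  rw [hf.add_int_mul, hf'.add_int_mul, key]

end IsLift

/-! ### Lifts of Möbius transformations -/

theorem exists_act_eq (M : SU11) : ∃ a b : ℂ, ‖b‖ < ‖a‖ ∧ a * star a - b * star b = 1 ∧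
    ∀ z, act M z = (a * z + b) / (star b * z + star a) := by
  have hdet : (M.1 : Matrix (Fin 2) (Fin 2) ℂ).det = 1 := M.1.2
  have h₁ := M.2.1
  have h₂ := M.2.2
  rw [Matrix.det_fin_two, h₁, h₂] at hdet
  refine ⟨(M.1 : Matrix (Fin 2) (Fin 2) ℂ) 0 0, (M.1 : Matrix (Fin 2) (Fin 2) ℂ) 0 1,
    ?_, hdet, fun z ↦ ?_⟩
  · rw [Complex.mul_conj, Complex.mul_conj, Complex.normSq_eq_norm_sq,
      Complex.normSq_eq_norm_sq] at hdet
    norm_cast at hdet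
    nlinarith [norm_nonneg ((M.1 : Matrix (Fin 2) (Fin 2) ℂ) 0 0),
      norm_nonneg ((M.1 : Matrix (Fin 2) (Fin 2) ℂ) 0 1)]
  · rw [act, h₁, h₂]
    rfl

theorem denom_ne_zero {a b z : ℂ} (hab : ‖b‖ < ‖a‖) (hz : ‖z‖ ≤ 1) :
    star b * z + star a ≠ 0 := by
  intro h
  have h₁ : star a = -(star b * z) := by linear_combination h
  have h₂ : ‖a‖ = ‖b‖ * ‖z‖ := by
    rw [← norm_star a, h₁, norm_neg, norm_mul, norm_star]
  nlinarith [norm_nonneg b, norm_nonneg z]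

theorem norm_exp_sub_exp (x y : ℝ) :
    ‖(Circle.exp x : ℂ) - Circle.exp y‖ = 2 * |sin ((x - y) / 2)| := by
  have h : (Circle.exp x : ℂ) - Circle.exp y =
      Circle.exp y * (Complex.exp (Complex.I * ((x - y : ℝ) : ℂ)) - 1) := by
    rw [Circle.coe_exp, Circle.coe_exp, mul_sub, ← Complex.exp_add]
    congr 2
    · push_cast; ring
    · simp
  rw [h, norm_mul, Circle.norm_coe, one_mul, Complex.norm_exp_I_mul_ofReal_sub_one, norm_mul]
  simp

theorem act_injOn (M : SU11) {z w : ℂ} (hz : ‖z‖ ≤ 1) (hw : ‖w‖ ≤ 1) (h : act M z = act M w) :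
    z = w := by
  obtain ⟨a, b, hab, hdet, hact⟩ := exists_act_eq M
  rw [hact, hact, div_eq_div_iff (denom_ne_zero hab hz) (denom_ne_zero hab hw)] at h
  linear_combination h - (z - w) * hdet

/-- Every Möbius transformation has a lift; chords are distorted by a multiplicative factor. -/
theorem exists_isLift (M : SU11) : ∃ f : ℝ → ℝ, Continuous f ∧ IsLift f (actS M) := by
  obtain ⟨a, b, hab, hdet, hact⟩ := exists_act_eq M
  have ha : a ≠ 0 := by
    rintro rfl
    simp at hab
    linarith [norm_nonneg b]
  -- On the circle the map is `z * (a / star a) * (r / star r)` with `r = 1 + (b / a) * star z`, so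
  -- a lift is `x + 2 arg a + 2 arg r`. As `‖b‖ < ‖a‖`, `r` stays in the right half-plane, where
  -- `arg` is continuous.
  set r : ℝ → ℂ := fun x ↦ 1 + b / a * Circle.exp (-x) with hr
  have hre : ∀ x, 0 < (r x).re := by
    intro x
    have h₁ : ‖b / a * Circle.exp (-x)‖ < 1 := by
      rw [norm_mul, Circle.norm_coe, mul_one, norm_div, div_lt_one (norm_pos_iff.2 ha)]
      exact hab
    have h₂ := Complex.abs_re_le_norm (b / a * Circle.exp (-x))
    have h₃ := (abs_le.1 h₂).1
    simp only [hr, Complex.add_re, Complex.one_re]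
    linarith
  set f : ℝ → ℝ := fun x ↦ x + 2 * a.arg + 2 * (r x).arg with hf
  have hcont : Continuous f := by
    have h₁ : Continuous fun x ↦ (r x).arg := by
      rw [continuous_iff_continuousAt]
      intro x
      have h₂ : ContinuousAt r x := by
        apply Continuous.continuousAt
        simp only [hr]
        fun_prop
      exact (Complex.continuousAt_arg (Or.inl (hre x))).comp h₂
    simp only [hf]
    fun_prop
  have hexp : ∀ x, Circle.exp (f x) = actS M (Circle.exp x) := by
    intro x
    apply Subtype.ext
    change (Circle.exp (f x) : ℂ) = act M _
    rw [hact]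
    have h₁ : ∀ z : ℂ, z ≠ 0 → Complex.exp (2 * z.arg * Complex.I) = z / star z := by
      intro z hz
      have h₂ := Complex.norm_mul_exp_arg_mul_I z
      have h₃ : star z ≠ 0 := by simpa using hz
      have h₄ : (‖z‖ : ℂ) ≠ 0 := by simpa using hz
      rw [eq_div_iff h₃]
      have h₅ : z * star z = ‖z‖ ^ 2 := Complex.mul_conj' z
      apply mul_left_cancel₀ hz
      rw [mul_left_comm, h₅]
      conv_rhs => rw [← h₂]
      rw [show (2 : ℂ) * z.arg * Complex.I = z.arg * Complex.I + z.arg * Complex.I by ring,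
        Complex.exp_add]
      ring
    have hr0 : r x ≠ 0 := fun h ↦ by have := hre x; simp [h] at this
    have h₂ : (Circle.exp (f x) : ℂ) = Circle.exp x * (a / star a) * (r x / star (r x)) := by
      rw [← h₁ a ha, ← h₁ _ hr0, Circle.coe_exp, Circle.coe_exp, ← Complex.exp_add,
        ← Complex.exp_add]
      congr 1
      simp only [hf]
      push_cast
      ring
    have h₃ : (Circle.exp (-x) : ℂ) = (Circle.exp x : ℂ)⁻¹ := by rw [Circle.exp_neg]; simp
    have h₄ : star (Circle.exp (-x) : ℂ) = Circle.exp x := by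
      rw [h₃]
      have := Circle.coe_inv_eq_conj (Circle.exp x)
      rw [Circle.coe_inv] at this
      rw [this]
      simp
    have hz : (Circle.exp x : ℂ) ≠ 0 := Circle.coe_ne_zero _
    have hsa : star a ≠ 0 := by simpa using ha
    have hden := denom_ne_zero hab (Circle.norm_coe (Circle.exp x)).le
    have h₅ : star (r x) = (star b * Circle.exp x + star a) / star a := by
      simp only [hr, star_add, star_mul', star_div₀, star_one, h₄]
      field_simp
      ring
    have h₆ : r x = (a * Circle.exp x + b) / (a * Circle.exp x) := by
      simp only [hr, h₃]
      field_simp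
    rw [h₂, h₅, h₆]
    field_simp
  have hadd : ∀ x, f (x + 2 * π) = f x + 2 * π := by
    intro x
    have : Circle.exp (-(x + 2 * π)) = Circle.exp (-x) := by
      rw [Circle.exp_neg, Circle.exp_add_two_pi, Circle.exp_neg]
    simp only [hf, hr, this]
    ring
  have hint : ∀ x (n : ℕ), f (x + n * (2 * π)) = f x + n * (2 * π) := by
    intro x n
    induction n with
    | zero => simp
    | succ n ih =>
      push_cast
      rw [show x + ((n : ℝ) + 1) * (2 * π) = x + n * (2 * π) + 2 * π by ring, hadd, ih]
      ring
  -- A continuous injective function is strictly monotone; translation by a full turn then excludes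
  -- the decreasing case.
  have hinj : Function.Injective f := by
    have key : ∀ x y, x ≤ y → f x = f y → x = y := by
      intro x y hxy h
      have h₁ : actS M (Circle.exp y) = actS M (Circle.exp x) := by rw [← hexp, ← hexp, h]
      have h₂ : Circle.exp y = Circle.exp x := by
        apply Subtype.ext
        exact act_injOn M (Circle.norm_coe _).le (Circle.norm_coe _).le (congrArg Subtype.val h₁)
      obtain ⟨n, rfl⟩ := Circle.exp_eq_exp.1 h₂
      have hn : 0 ≤ n := by
        by_contra hn
        have : (n : ℝ) ≤ -1 := by exact_mod_cast (by omega : n ≤ -1)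
        nlinarith [Real.pi_pos]
      lift n to ℕ using hn
      have h₃ := hint x n
      push_cast at h h₃ ⊢
      linarith
    intro x y h
    rcases le_total x y with hxy | hxy
    · exact key x y hxy h
    · exact (key y x hxy h.symm).symm
  refine ⟨f, hcont, ?_, hadd, hexp⟩
  rcases hcont.strictMono_of_inj hinj with h | h
  · exact h
  · exfalso
    have h₁ := h (show (0 : ℝ) < 0 + 2 * π by linarith [Real.pi_pos])
    rw [hadd] at h₁
    linarith [Real.pi_pos]

/-- The distortion of chords under a lift of a Möbius transformation. -/
theorem IsLift.exists_sin_eq {f : ℝ → ℝ} {M : SU11} (hf : IsLift f (actS M)) :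
    ∃ m : ℝ → ℝ, (∀ x, 0 < m x) ∧ ∀ x y, x ≤ y → y ≤ x + 2 * π →
      sin ((f y - f x) / 2) = m x * m y * sin ((y - x) / 2) := by
  obtain ⟨a, b, hab, hdet, hact⟩ := exists_act_eq M
  refine ⟨fun x ↦ ‖star b * (Circle.exp x : ℂ) + star a‖⁻¹, fun x ↦ ?_, fun x y h₁ h₂ ↦ ?_⟩
  · have := denom_ne_zero hab (Circle.norm_coe (Circle.exp x)).le
    positivity
  have e₁ := norm_exp_sub_exp (f y) (f x)
  have e₂ := norm_exp_sub_exp y x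
  rw [hf.exp_apply, hf.exp_apply] at e₁
  change ‖act M _ - act M _‖ = _ at e₁
  have dx := denom_ne_zero hab (Circle.norm_coe (Circle.exp x)).le
  have dy := denom_ne_zero hab (Circle.norm_coe (Circle.exp y)).le
  rw [hact, hact, div_sub_div _ _ dy dx, norm_div, norm_mul] at e₁
  -- Since the determinant is one, a difference of images is the original difference divided by the
  -- two denominators; their inverse norms are the factors `m`.
  have e₃ : (a * (Circle.exp y : ℂ) + b) * (star b * (Circle.exp x : ℂ) + star a) -
      (star b * (Circle.exp y : ℂ) + star a) * (a * (Circle.exp x : ℂ) + b) =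
      (Circle.exp y : ℂ) - Circle.exp x := by
    linear_combination ((Circle.exp y : ℂ) - Circle.exp x) * hdet
  rw [e₃, e₂] at e₁
  have f₁ := hf.mono.monotone h₁
  have f₂ := hf.mono.monotone h₂
  rw [hf.add_two_pi] at f₂
  rw [abs_of_nonneg (sin_nonneg_of_nonneg_of_le_pi (by linarith) (by linarith)),
    abs_of_nonneg (sin_nonneg_of_nonneg_of_le_pi (by linarith) (by linarith))] at e₁
  have nx := norm_pos_iff.2 dx
  have ny := norm_pos_iff.2 dy
  simp only
  field_simp
  field_simp at e₁
  linarith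

theorem IsLift.continuous {f : ℝ → ℝ} {M : SU11} (hf : IsLift f (actS M)) : Continuous f := by
  obtain ⟨f₀, hc, hf₀⟩ := exists_isLift M
  obtain ⟨n, hn⟩ := Circle.exp_eq_exp.1 ((hf.exp_apply 0).trans (hf₀.exp_apply 0).symm)
  rw [show f = fun x ↦ f₀ x + n * (2 * π) from funext (hf.eq_of_eq (hf₀.add_const n) hn)]
  fun_prop

theorem IsLift.surjective {f : ℝ → ℝ} {M : SU11} (hf : IsLift f (actS M)) :
    Function.Surjective f := by
  intro y
  have hc := hf.continuous
  obtain ⟨n, hn⟩ := exists_int_gt ((y - f 0) / (2 * π))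
  obtain ⟨k, hk⟩ := exists_int_lt ((y - f 0) / (2 * π))
  have hpi := Real.two_pi_pos
  rw [div_lt_iff₀ hpi] at hn
  rw [lt_div_iff₀ hpi] at hk
  have h₁ := hf.add_int_mul 0 n
  have h₂ := hf.add_int_mul 0 k
  exact mem_range_of_exists_le_of_exists_ge hc ⟨_, by rw [h₂]; linarith⟩ ⟨_, by rw [h₁]; linarith⟩

end BowenSeries

end

/-! ### The side function under Möbius transformations, and the projective model. -/

noncomputable section

namespace BowenSeries

open Real

/-! ### Composition of Möbius transformations -/

theorem act_mul (M M' : SU11) {z : ℂ} (hz : ‖z‖ ≤ 1) : act (M * M') z = act M (act M' z) := by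
  have h₁ := M'.2.1
  have h₂ := M'.2.2
  have hd : (M'.1 : Matrix (Fin 2) (Fin 2) ℂ) 1 0 * z + (M'.1 : Matrix (Fin 2) (Fin 2) ℂ) 1 1
      ≠ 0 := by
    obtain ⟨a, b, hab, hdet, hact⟩ := exists_act_eq M'
    have hdet : (M'.1 : Matrix (Fin 2) (Fin 2) ℂ).det = 1 := M'.1.2
    rw [Matrix.det_fin_two, h₁, h₂] at hdet
    rw [h₁, h₂]
    refine denom_ne_zero ?_ hz
    rw [Complex.mul_conj, Complex.mul_conj, Complex.normSq_eq_norm_sq,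
      Complex.normSq_eq_norm_sq] at hdet
    norm_cast at hdet
    nlinarith [norm_nonneg ((M'.1 : Matrix (Fin 2) (Fin 2) ℂ) 0 0),
      norm_nonneg ((M'.1 : Matrix (Fin 2) (Fin 2) ℂ) 0 1)]
  simp only [act, Subgroup.coe_mul, Matrix.SpecialLinearGroup.coe_mul, Matrix.mul_apply,
    Fin.sum_univ_two]
  generalize (M.1 : Matrix (Fin 2) (Fin 2) ℂ) 0 0 = a at *
  generalize (M.1 : Matrix (Fin 2) (Fin 2) ℂ) 0 1 = b at *
  generalize (M.1 : Matrix (Fin 2) (Fin 2) ℂ) 1 0 = c at *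
  generalize (M.1 : Matrix (Fin 2) (Fin 2) ℂ) 1 1 = d at *
  generalize (M'.1 : Matrix (Fin 2) (Fin 2) ℂ) 0 0 = a' at *
  generalize (M'.1 : Matrix (Fin 2) (Fin 2) ℂ) 0 1 = b' at *
  generalize (M'.1 : Matrix (Fin 2) (Fin 2) ℂ) 1 0 = c' at *
  generalize (M'.1 : Matrix (Fin 2) (Fin 2) ℂ) 1 1 = d' at *
  have n₁ : a * ((a' * z + b') / (c' * z + d')) + b =
      ((a * a' + b * c') * z + (a * b' + b * d')) / (c' * z + d') := by
    rw [mul_div_assoc', div_add' _ _ _ hd]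
    congr 1
    ring
  have n₂ : c * ((a' * z + b') / (c' * z + d')) + d =
      ((c * a' + d * c') * z + (c * b' + d * d')) / (c' * z + d') := by
    rw [mul_div_assoc', div_add' _ _ _ hd]
    congr 1
    ring
  rw [n₁, n₂, div_div_div_cancel_right₀ hd]

theorem act_one (z : ℂ) : act 1 z = z := by simp [act]

/-- Rests on `|star b * z + star a|² - |a * z + b|² = 1 - |z|²`. -/
theorem norm_act_lt_one (M : SU11) {z : ℂ} (hz : ‖z‖ < 1) : ‖act M z‖ < 1 := by
  obtain ⟨a, b, hab, hdet, hact⟩ := exists_act_eq M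
  have hd := denom_ne_zero hab hz.le
  rw [hact, norm_div, div_lt_one (norm_pos_iff.2 hd)]
  refine lt_of_pow_lt_pow_left₀ 2 (norm_nonneg _) ?_
  rw [← Complex.normSq_eq_norm_sq, ← Complex.normSq_eq_norm_sq]
  have key : Complex.normSq (star b * z + star a) - Complex.normSq (a * z + b) =
      1 - Complex.normSq z := by
    have h : ((Complex.normSq (star b * z + star a) - Complex.normSq (a * z + b) : ℝ) : ℂ) =
        ((1 - Complex.normSq z : ℝ) : ℂ) := by
      push_cast
      simp only [← Complex.mul_conj, map_add, map_mul, starRingEnd_apply, star_star] at hdet ⊢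
      linear_combination (1 - z * star z) * hdet
    exact_mod_cast h
  have : Complex.normSq z < 1 := by
    rw [Complex.normSq_eq_norm_sq]
    nlinarith [norm_nonneg z]
  linarith

theorem actS_mul (M M' : SU11) (x : Circle) : actS (M * M') x = actS M (actS M' x) :=
  Subtype.ext (act_mul M M' (Circle.norm_coe x).le)

theorem actS_one (x : Circle) : actS 1 x = x := Subtype.ext (act_one x)

theorem act_inv_act (M : SU11) {z : ℂ} (hz : ‖z‖ ≤ 1) : act M⁻¹ (act M z) = z := by
  rw [← act_mul _ _ hz, inv_mul_cancel, act_one]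

theorem act_act_inv (M : SU11) {z : ℂ} (hz : ‖z‖ ≤ 1) : act M (act M⁻¹ z) = z := by
  rw [← act_mul _ _ hz, mul_inv_cancel, act_one]

theorem actS_act_inv (M : SU11) (x : Circle) : actS M (actS M⁻¹ x) = x := by
  rw [← actS_mul, mul_inv_cancel, actS_one]

/-- A Möbius transformation that fixes the disk fixes the circle at infinity. -/
theorem ActsAsId.actS_eq {M : SU11} (h : ActsAsId M) (x : Circle) : actS M x = x := by
  obtain ⟨a, b, hab, hdet, hact⟩ := exists_act_eq M
  have hsa : star a ≠ 0 := by simpa using denom_ne_zero hab (z := 0) (by simp)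
  -- The fixed point `0` gives `b = 0`, and the fixed point `1 / 2` then gives `a = star a`.
  have h₀ : b = 0 := by
    have := h 0 (by simp)
    rw [hact, div_eq_zero_iff] at this
    simpa using this.resolve_right (by simpa using hsa)
  have h₁ : a = star a := by
    have := h (1 / 2) (by norm_num)
    rw [hact, h₀] at this
    simp only [star_zero, zero_mul, zero_add, add_zero] at this
    field_simp at this
    exact this
  apply Subtype.ext
  change act M x = x
  rw [hact, h₀, ← h₁]
  rw [← h₁] at hsa
  simp [hsa]

/-! ### The side function -/

/-- Exhibits the side function, up to sign, as the imaginary part of a product of differences. Under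
a Möbius transformation the denominators of these differences combine to a positive real number, so
the sign of the side function is invariant (`sideFn_act`). On the circle the real part vanishes as
well, which locates the zeros (`eq_or_eq_of_sideFn_eq_zero`). -/
theorem sub_mul_conj_sub_mul (x y : Circle) (z : ℂ) :
    (z - x) * star (z - y) * (1 - star (x : ℂ) * y) =
      (((‖z‖ ^ 2 - 1) * (1 - (star (x : ℂ) * y).re) : ℝ) : ℂ) - sideFn x y z * Complex.I := by
  have hx : (x : ℂ) * star (x : ℂ) = 1 := by
    have := Complex.mul_conj' (x : ℂ)
    rw [Circle.norm_coe] at this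
    simpa using this
  have hy : (y : ℂ) * star (y : ℂ) = 1 := by
    have := Complex.mul_conj' (y : ℂ)
    rw [Circle.norm_coe] at this
    simpa using this
  have hz : z * star z = ((‖z‖ ^ 2 : ℝ) : ℂ) := by
    have := Complex.mul_conj' z
    push_cast
    exact this
  have h : (z - x) * star (z - y) * (1 - star (x : ℂ) * y) =
      z * star z - 1 - (z * star (y : ℂ) - y * star z) - (x * star z - z * star (x : ℂ))
        + (x * star (y : ℂ) - z * star z * (star (x : ℂ) * y)) := by
    rw [star_sub]
    linear_combination (-1 : ℂ) * hx * (y * star (y : ℂ)) - hy + z * star (x : ℂ) * hy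
      + y * star z * hx
  rw [h, hz, sideFn]
  generalize (x : ℂ) = x at *
  generalize (y : ℂ) = y at *
  apply Complex.ext <;> simp [Complex.sq_norm, Complex.normSq_apply] <;> ring

theorem sideFn_act (M : SU11) {z : ℂ} (hz : ‖z‖ ≤ 1) (x y : Circle) :
    ∃ c : ℝ, 0 < c ∧ sideFn (actS M x) (actS M y) (act M z) = c * sideFn x y z := by
  obtain ⟨a, b, hab, hdet, hact⟩ := exists_act_eq M
  have dx := denom_ne_zero hab (Circle.norm_coe x).le
  have dy := denom_ne_zero hab (Circle.norm_coe y).le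
  have dz := denom_ne_zero hab hz
  have key : ∀ u v : ℂ, star b * u + star a ≠ 0 → star b * v + star a ≠ 0 →
      act M u - act M v = (u - v) / ((star b * u + star a) * (star b * v + star a)) := by
    intro u v hu hv
    rw [hact, hact, div_sub_div _ _ hu hv]
    congr 1
    linear_combination (u - v) * hdet
  have key' : 1 - star (act M x) * act M y =
      (1 - star (x : ℂ) * y) / (star (star b * x + star a) * (star b * y + star a)) := by
    have dx' : star (star b * x + star a) ≠ 0 := star_ne_zero.2 dx
    rw [hact, hact, star_div₀, div_mul_div_comm, eq_div_iff (mul_ne_zero dx' dy), sub_mul,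
      div_mul_cancel₀ _ (mul_ne_zero dx' dy)]
    simp only [star_add, star_mul', star_star]
    linear_combination (1 - star (x : ℂ) * y) * hdet
  have e := sub_mul_conj_sub_mul (actS M x) (actS M y) (act M z)
  change (act M z - act M x) * star (act M z - act M y) * (1 - star (act M x) * act M y) = _ at e
  rw [key z x dz dx, key z y dz dy, key'] at e
  set jx := star b * (x : ℂ) + star a
  set jy := star b * (y : ℂ) + star a
  set jz := star b * z + star a
  have e₂ : (z - x) / (jz * jx) * star ((z - y) / (jz * jy)) *
      ((1 - star (x : ℂ) * y) / (star jx * jy)) =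
      ((z - x) * star (z - y) * (1 - star (x : ℂ) * y)) /
        ((jx * star jx) * (jy * star jy) * (jz * star jz)) := by
    rw [star_div₀, star_mul', div_mul_div_comm, div_mul_div_comm]
    congr 1
    ring
  have nsq : ∀ w : ℂ, w * star w = ((‖w‖ ^ 2 : ℝ) : ℂ) := fun w ↦ by
    push_cast
    exact Complex.mul_conj' w
  rw [e₂, sub_mul_conj_sub_mul, nsq, nsq, nsq, ← Complex.ofReal_mul, ← Complex.ofReal_mul] at e
  refine ⟨(‖jx‖ ^ 2 * ‖jy‖ ^ 2 * ‖jz‖ ^ 2)⁻¹, ?_, ?_⟩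
  · have := norm_pos_iff.2 dx
    have := norm_pos_iff.2 dy
    have := norm_pos_iff.2 dz
    positivity
  · have e₃ := congrArg Complex.im e
    rw [Complex.div_ofReal_im] at e₃
    simp only [Complex.sub_im, Complex.ofReal_im, Complex.mul_im, Complex.ofReal_re,
      Complex.I_im, Complex.I_re] at e₃
    rw [inv_mul_eq_div]
    rw [show sideFn x y z / (‖jx‖ ^ 2 * ‖jy‖ ^ 2 * ‖jz‖ ^ 2) =
      -((0 - (sideFn x y z * 1 + 0 * 0)) / (‖jx‖ ^ 2 * ‖jy‖ ^ 2 * ‖jz‖ ^ 2)) by ring, e₃]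
    ring

theorem mem_geodesic_act {M : SU11} {x y : Circle} {z : ℂ} (h : z ∈ geodesic x y) :
    act M z ∈ geodesic (actS M x) (actS M y) := by
  obtain ⟨c, -, hc⟩ := sideFn_act M h.1.le x y
  exact ⟨norm_act_lt_one M h.1, by rw [hc, h.2, mul_zero]⟩

theorem sideFn_swap (x y : Circle) (z : ℂ) : sideFn y x z = -sideFn x y z := by
  simp [sideFn]
  ring

theorem sideFn_exp (a b x : ℝ) :
    sideFn (Circle.exp a) (Circle.exp b) (Circle.exp x) =
      8 * (sin ((b - a) / 2) * sin ((x - a) / 2) * sin ((x - b) / 2)) := by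
  have h : sideFn (Circle.exp a) (Circle.exp b) (Circle.exp x) =
      2 * (sin (a - x) - sin (b - x) - sin (a - b)) := by
    have e : ∀ u : ℝ, (Circle.exp u : ℂ) = ⟨cos u, sin u⟩ := fun u ↦ by
      rw [Circle.coe_exp]
      apply Complex.ext
      · exact Complex.exp_ofReal_mul_I_re u
      · exact Complex.exp_ofReal_mul_I_im u
    rw [sideFn, Circle.norm_coe, e, e, e, sin_sub, sin_sub, sin_sub]
    simp
    ring
  rw [h]
  obtain ⟨u, hu⟩ : ∃ u, u = (x - a) / 2 := ⟨_, rfl⟩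
  obtain ⟨v, hv⟩ : ∃ v, v = (x - b) / 2 := ⟨_, rfl⟩
  rw [← hu, ← hv, show a - x = -(2 * u) by linarith, show b - x = -(2 * v) by linarith,
    show a - b = -(2 * (u - v)) by linarith, show (b - a) / 2 = u - v by linarith, sin_neg, sin_neg,
    sin_neg, sin_two_mul, sin_two_mul, sin_two_mul, sin_sub, cos_sub]
  linear_combination 4 * sin u * cos u * sin_sq_add_cos_sq v - 4 * sin v * cos v *
    sin_sq_add_cos_sq u

theorem sideFn_exp_pos {a b x : ℝ} (h₁ : a < b) (h₂ : b < x) (h₃ : x < a + 2 * π) :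
    0 < sideFn (Circle.exp a) (Circle.exp b) (Circle.exp x) := by
  rw [sideFn_exp]
  have := sin_pos_of_pos_of_lt_pi (x := (b - a) / 2) (by linarith) (by linarith)
  have := sin_pos_of_pos_of_lt_pi (x := (x - a) / 2) (by linarith) (by linarith)
  have := sin_pos_of_pos_of_lt_pi (x := (x - b) / 2) (by linarith) (by linarith)
  positivity

theorem sideFn_exp_neg {a b x : ℝ} (h₁ : a < x) (h₂ : x < b) (h₃ : b < a + 2 * π) :
    sideFn (Circle.exp a) (Circle.exp b) (Circle.exp x) < 0 := by
  have h := sideFn_exp_pos h₁ h₂ h₃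
  rw [sideFn_exp] at h ⊢
  rw [show (x - b) / 2 = -((b - x) / 2) by ring, sin_neg]
  linarith

theorem sideFn_left (x y : Circle) : sideFn x y x = 0 := by
  have h := congrArg Complex.im (sub_mul_conj_sub_mul x y x)
  rw [Circle.norm_coe] at h
  simpa using h.symm

theorem eq_or_eq_of_sideFn_eq_zero {x y u : Circle} (hxy : x ≠ y) (h : sideFn x y u = 0) :
    u = x ∨ u = y := by
  have e := sub_mul_conj_sub_mul x y u
  rw [h, Circle.norm_coe] at e
  simp only [one_pow, sub_self, Complex.ofReal_zero, zero_mul, mul_eq_zero, star_eq_zero,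
    sub_eq_zero, Circle.coe_inj] at e
  rcases e with (e | e) | e
  · exact Or.inl e
  · exact Or.inr e
  · exfalso
    apply hxy
    apply Subtype.ext
    have hx : (x : ℂ) * star (x : ℂ) = 1 := by
      have := Complex.mul_conj' (x : ℂ)
      rw [Circle.norm_coe] at this
      simpa using this
    change (x : ℂ) = y
    linear_combination (x : ℂ) * e + y * hx

/-! ### The projective model -/

/-- `k` is the point of the projective disk model that corresponds to `z` in the conformal one. -/
def IsKlein (z k : ℂ) : Prop := 2 * z = (1 + ‖z‖ ^ 2 : ℝ) * k

/-- The projective coordinate absorbs the quadratic term. Geodesics become straight chords, and sign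
questions become questions about affine functions. -/
theorem IsKlein.sideFn_eq {z k : ℂ} (h : IsKlein z k) (x y : Circle) :
    sideFn x y z = (1 + ‖z‖ ^ 2) * (((x - y : ℂ) * star k).im - (x * star (y : ℂ)).im) := by
  have h₁ : 2 * ((x - y : ℂ) * star z).im = (1 + ‖z‖ ^ 2) * ((x - y : ℂ) * star k).im := by
    have h₂ := congrArg (fun w ↦ ((x - y : ℂ) * star w).im) h
    have h₃ : ∀ (r : ℝ) (w : ℂ), ((x - y : ℂ) * star (r * w)).im = r * ((x - y : ℂ) * star w).im := by
      intro r w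
      rw [star_mul', Complex.star_def, Complex.conj_ofReal, mul_left_comm, Complex.im_ofReal_mul]
    have h₄ := h₃ 2 z
    push_cast at h₄
    simp only [h₃, h₄] at h₂
    exact h₂
  rw [sideFn]
  change 2 * ((x - y : ℂ) * star z).im - (x * star (y : ℂ)).im * _ = _
  rw [h₁]
  ring

theorem isKlein_coe (x : Circle) : IsKlein x x := by
  rw [IsKlein, Circle.norm_coe]
  norm_num

end BowenSeries

end

/-! ### Chords and half-planes in the projective model. -/

noncomputable section

namespace BowenSeries

open Real

/-- The side function in the projective model; it is an affine function of `k`. -/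
def chordFn (x y : Circle) (k : ℂ) : ℝ := ((x - y : ℂ) * star k).im - (x * star (y : ℂ)).im

theorem IsKlein.sideFn_eq_chordFn {z k : ℂ} (h : IsKlein z k) (x y : Circle) :
    sideFn x y z = (1 + ‖z‖ ^ 2) * chordFn x y k := h.sideFn_eq x y

theorem sideFn_circle (x y u : Circle) : sideFn x y u = 2 * chordFn x y u := by
  rw [(isKlein_coe u).sideFn_eq_chordFn, Circle.norm_coe]
  norm_num

theorem chordFn_combination (x y : Circle) (u v : ℂ) (s : ℝ) :
    chordFn x y ((1 - s : ℝ) * u + (s : ℝ) * v) = (1 - s) * chordFn x y u + s * chordFn x y v := by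
  simp [chordFn]
  ring

theorem exists_isKlein_left {z : ℂ} (hz : ‖z‖ < 1) : ∃ k, ‖k‖ < 1 ∧ IsKlein z k := by
  have h : (0 : ℝ) < 1 + ‖z‖ ^ 2 := by positivity
  refine ⟨2 * z / (1 + ‖z‖ ^ 2 : ℝ), ?_, ?_⟩
  · rw [norm_div, Complex.norm_real, Real.norm_of_nonneg h.le, div_lt_one h, norm_mul]
    simp only [Complex.norm_ofNat]
    nlinarith [sq_nonneg (1 - ‖z‖), sq_pos_of_pos (sub_pos.2 hz)]
  · rw [IsKlein, mul_div_cancel₀ _ (by exact_mod_cast h.ne')]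

theorem exists_isKlein_right {k : ℂ} (hk : ‖k‖ < 1) : ∃ z, ‖z‖ < 1 ∧ IsKlein z k := by
  have h₀ : 0 < 1 - ‖k‖ ^ 2 := by nlinarith [norm_nonneg k]
  obtain ⟨r, hr, hr2⟩ : ∃ r : ℝ, 0 < r ∧ r ^ 2 = 1 - ‖k‖ ^ 2 :=
    ⟨√(1 - ‖k‖ ^ 2), Real.sqrt_pos.2 h₀, Real.sq_sqrt h₀.le⟩
  have hn : ‖k / (1 + r : ℝ)‖ ^ 2 = (1 - r) / (1 + r) := by
    rw [norm_div, Complex.norm_real, Real.norm_of_nonneg (by linarith), div_pow,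
      div_eq_div_iff (by positivity) (by positivity)]
    linear_combination (1 + r) * hr2
  refine ⟨k / (1 + r : ℝ), ?_, ?_⟩
  · have : ‖k / (1 + r : ℝ)‖ ^ 2 < 1 := by
      rw [hn, div_lt_one (by linarith)]
      linarith
    nlinarith [norm_nonneg (k / (1 + r : ℝ))]
  · have h₁ : 1 + (1 - r) / (1 + r) = 2 / (1 + r) := by
      field_simp
      ring
    have h₂ : ((1 + r : ℝ) : ℂ) ≠ 0 := by exact_mod_cast (by linarith : (1 + r) ≠ 0)
    rw [IsKlein, hn, h₁, Complex.ofReal_div]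
    push_cast at h₂ ⊢
    field_simp

/-- Points of a geodesic lie on the chord of its end points in the projective model. -/
theorem exists_chord {x y : Circle} (hxy : x ≠ y) {z : ℂ} (hz : z ∈ geodesic x y) :
    ∃ s : ℝ, 0 < s ∧ s < 1 ∧ IsKlein z ((1 - s : ℝ) * x + (s : ℝ) * y) := by
  obtain ⟨k, hk, hzk⟩ := exists_isKlein_left hz.1
  have h₀ : chordFn x y k = 0 := by
    have h := hzk.sideFn_eq_chordFn x y
    rw [hz.2, eq_comm, mul_eq_zero] at h
    exact h.resolve_left (by positivity)
  have hne : (y : ℂ) - x ≠ 0 := by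
    rw [sub_ne_zero]
    exact fun h ↦ hxy (Circle.coe_inj.1 h.symm)
  have him : ((k - x) / (y - x)).im = 0 := by
    have h₁ : ((k - x) / (y - x)).im = ((k - x) * star (y - x : ℂ)).im / Complex.normSq (y - x) := by
      rw [Complex.div_im, Complex.mul_im]
      simp
      ring
    have h₂ : ((k - x) * star (y - x : ℂ)).im = chordFn x y k := by
      simp [chordFn]
      ring
    rw [h₁, h₂, h₀, zero_div]
  obtain ⟨s, hs⟩ : ∃ s : ℝ, (k - x) / (y - x) = s :=
    ⟨((k - x) / (y - x)).re, Complex.ext rfl (by simpa using him)⟩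
  have hks : k = (1 - s : ℝ) * x + (s : ℝ) * y := by
    rw [div_eq_iff hne] at hs
    push_cast
    linear_combination hs
  -- With this identity `‖k‖ < 1` forces `s * (1 - s) > 0`, so `k` lies between the end points of
  -- the chord.
  have hnorm : Complex.normSq k = 1 - s * (1 - s) * Complex.normSq (y - x) := by
    have hx : Complex.normSq x = 1 := Circle.normSq_coe x
    have hy : Complex.normSq y = 1 := Circle.normSq_coe y
    rw [hks]
    simp only [Complex.normSq_apply] at hx hy ⊢
    simp
    linear_combination (1 - s) * hx + s * hy
  have hpos : 0 < s * (1 - s) := by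
    rw [Complex.normSq_eq_norm_sq] at hnorm
    by_contra hle
    nlinarith [norm_nonneg k, Complex.normSq_nonneg ((y : ℂ) - x)]
  have hs0 : 0 < s := by
    by_contra h
    nlinarith
  have hs1 : s < 1 := by
    by_contra h
    nlinarith
  exact ⟨s, hs0, hs1, hks ▸ hzk⟩

theorem sideFn_pos_of_mem_geodesic {a b x y : Circle} (hxy : x ≠ y) {z : ℂ}
    (hz : z ∈ geodesic x y) (hx : 0 ≤ sideFn a b x) (hy : 0 ≤ sideFn a b y)
    (h : 0 < sideFn a b x ∨ 0 < sideFn a b y) : 0 < sideFn a b z := by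
  obtain ⟨s, hs₀, hs₁, hs⟩ := exists_chord hxy hz
  rw [hs.sideFn_eq_chordFn, chordFn_combination]
  rw [sideFn_circle] at hx hy h
  rw [sideFn_circle] at h
  have : 0 < (1 - s) * chordFn a b x + s * chordFn a b y := by
    rcases h with h | h
    · have := mul_pos (sub_pos.2 hs₁) (by linarith : 0 < chordFn a b x)
      have := mul_nonneg hs₀.le (by linarith : 0 ≤ chordFn a b y)
      linarith
    · have := mul_nonneg (sub_pos.2 hs₁).le (by linarith : 0 ≤ chordFn a b x)
      have := mul_pos hs₀ (by linarith : 0 < chordFn a b y)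
      linarith
  positivity

/-- Two geodesics with two common points have the same end points. -/
theorem sideFn_eq_zero_of_two_points {a b x y c d : Circle} (hxy : x ≠ y) {z w : ℂ}
    (hz : z ∈ geodesic x y) (hw : w ∈ geodesic x y) (hz' : sideFn a b z = 0)
    (hw' : sideFn a b w = 0) (hzc : sideFn c d z = 0) (hwc : sideFn c d w ≠ 0) :
    sideFn a b x = 0 ∧ sideFn a b y = 0 := by
  obtain ⟨s, -, -, hs⟩ := exists_chord hxy hz
  obtain ⟨r, -, -, hr⟩ := exists_chord hxy hw
  have key : ∀ {v k : ℂ} {e f : Circle}, IsKlein v k → (sideFn e f v = 0 ↔ chordFn e f k = 0) := by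
    intro v k e f h
    rw [h.sideFn_eq_chordFn, mul_eq_zero, or_iff_right (by positivity)]
  rw [key hs, chordFn_combination] at hz' hzc
  rw [key hr, chordFn_combination] at hw'
  rw [Ne, key hr, chordFn_combination] at hwc
  have hsr : s ≠ r := by
    rintro rfl
    exact hwc hzc
  have h₁ : (s - r) * (chordFn a b y - chordFn a b x) = 0 := by linarith
  have h₂ := (mul_eq_zero.1 h₁).resolve_left (sub_ne_zero.2 hsr)
  rw [sideFn_circle, sideFn_circle]
  constructor
  · linear_combination 2 * hz' - 2 * s * h₂
  · linear_combination 2 * hz' + 2 * (1 - s) * h₂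

/-- The order of two points along a geodesic that crosses a third one. -/
theorem chord_order {a b x y : Circle} {z w : ℂ} {s r : ℝ}
    (hs : IsKlein z ((1 - s : ℝ) * x + (s : ℝ) * y))
    (hr : IsKlein w ((1 - r : ℝ) * x + (r : ℝ) * y))
    (hx : sideFn a b x < 0) (hy : 0 < sideFn a b y) (hz : sideFn a b z = 0)
    (hw : 0 < sideFn a b w) : s < r := by
  rw [sideFn_circle] at hx hy
  rw [hs.sideFn_eq_chordFn, chordFn_combination, mul_eq_zero,
    or_iff_right (by positivity)] at hz
  rw [hr.sideFn_eq_chordFn, chordFn_combination, mul_pos_iff_of_pos_left (by positivity)] at hw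
  by_contra h
  have h := not_lt.1 h
  nlinarith [mul_nonneg (sub_nonneg.2 h) (by linarith : 0 ≤ chordFn a b y - chordFn a b x)]

/-- From a point on the boundary of an intersection of half planes one can enter its interior
along a ray whose end point lies in the half planes that have the point on their boundary. -/
theorem exists_mem_geodesic_forall_pos {ι : Type*} [Finite ι] (P Q : ι → Circle) {v : ℂ}
    {e f : Circle} (hv : v ∈ geodesic e f)
    (h : ∀ l, 0 < sideFn (P l) (Q l) v ∨
      0 ≤ sideFn (P l) (Q l) v ∧ 0 < sideFn (P l) (Q l) (e : ℂ)) :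
    ∃ z ∈ geodesic e f, ∀ l, 0 < sideFn (P l) (Q l) z := by
  obtain ⟨k, hk, hvk⟩ := exists_isKlein_left hv.1
  -- Move from `k` towards `e` by a small fraction `s`. Strict inequalities persist by continuity,
  -- and the others become strict because of the positive value at `e`; there are finitely many, so
  -- one `s` serves for all.
  have hev : ∀ l, ∀ᶠ s : ℝ in nhdsWithin 0 (Set.Ioi 0),
      0 < (1 - s) * chordFn (P l) (Q l) k + s * chordFn (P l) (Q l) e := by
    intro l
    have hl := h l
    rw [hvk.sideFn_eq_chordFn, sideFn_circle] at hl
    have hp : 0 < 1 + ‖v‖ ^ 2 := by positivity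
    rw [mul_pos_iff_of_pos_left hp, mul_nonneg_iff_of_pos_left hp] at hl
    rcases hl with hl | ⟨hl, hl'⟩
    · have hc : Continuous fun s : ℝ ↦
          (1 - s) * chordFn (P l) (Q l) k + s * chordFn (P l) (Q l) e := by fun_prop
      have h₀ : (0 : ℝ) < (1 - 0) * chordFn (P l) (Q l) k + 0 * chordFn (P l) (Q l) e := by
        simpa using hl
      exact (hc.continuousAt.eventually (lt_mem_nhds h₀)).filter_mono nhdsWithin_le_nhds
    · have h₁ : ∀ᶠ s : ℝ in nhdsWithin 0 (Set.Ioi 0), s < 1 :=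
        (eventually_lt_nhds one_pos).filter_mono nhdsWithin_le_nhds
      filter_upwards [h₁, self_mem_nhdsWithin] with s hs hs0
      have := mul_nonneg (sub_nonneg.2 hs.le) hl
      have := mul_pos hs0 (by linarith : 0 < chordFn (P l) (Q l) e)
      linarith
  have h₁ : ∀ᶠ s : ℝ in nhdsWithin 0 (Set.Ioi 0), s < 1 :=
    (eventually_lt_nhds one_pos).filter_mono nhdsWithin_le_nhds
  obtain ⟨s, hs, hs1, hs0⟩ := ((Filter.eventually_all.2 hev).and
    (h₁.and self_mem_nhdsWithin)).exists
  have hs0 : 0 < s := hs0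
  have hnorm : ‖((1 - s : ℝ) : ℂ) * k + (s : ℝ) * (e : ℂ)‖ < 1 := by
    refine (norm_add_le _ _).trans_lt ?_
    rw [norm_mul, norm_mul, Complex.norm_real, Complex.norm_real, Circle.norm_coe,
      Real.norm_of_nonneg hs0.le, Real.norm_of_nonneg (by linarith)]
    nlinarith
  obtain ⟨z, hz, hzk⟩ := exists_isKlein_right hnorm
  refine ⟨z, ⟨hz, ?_⟩, fun l ↦ ?_⟩
  · rw [hzk.sideFn_eq_chordFn, chordFn_combination]
    have h₂ := hv.2
    rw [hvk.sideFn_eq_chordFn, mul_eq_zero, or_iff_right (by positivity)] at h₂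
    have h₃ := sideFn_left e f
    rw [sideFn_circle] at h₃
    rw [h₂, (by linarith : chordFn e f e = 0)]
    ring
  · rw [hzk.sideFn_eq_chordFn, chordFn_combination]
    have := hs l
    positivity

theorem continuous_sideFn (x y : Circle) : Continuous (sideFn x y) := by
  unfold sideFn
  fun_prop

theorem act_mem_interior_image_polygon {g : ℕ} (hg : 2 ≤ g) {P Q : Idx g → Circle} (M : SU11)
    {z : ℂ} (hz : ‖z‖ < 1) (h : ∀ l, 0 < sideFn (P l) (Q (l + 1)) z) :
    act M z ∈ interior (act M '' polygon P Q) := by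
  have : NeZero (8 * g - 4) := ⟨by omega⟩
  rw [mem_interior]
  refine ⟨{y | ‖y‖ < 1} ∩ ⋂ l, {y | 0 < sideFn (actS M (P l)) (actS M (Q (l + 1))) y}, ?_, ?_, ?_⟩
  · rintro y ⟨hy, hy'⟩
    rw [Set.mem_iInter] at hy'
    refine ⟨act M⁻¹ y, ⟨norm_act_lt_one _ hy, fun l ↦ ?_⟩, act_act_inv M (le_of_lt hy)⟩
    obtain ⟨c, hc, hc'⟩ := sideFn_act M (norm_act_lt_one M⁻¹ hy).le (P l) (Q (l + 1))
    rw [act_act_inv M (le_of_lt hy)] at hc'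
    have h₁ := hy' l
    rw [Set.mem_ofPred_eq, hc'] at h₁
    exact (pos_of_mul_pos_right h₁ hc.le).le
  · refine (isOpen_lt continuous_norm continuous_const).inter (isOpen_iInter_of_finite fun l ↦ ?_)
    exact isOpen_lt continuous_const (continuous_sideFn _ _)
  · refine ⟨norm_act_lt_one _ hz, Set.mem_iInter.2 fun l ↦ ?_⟩
    obtain ⟨c, hc, hc'⟩ := sideFn_act M hz.le (P l) (Q (l + 1))
    rw [Set.mem_ofPred_eq, hc']
    exact mul_pos hc (h l)

end BowenSeries

end

/-! ### Integer indices, end points on the universal cover, and vertices. -/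

noncomputable section

namespace BowenSeries

open Real

/-! ### Integer indices -/

/-- The number `8g-4` of sides. -/
def per (g : ℕ) : ℤ := 8 * g - 4

/-- The lift of `σ` to integer indices. -/
def sigZ (g : ℕ) (n : ℤ) : ℤ := if Odd n then 4 * g - n else 2 - n

variable {g : ℕ}

theorem sigZ_cases (g : ℕ) (n : ℤ) :
    Odd n ∧ sigZ g n = 4 * g - n ∨ Even n ∧ sigZ g n = 2 - n := by
  unfold sigZ
  split_ifs with h
  · exact Or.inl ⟨h, rfl⟩
  · exact Or.inr ⟨Int.not_odd_iff_even.1 h, rfl⟩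

theorem sigZ_sigZ (g : ℕ) (n : ℤ) : sigZ g (sigZ g n) = n := by
  rcases sigZ_cases g n with ⟨h, e⟩ | ⟨h, e⟩ <;>
  rcases sigZ_cases g (sigZ g n) with ⟨h', e'⟩ | ⟨h', e'⟩ <;> rw [e'] <;> rw [e] at * <;> grind

/-- On each parity class `σ` is a reflection, and the period is even; hence the minus sign. -/
theorem sigZ_add_per (g : ℕ) (n : ℤ) : sigZ g (n + per g) = sigZ g n - per g := by
  unfold per
  rcases sigZ_cases g n with ⟨h, e⟩ | ⟨h, e⟩ <;>
  rcases sigZ_cases g (n + (8 * g - 4)) with ⟨h', e'⟩ | ⟨h', e'⟩ <;> rw [e, e'] <;> grind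

theorem natCast_sub_eq_per (hg : 2 ≤ g) : ((8 * g - 4 : ℕ) : ℤ) = per g := by
  unfold per
  omega

theorem per_cast (hg : 2 ≤ g) : ((per g : ℤ) : Idx g) = 0 := by
  rw [← natCast_sub_eq_per hg, Int.cast_natCast]
  exact ZMod.natCast_self _

theorem cast_add_per (hg : 2 ≤ g) (n : ℤ) : ((n + per g : ℤ) : Idx g) = n := by
  rw [Int.cast_add, per_cast hg, add_zero]

theorem cast_eq_cast_of_dvd (hg : 2 ≤ g) {m n : ℤ} (h : per g ∣ m - n) : (m : Idx g) = n := by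
  obtain ⟨k, hk⟩ := h
  rw [show m = n + per g * k by linarith, Int.cast_add, Int.cast_mul, per_cast hg]
  simp

/-- Every index has a representative in a prescribed period. -/
theorem exists_cast_eq (hg : 2 ≤ g) (i : Idx g) (n : ℤ) :
    ∃ k : ℤ, 0 ≤ k ∧ k < per g ∧ ((n + k : ℤ) : Idx g) = i := by
  have : NeZero (8 * g - 4) := ⟨by omega⟩
  have hN : 0 < per g := by unfold per; omega
  refine ⟨(i.val - n) % per g, Int.emod_nonneg _ hN.ne', Int.emod_lt_of_pos _ hN, ?_⟩
  rw [cast_eq_cast_of_dvd hg (n := (i.val : ℤ))]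
  · simp
  · have := Int.emod_add_mul_ediv (i.val - n) (per g)
    exact ⟨-((i.val - n) / per g), by linarith⟩

theorem sig_cast (hg : 2 ≤ g) (n : ℤ) : sig (n : Idx g) = (sigZ g n : ℤ) := by
  have : NeZero (8 * g - 4) := ⟨by omega⟩
  have hval : ((n : Idx g).val : ℤ) = n % per g := by
    rw [ZMod.val_intCast, natCast_sub_eq_per hg]
  have hodd : Odd (n : Idx g).val ↔ Odd n := by
    rw [← Int.odd_coe_nat, hval]
    have := Int.emod_add_mul_ediv n (per g)
    have he : Even (per g) := ⟨4 * g - 2, by unfold per; ring⟩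
    conv_rhs => rw [← this]
    rw [Int.odd_add, iff_true_right (he.mul_right _)]
  unfold sig sigZ
  simp only [hodd]
  split_ifs <;> push_cast <;> rfl

theorem rho_cast (hg : 2 ≤ g) (n : ℤ) : rho (n : Idx g) = ((sigZ g n + 1 : ℤ) : Idx g) := by
  rw [rho, sig_cast hg]
  push_cast
  rfl

theorem tau_cast (hg : 2 ≤ g) (n : ℤ) : tau (n : Idx g) = ((n + (4 * g - 2) : ℤ) : Idx g) := by
  have : ((4 * g - 2 : ℕ) : ℤ) = 4 * g - 2 := by omega
  rw [tau, ← Int.cast_natCast, this]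
  push_cast
  rfl

namespace SurfacePolygon

variable (S : SurfacePolygon g)

theorem twelve_le_per (S : SurfacePolygon g) : 12 ≤ per g := by
  have := S.two_le
  unfold per
  omega

/-! ### The end points on the universal cover -/

/-- Lifts of the points `X n` that lie in one period when `n` does. -/
def lift (X : Idx g → Circle) (n : ℤ) : ℝ :=
  Complex.arg (S.P 1) + ccw (S.P 1) (X n) + ((n - 1) / per g : ℤ) * (2 * π)

/-- The lifts of the points `P n`. -/
def p : ℤ → ℝ := S.lift S.P

/-- The lifts of the points `Q n`. -/
def q : ℤ → ℝ := S.lift S.Q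

theorem exp_arg_add_ccw (a x : Circle) : Circle.exp (Complex.arg a + ccw a x) = x := by
  rw [ccw, toIcoMod, ← add_sub_assoc, zsmul_eq_mul, sub_eq_add_neg, ← neg_mul, ← Int.cast_neg,
    exp_add_int_mul, Circle.exp_add, Circle.exp_arg, Circle.exp_arg]
  simp

theorem exp_lift (X : Idx g → Circle) (n : ℤ) : Circle.exp (S.lift X n) = X n := by
  rw [lift, exp_add_int_mul, exp_arg_add_ccw]

theorem lift_add_per (X : Idx g → Circle) (n : ℤ) :
    S.lift X (n + per g) = S.lift X n + 2 * π := by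
  have h : (n + per g - 1) / per g = (n - 1) / per g + 1 := by
    rw [show n + per g - 1 = n - 1 + 1 * per g by ring, Int.add_mul_ediv_right]
    have := S.twelve_le_per
    omega
  rw [lift, lift, cast_add_per S.two_le, h]
  push_cast
  ring

@[simp] theorem exp_p (n : ℤ) : Circle.exp (S.p n) = S.P n := S.exp_lift _ n

@[simp] theorem exp_q (n : ℤ) : Circle.exp (S.q n) = S.Q n := S.exp_lift _ n

theorem p_add_per (n : ℤ) : S.p (n + per g) = S.p n + 2 * π := S.lift_add_per _ n

theorem q_add_per (n : ℤ) : S.q (n + per g) = S.q n + 2 * π := S.lift_add_per _ n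

theorem exists_eq_one_add (S : SurfacePolygon g) (n : ℤ) : ∃ (k : ℕ) (a : ℤ), k < 8 * g - 4 ∧ n = 1 + k + a * per g := by
  have hN := S.twelve_le_per
  have h₀ := Int.emod_nonneg (n - 1) (by omega : per g ≠ 0)
  have h₁ := Int.emod_lt_of_pos (n - 1) (by omega : 0 < per g)
  have h₂ := Int.emod_add_mul_ediv (n - 1) (per g)
  have h₃ := natCast_sub_eq_per S.two_le
  refine ⟨((n - 1) % per g).toNat, (n - 1) / per g, by omega, ?_⟩
  rw [Int.toNat_of_nonneg h₀]
  linarith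

theorem lift_one_add (X : Idx g → Circle) (k : ℕ) (a : ℤ) (hk : k < 8 * g - 4) :
    S.lift X (1 + k + a * per g) =
      Complex.arg (S.P 1) + ccw (S.P 1) (X (1 + (k : Idx g))) + a * (2 * π) := by
  have h₃ := natCast_sub_eq_per S.two_le
  have h : (1 + (k : ℤ) + a * per g - 1) / per g = a := by
    rw [show 1 + (k : ℤ) + a * per g - 1 = k + a * per g by ring, Int.add_mul_ediv_right _ _
      (by have := S.twelve_le_per; omega), Int.ediv_eq_zero_of_lt (by omega) (by omega)]
    ring
  have h' : ((1 + k + a * per g : ℤ) : Idx g) = 1 + (k : Idx g) := by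
    push_cast
    rw [per_cast S.two_le]
    simp
  rw [lift, h, h']

theorem p_lt_q_self (n : ℤ) : S.p n < S.q n := by
  obtain ⟨k, a, hk, rfl⟩ := S.exists_eq_one_add n
  rw [p, q, S.lift_one_add _ k a hk, S.lift_one_add _ k a hk]
  linarith [S.order_PQ k hk]

theorem ccw_lt_two_pi (a x : Circle) : ccw a x < 2 * π := by
  have := toIcoMod_lt_right Real.two_pi_pos 0 (Complex.arg (x / a : Circle))
  rw [zero_add] at this
  exact this

theorem ccw_nonneg (a x : Circle) : 0 ≤ ccw a x := left_le_toIcoMod Real.two_pi_pos 0 _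

theorem q_lt_p_succ (n : ℤ) : S.q n < S.p (n + 1) := by
  obtain ⟨k, a, hk, rfl⟩ := S.exists_eq_one_add n
  by_cases hk' : k + 1 < 8 * g - 4
  · rw [show 1 + (k : ℤ) + a * per g + 1 = 1 + (k + 1 : ℕ) + a * per g by push_cast; ring, p, q,
      S.lift_one_add _ k a hk, S.lift_one_add _ (k + 1) a hk']
    linarith [S.order_QP k hk']
  · have h₃ := natCast_sub_eq_per S.two_le
    rw [show 1 + (k : ℤ) + a * per g + 1 = 1 + (0 : ℕ) + (a + 1) * per g by
      rw [← h₃, show 8 * g - 4 = k + 1 by omega]; push_cast; ring, p, q,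
      S.lift_one_add _ k a hk, S.lift_one_add _ 0 (a + 1) (by omega)]
    have h₁ := ccw_lt_two_pi (S.P 1) (S.Q (1 + (k : Idx g)))
    have h₂ := ccw_nonneg (S.P 1) (S.P (1 + ((0 : ℕ) : Idx g)))
    push_cast at h₁ h₂ ⊢
    linarith

theorem p_strictMono : StrictMono S.p :=
  strictMono_int_of_lt_succ fun n ↦ (S.p_lt_q_self n).trans (S.q_lt_p_succ n)

theorem q_strictMono : StrictMono S.q :=
  strictMono_int_of_lt_succ fun n ↦ (S.q_lt_p_succ n).trans (S.p_lt_q_self (n + 1))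

variable {S}

theorem p_le {m n : ℤ} (h : m ≤ n) : S.p m ≤ S.p n := S.p_strictMono.monotone h

theorem q_le {m n : ℤ} (h : m ≤ n) : S.q m ≤ S.q n := S.q_strictMono.monotone h

theorem p_lt_q {m n : ℤ} (h : m ≤ n) : S.p m < S.q n := (p_le h).trans_lt (S.p_lt_q_self n)

theorem q_lt_p {m n : ℤ} (h : m < n) : S.q m < S.p n := (S.q_lt_p_succ m).trans_le (p_le h)

theorem p_lt {m n : ℤ} (h : m < n) : S.p m < S.p n := S.p_strictMono h

theorem q_lt {m n : ℤ} (h : m < n) : S.q m < S.q n := S.q_strictMono h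

variable (S)

theorem p_sub_per (n : ℤ) : S.p (n - per g) = S.p n - 2 * π := by
  have := S.p_add_per (n - per g)
  rw [sub_add_cancel] at this
  linarith

theorem q_sub_per (n : ℤ) : S.q (n - per g) = S.q n - 2 * π := by
  have := S.q_add_per (n - per g)
  rw [sub_add_cancel] at this
  linarith

/-! ### Vertices -/

theorem V_mem_geodesic_pred (n : ℤ) : S.V n ∈ geodesic (S.P (n - 1 : ℤ)) (S.Q n) := by
  have := S.V_mem_left n
  push_cast
  exact this

theorem V_mem_geodesic (n : ℤ) : S.V n ∈ geodesic (S.P n) (S.Q (n + 1 : ℤ)) := by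
  have := S.V_mem_right n
  push_cast
  exact this

theorem V_mem_geodesic_pred' {m n : ℤ} (h : m + 1 = n) :
    S.V n ∈ geodesic (S.P m) (S.Q n) := by
  have := S.V_mem_geodesic_pred n
  rwa [show n - 1 = m by omega] at this

theorem sideFn_exp_pos {l m : ℤ} (hm : l + 1 = m) {x : ℝ} (h₁ : S.q m < x)
    (h₂ : x < S.p (l + per g)) : 0 < sideFn (S.P l) (S.Q m) (Circle.exp x) := by
  rw [← exp_p, ← exp_q]
  rw [p_add_per] at h₂
  exact BowenSeries.sideFn_exp_pos (p_lt_q (by omega)) h₁ h₂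

theorem sideFn_exp_neg {l m : ℤ} (hm : l + 1 = m) {x : ℝ} (h₁ : S.p l < x) (h₂ : x < S.q m) :
    sideFn (S.P l) (S.Q m) (Circle.exp x) < 0 := by
  rw [← exp_p, ← exp_q]
  have := S.twelve_le_per
  refine BowenSeries.sideFn_exp_neg h₁ h₂ ?_
  rw [← p_add_per]
  exact q_lt_p (by omega)

theorem P_ne_Q {l m : ℤ} (h₁ : l ≤ m) (h₂ : m < l + per g) : S.P l ≠ S.Q m := by
  rw [← exp_p, ← exp_q]
  intro h
  have h₃ : S.p l < S.q m := p_lt_q h₁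
  have h₄ : S.q m < S.p l + 2 * π := by
    rw [← p_add_per]
    exact q_lt_p h₂
  exact h₃.ne (eq_of_exp_eq h (by linarith [Real.pi_pos]) h₄)

/-- A vertex lies strictly to the left of the lines of all sides that do not contain it. -/
theorem sideFn_V_pos {n l m : ℤ} (h₁ : n < l) (h₂ : l + 1 < n + per g) (hm : l + 1 = m) :
    0 < sideFn (S.P l) (S.Q m) (S.V n) := by
  have hN := S.twelve_le_per
  -- The vertex lies on the lines of sides `n - 1` and `n`. The former has both ends on the left of
  -- line `l` unless `l` is `n - 2` modulo the period, where the two lines cross; in that case the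
  -- line of side `n` serves.
  by_cases hl : l + 2 = n + per g
  · refine sideFn_pos_of_mem_geodesic (S.P_ne_Q (l := n) (m := n + 1) (by omega) (by omega))
      (S.V_mem_geodesic n) (le_of_lt ?_) (le_of_lt ?_) (Or.inl ?_)
    · rw [← cast_add_per S.two_le n, ← S.exp_p (n + per g)]
      exact S.sideFn_exp_pos hm (q_lt_p (by omega)) (p_lt (by omega))
    · rw [← cast_add_per S.two_le (n + 1), ← S.exp_q (n + 1 + per g)]
      exact S.sideFn_exp_pos hm (q_lt (by omega)) (q_lt_p (by omega))
    · rw [← cast_add_per S.two_le n, ← S.exp_p (n + per g)]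
      exact S.sideFn_exp_pos hm (q_lt_p (by omega)) (p_lt (by omega))
  · refine sideFn_pos_of_mem_geodesic (S.P_ne_Q (l := n - 1) (m := n) (by omega) (by omega))
      (S.V_mem_geodesic_pred n) (le_of_lt ?_) (le_of_lt ?_) (Or.inl ?_)
    · rw [← cast_add_per S.two_le (n - 1), ← S.exp_p (n - 1 + per g)]
      exact S.sideFn_exp_pos hm (q_lt_p (by omega)) (p_lt (by omega))
    · rw [← cast_add_per S.two_le n, ← S.exp_q (n + per g)]
      exact S.sideFn_exp_pos hm (q_lt (by omega)) (q_lt_p (by omega))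
    · rw [← cast_add_per S.two_le (n - 1), ← S.exp_p (n - 1 + per g)]
      exact S.sideFn_exp_pos hm (q_lt_p (by omega)) (p_lt (by omega))

theorem norm_V_lt_one (n : ℤ) : ‖S.V n‖ < 1 := (S.V_mem_geodesic n).1

theorem act_T_V (n : ℤ) : act (S.T n) (S.V n) = S.V (sigZ g n + 1 : ℤ) := by
  rw [S.T_V, rho_cast S.two_le]

theorem act_T_act_T_sig (n : ℤ) {z : ℂ} (hz : ‖z‖ < 1) :
    act (S.T n) (act (S.T (sigZ g n : ℤ)) z) = z := by
  rw [← act_mul _ _ hz.le]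
  have h := S.T_inv (sigZ g n : ℤ)
  rw [sig_cast S.two_le, sigZ_sigZ] at h
  exact h z hz

theorem act_T_V_succ (n : ℤ) : act (S.T n) (S.V (n + 1 : ℤ)) = S.V (sigZ g n : ℤ) := by
  have h := S.act_T_V (sigZ g n)
  rw [sigZ_sigZ] at h
  rw [← h, S.act_T_act_T_sig n (S.norm_V_lt_one _)]

theorem actS_T_actS_T_sig (n : ℤ) (x : Circle) :
    actS (S.T (sigZ g n : ℤ)) (actS (S.T n) x) = x := by
  rw [← actS_mul, ← sig_cast S.two_le]
  exact (S.T_inv n).actS_eq x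

theorem actS_injective (M : SU11) : Function.Injective (actS M) := fun x y h ↦
  Subtype.ext (act_injOn M (Circle.norm_coe x).le (Circle.norm_coe y).le (congrArg Subtype.val h))

/-- The vertices `V n` and `V (n + 1)` are met in this order along the line of side `n`. -/
theorem chord_order_act (M : SU11) (n : ℤ) {z w : ℂ} {a b : ℝ}
    (ha : IsKlein z ((1 - a : ℝ) * actS M (S.P n) + (a : ℝ) * actS M (S.Q (n + 1 : ℤ))))
    (hb : IsKlein w ((1 - b : ℝ) * actS M (S.P n) + (b : ℝ) * actS M (S.Q (n + 1 : ℤ))))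
    (hz : z = act M (S.V n)) (hw : w = act M (S.V (n + 1 : ℤ))) : a < b := by
  have hN := S.twelve_le_per
  have key := fun (z : ℂ) (hz : ‖z‖ ≤ 1) ↦ sideFn_act M hz (S.P (n - 1 : ℤ)) (S.Q n)
  refine chord_order (a := actS M (S.P (n - 1 : ℤ))) (b := actS M (S.Q n)) ha hb ?_ ?_ ?_ ?_
  · obtain ⟨c, hc, e⟩ := key (S.P n) (Circle.norm_coe _).le
    refine e.trans_lt (mul_neg_of_pos_of_neg hc ?_)
    have := S.sideFn_exp_neg (l := n - 1) (m := n) (x := S.p n) (by omega) (p_lt (by omega))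
      (p_lt_q le_rfl)
    rwa [exp_p] at this
  · obtain ⟨c, hc, e⟩ := key (S.Q (n + 1 : ℤ)) (Circle.norm_coe _).le
    refine (mul_pos hc ?_).trans_eq e.symm
    have := S.sideFn_exp_pos (l := n - 1) (m := n) (x := S.q (n + 1)) (by omega) (q_lt (by omega))
      (q_lt_p (by omega))
    rwa [exp_q] at this
  · obtain ⟨c, hc, e⟩ := key (S.V n) (S.norm_V_lt_one n).le
    rw [hz, e, (S.V_mem_geodesic_pred n).2, mul_zero]
  · obtain ⟨c, hc, e⟩ := key (S.V (n + 1 : ℤ)) (S.norm_V_lt_one _).le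
    rw [hw, e]
    have := S.sideFn_V_pos (n := n + 1) (l := n - 1 + per g) (m := n + per g) (by omega) (by omega)
      (by ring)
    rw [cast_add_per S.two_le, cast_add_per S.two_le] at this
    exact mul_pos hc this

/-- The side pairing maps the line of side `n` to the line of side `σ(n)` with the opposite
orientation. -/
theorem actS_T_P_and_Q (n : ℤ) : actS (S.T n) (S.P n) = S.Q (sigZ g n + 1 : ℤ) ∧
    actS (S.T n) (S.Q (n + 1 : ℤ)) = S.P (sigZ g n : ℤ) := by
  have hN := S.twelve_le_per
  set s := sigZ g n with hs
  set x := actS (S.T n) (S.P n) with hx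
  set y := actS (S.T n) (S.Q (n + 1 : ℤ)) with hy
  have hxy : x ≠ y := fun h ↦ S.P_ne_Q (l := n) (m := n + 1) (by omega) (by omega)
    (actS_injective _ h)
  have hz : S.V (s + 1 : ℤ) ∈ geodesic x y := by
    rw [← act_T_V]
    exact mem_geodesic_act (S.V_mem_geodesic n)
  have hw : S.V (s : ℤ) ∈ geodesic x y := by
    rw [hs, ← act_T_V_succ]
    exact mem_geodesic_act (S.V_mem_geodesic_pred' rfl)
  -- Both lines contain the vertices `s` and `s + 1`; these are distinct because the line of side `s
  -- + 1` passes through only one of them.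
  obtain ⟨hx0, hy0⟩ := sideFn_eq_zero_of_two_points hxy hz hw
    (S.V_mem_geodesic_pred' rfl).2 (S.V_mem_geodesic s).2 (S.V_mem_geodesic (s + 1)).2
    (S.sideFn_V_pos (n := s) (l := s + 1) (by omega) (by omega) rfl).ne'
  have hPQ := S.P_ne_Q (l := s) (m := s + 1) (by omega) (by omega)
  rcases eq_or_eq_of_sideFn_eq_zero hPQ hx0 with h | h
  -- If the orientation were preserved, the vertices `s` and `s + 1` would occur in both orders
  -- along one oriented line.
  · exfalso
    have h' : y = S.Q (s + 1 : ℤ) := by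
      rcases eq_or_eq_of_sideFn_eq_zero hPQ hy0 with h' | h'
      · exact absurd (h.trans h'.symm) hxy
      · exact h'
    obtain ⟨a, -, -, ha⟩ := exists_chord hxy hz
    obtain ⟨b, -, -, hb⟩ := exists_chord hxy hw
    have h₁ : a < b := S.chord_order_act (S.T n) n ha hb (S.act_T_V n).symm
      (S.act_T_V_succ n).symm
    rw [h, h'] at ha hb
    have h₂ : b < a := S.chord_order_act 1 s (by rwa [actS_one, actS_one])
      (by rwa [actS_one, actS_one]) (act_one _).symm (act_one _).symm
    exact lt_asymm h₁ h₂
  · refine ⟨h, ?_⟩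
    rcases eq_or_eq_of_sideFn_eq_zero hPQ hy0 with h' | h'
    · exact h'
    · exact absurd (h.trans h'.symm) hxy

/-- Consequence of the extension condition: a line through a vertex of a tile that does not meet
the interior of the tile does not enter the sector of the tile at this vertex. -/
theorem actS_exp_ne {γ : SU11} {n : ℤ} {x y : Circle}
    (hd : Disjoint (geodesic x y) (interior (act γ '' polygon S.P S.Q)))
    (hV : act γ (S.V n) ∈ geodesic x y) {e : ℝ} (h₁ : S.q (n + 1) < e)
    (h₂ : e < S.p (n - 1 + per g)) : actS γ (Circle.exp e) ≠ x := by
  have hN := S.twelve_le_per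
  have : NeZero (8 * g - 4) := ⟨by have := S.two_le; omega⟩
  rintro rfl
  have hV' : S.V n ∈ geodesic (Circle.exp e) (actS γ⁻¹ y) := by
    have h := mem_geodesic_act (M := γ⁻¹) hV
    rwa [act_inv_act γ (S.norm_V_lt_one n).le, ← actS_mul, inv_mul_cancel, actS_one] at h
  -- Only the lines of sides `n - 1` and `n` pass through the vertex, and `exp e` is on the left of
  -- both. So the ray towards `exp e` enters the open polygon, and its image under `γ` is on the
  -- line inside the tile.
  obtain ⟨z, hz, hz'⟩ := exists_mem_geodesic_forall_pos S.P (fun l ↦ S.Q (l + 1)) hV' (by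
    intro l
    obtain ⟨k, hk₀, hk₁, rfl⟩ := exists_cast_eq S.two_le l n
    have hcast : ((n + k : ℤ) : Idx g) + 1 = ((n + k + 1 : ℤ) : Idx g) := by push_cast; rfl
    rw [hcast]
    by_cases h0 : k = 0
    · subst h0
      rw [add_zero, (S.V_mem_geodesic n).2]
      exact Or.inr ⟨le_rfl, S.sideFn_exp_pos rfl h₁ (h₂.trans (p_lt (by omega)))⟩
    by_cases h1 : k = per g - 1
    · subst h1
      rw [show n + (per g - 1) = n - 1 + per g by ring,
        show n - 1 + per g + 1 = n + per g by ring, cast_add_per S.two_le, cast_add_per S.two_le,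
        (S.V_mem_geodesic_pred n).2]
      exact Or.inr ⟨le_rfl, S.sideFn_exp_pos (by omega) ((q_lt (by omega)).trans h₁) h₂⟩
    · exact Or.inl (S.sideFn_V_pos (by omega) (by omega) rfl))
  have h₃ := act_mem_interior_image_polygon S.two_le γ hz.1 hz'
  have h₄ := mem_geodesic_act (M := γ) hz
  rw [actS_act_inv] at h₄
  exact Set.disjoint_left.1 hd h₄ h₃

end SurfacePolygon

end BowenSeries

end

/-! ### Lifts of the side pairings and their exact values at end points. -/

noncomputable section

namespace BowenSeries

open Real

theorem eq_add_two_pi_of_exp_eq {x y : ℝ} (h : Circle.exp x = Circle.exp y) (h₁ : y < x)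
    (h₂ : x ≤ y + 2 * π) : x = y + 2 * π := by
  rcases h₂.lt_or_eq with h₃ | h₃
  · exact absurd (eq_of_exp_eq h h₃ (by linarith [Real.pi_pos])) h₁.ne'
  · exact h₃

variable {g : ℕ}

namespace SurfacePolygon

variable (S : SurfacePolygon g)

/-! ### Lifts of the side pairings -/

theorem exists_t (n : ℤ) : ∃ f : ℝ → ℝ, IsLift f (actS (S.T n)) ∧
    f (S.p n) = S.q (sigZ g n + 1) := by
  obtain ⟨f, -, hf⟩ := exists_isLift (S.T n)
  have h : Circle.exp (S.q (sigZ g n + 1)) = Circle.exp (f (S.p n)) := by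
    rw [hf.exp_apply, exp_p, exp_q, (S.actS_T_P_and_Q n).1]
  obtain ⟨m, hm⟩ := Circle.exp_eq_exp.1 h
  exact ⟨_, hf.add_const m, hm.symm⟩

/-- The lift of the side pairing `T n` that maps `p n` to `q (σ(n) + 1)`. -/
def t (n : ℤ) : ℝ → ℝ := (S.exists_t n).choose

theorem isLift_t (n : ℤ) : IsLift (S.t n) (actS (S.T n)) := (S.exists_t n).choose_spec.1

theorem t_p (n : ℤ) : S.t n (S.p n) = S.q (sigZ g n + 1) := (S.exists_t n).choose_spec.2

theorem t_lt (n : ℤ) {x y : ℝ} : S.t n x < S.t n y ↔ x < y := (S.isLift_t n).mono.lt_iff_lt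

theorem t_le (n : ℤ) {x y : ℝ} : S.t n x ≤ S.t n y ↔ x ≤ y := (S.isLift_t n).mono.le_iff_le

theorem t_add_two_pi (n : ℤ) (x : ℝ) : S.t n (x + 2 * π) = S.t n x + 2 * π :=
  (S.isLift_t n).add_two_pi x

theorem t_sub_two_pi (n : ℤ) (x : ℝ) : S.t n (x - 2 * π) = S.t n x - 2 * π :=
  (S.isLift_t n).sub_two_pi x

theorem exp_t (n : ℤ) (x : ℝ) : Circle.exp (S.t n x) = actS (S.T n) (Circle.exp x) :=
  (S.isLift_t n).exp_apply x

theorem t_surjective (n : ℤ) : Function.Surjective (S.t n) := (S.isLift_t n).surjective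

/-- Only the choice of lift is at stake. As `q (n + 1)` lies less than a turn after `p n`, its image
lies less than a turn after `q (σ(n) + 1)`, which singles out the translate by one period. -/
theorem t_q_succ (n : ℤ) : S.t n (S.q (n + 1)) = S.p (sigZ g n + per g) := by
  have hN := S.twelve_le_per
  have h₁ : S.p n < S.q (n + 1) := p_lt_q (by omega)
  have h₂ : S.q (n + 1) < S.p (n + per g) := q_lt_p (by omega)
  have h₃ : S.q (sigZ g n + 1) < S.p (sigZ g n + per g) := q_lt_p (by omega)
  have h₄ : S.p (sigZ g n + per g) < S.q (sigZ g n + 1 + per g) := p_lt_q (by omega)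
  rw [← S.t_lt n, t_p] at h₁
  rw [← S.t_lt n, p_add_per, t_add_two_pi, t_p] at h₂
  rw [q_add_per] at h₄
  apply eq_of_exp_eq
  · rw [exp_t, exp_q, exp_p, cast_add_per S.two_le, (S.actS_T_P_and_Q n).2]
  · linarith
  · linarith

/-- A full turn appears because of the normalisation: `p n` goes to `q (σ(n) + 1)` and then to `p (n
+ per g)`. -/
theorem t_sig (n : ℤ) (x : ℝ) : S.t (sigZ g n) (S.t n x) = x + 2 * π := by
  have h₁ : IsLift (S.t (sigZ g n) ∘ S.t n) id := by
    have h := (S.isLift_t (sigZ g n)).comp (S.isLift_t n)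
    rwa [show actS (S.T (sigZ g n : ℤ)) ∘ actS (S.T n) = id from
      funext fun x ↦ S.actS_T_actS_T_sig n x] at h
  have h₂ := h₁.eq_of_eq (IsLift.id_add 1) (x₀ := S.p n) (by
    simp only [Function.comp, t_p, t_q_succ, sigZ_sigZ, p_add_per]
    push_cast
    ring) x
  simpa using h₂

theorem t_sig' (n : ℤ) (x : ℝ) : S.t n (S.t (sigZ g n) x) = x + 2 * π := by
  have h := S.t_sig (sigZ g n) x
  rwa [sigZ_sigZ] at h

/-- One turn is lost because the source `p n` advances by a period, the other because `σ(n)` recedes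
by one. -/
theorem t_add_per (n : ℤ) (x : ℝ) : S.t (n + per g) x = S.t n x - 4 * π := by
  have h₁ := S.isLift_t (n + per g)
  rw [cast_add_per S.two_le] at h₁
  have h₂ := h₁.eq_of_eq ((S.isLift_t n).add_const (-2)) (x₀ := S.p (n + per g)) (by
    rw [t_p, p_add_per, t_add_two_pi, t_p, sigZ_add_per, show sigZ g n - per g + 1 =
      sigZ g n + 1 - per g by ring, q_sub_per]
    push_cast
    ring) x
  rw [h₂]
  push_cast
  ring

theorem T_mem (n : ℤ) : S.T n ∈ Subgroup.closure (Set.range S.T) :=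
  Subgroup.subset_closure ⟨_, rfl⟩

theorem p_lt_t_p_pred (n : ℤ) : S.p (sigZ g n) < S.t n (S.p (n - 1)) := by
  have hN := S.twelve_le_per
  have h : S.q (n + 1) < S.p (n - 1 + per g) := q_lt_p (by omega)
  rw [← S.t_lt n, t_q_succ, p_add_per, p_add_per, t_add_two_pi] at h
  linarith

/-- The line of side `σ(n) + 1` passes through the vertex `σ(n) + 1` of the tile `T n F`. If the
inequality failed, this line would enter the sector of the tile there, against the extension
condition. -/
theorem t_p_pred_le (n : ℤ) : S.t n (S.p (n - 1)) ≤ S.p (sigZ g n + 1) := by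
  by_contra! h
  obtain ⟨e, he⟩ := S.t_surjective n (S.p (sigZ g n + 1 + per g))
  have h₁ : S.q (n + 1) < e := by
    rw [← S.t_lt n, t_q_succ, he]
    exact p_lt (by omega)
  have h₂ : e < S.p (n - 1 + per g) := by
    rw [← S.t_lt n, he, p_add_per, p_add_per, t_add_two_pi]
    linarith
  have hd := S.extension _ (S.T_mem n) ((sigZ g n + 1 : ℤ) : Idx g)
  refine S.actS_exp_ne hd ?_ h₁ h₂ ?_
  · rw [act_T_V]
    exact S.V_mem_right _
  · rw [← exp_t, he, exp_p, cast_add_per S.two_le]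

theorem q_lt_t_q (n : ℤ) : S.q (sigZ g n + 1) < S.t n (S.q n) := by
  rw [← t_p, t_lt]
  exact p_lt_q le_rfl

theorem geodesic_swap (x y : Circle) : geodesic x y = geodesic y x := by
  ext z
  simp only [geodesic, Set.mem_ofPred_eq, sideFn_swap y x z, neg_eq_zero]

/-- The same argument for the inverse of `T n`: the tile is the preimage of the polygon, its vertex
is `V n`, and the line is that of side `n - 1`, traversed backwards. -/
theorem t_q_le (n : ℤ) : S.t n (S.q n) ≤ S.q (sigZ g n + 2) := by
  by_contra! h
  have h₁ : S.t n (S.q n) < S.p (sigZ g n + 1 - 1 + per g) := by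
    rw [add_sub_cancel_right, ← t_q_succ, t_lt]
    exact q_lt (by omega)
  have hd := S.extension _ (inv_mem (S.T_mem n)) ((n - 1 : ℤ) : Idx g)
  have hcast : ((n - 1 : ℤ) : Idx g) + 1 = (n : Idx g) := by push_cast; ring
  rw [hcast, geodesic_swap] at hd
  refine S.actS_exp_ne (n := sigZ g n + 1) hd ?_ (by rwa [add_assoc]) h₁ ?_
  · rw [← act_T_V, act_inv_act _ (S.norm_V_lt_one n).le, geodesic_swap]
    exact S.V_mem_geodesic_pred n
  · rw [exp_t, exp_q, ← actS_mul, inv_mul_cancel, actS_one]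

theorem t_cycle_lift (n : ℤ) {a b c : ℤ} (ha : a = sigZ g n + 1) (hb : b = sigZ g a + 1)
    (hc : c = sigZ g b + 1) : IsLift (S.t c ∘ S.t b ∘ S.t a ∘ S.t n) id := by
  have h := (S.isLift_t c).comp ((S.isLift_t b).comp ((S.isLift_t a).comp (S.isLift_t n)))
  have e : actS (S.T c) ∘ actS (S.T b) ∘ actS (S.T a) ∘ actS (S.T n) = id := by
    funext x
    have h₁ := (S.T_cycle n).actS_eq x
    rw [rho_cast S.two_le, ← ha, rho_cast S.two_le, ← hb, rho_cast S.two_le, ← hc, actS_mul,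
      actS_mul, actS_mul] at h₁
    exact h₁
  rwa [e] at h

/-- The cycle of `ρ` closes after four steps, but on integers it drifts by one period, in a
direction given by the parity of `n`. -/
theorem cycle_index (n : ℤ) {a b c d : ℤ} (ha : a = sigZ g n + 1) (hb : b = sigZ g a + 1)
    (hc : c = sigZ g b + 1) (hd : d = sigZ g c + 1) : d = n + per g ∨ d = n - per g := by
  unfold per
  rcases sigZ_cases g n with ⟨h₁, e₁⟩ | ⟨h₁, e₁⟩ <;>
  rcases sigZ_cases g a with ⟨h₂, e₂⟩ | ⟨h₂, e₂⟩ <;>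
  rcases sigZ_cases g b with ⟨h₃, e₃⟩ | ⟨h₃, e₃⟩ <;>
  rcases sigZ_cases g c with ⟨h₄, e₄⟩ | ⟨h₄, e₄⟩ <;> grind

/-- By the relations of length four, the angle inequalities of the extension condition are
equalities. -/
theorem t_p_pred (n : ℤ) : S.t n (S.p (n - 1)) = S.p (sigZ g n + 1) := by
  obtain ⟨a, ha⟩ : ∃ a, a = sigZ g n + 1 := ⟨_, rfl⟩
  obtain ⟨b, hb⟩ : ∃ b, b = sigZ g a + 1 := ⟨_, rfl⟩
  obtain ⟨c, hc⟩ : ∃ c, c = sigZ g b + 1 := ⟨_, rfl⟩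
  obtain ⟨d, hd⟩ : ∃ d, d = sigZ g c + 1 := ⟨_, rfl⟩
  have hlift := S.t_cycle_lift n ha hb hc
  have hcast : (((d - 1 : ℤ)) : Idx g) = ((n - 1 : ℤ) : Idx g) := by
    refine cast_eq_cast_of_dvd S.two_le ?_
    rcases cycle_index n ha hb hc hd with h | h
    · exact ⟨1, by omega⟩
    · exact ⟨-1, by omega⟩
  have hexp : Circle.exp (S.t c (S.t b (S.t a (S.t n (S.p (n - 1)))))) =
      Circle.exp (S.p (d - 1)) := by
    have := hlift.exp_apply (S.p (n - 1))
    simp only [Function.comp, id, exp_p] at this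
    rw [this, exp_p, hcast]
  have up₁ := S.t_p_pred_le n
  rw [← ha] at up₁
  have lo : S.p (d - 1) < S.t c (S.t b (S.t a (S.t n (S.p (n - 1))))) := by
    have h₁ := S.p_lt_t_p_pred n
    have h₂ := S.p_lt_t_p_pred a
    have h₃ := S.p_lt_t_p_pred b
    have h₄ := S.p_lt_t_p_pred c
    rw [show sigZ g n = a - 1 by omega, ← S.t_lt a] at h₁
    rw [show sigZ g a = b - 1 by omega] at h₂
    rw [show sigZ g b = c - 1 by omega] at h₃
    rw [show sigZ g c = d - 1 by omega] at h₄
    have h₅ := (S.t_lt b).2 (h₂.trans h₁)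
    exact h₄.trans ((S.t_lt c).2 (h₃.trans h₅))
  -- Two of the values around the cycle are known exactly; `t_q_le` bounds the one between them.
  have up : S.t c (S.t b (S.t a (S.p a))) ≤ S.p (d - 1) + 2 * π := by
    have h₁ := (S.t_le c).2 (S.t_q_le b)
    rw [show sigZ g b + 2 = c + 1 by omega, t_q_succ, p_add_per, show sigZ g c = d - 1 by omega]
      at h₁
    rw [t_p, ← hb]
    exact h₁
  have up' : S.t c (S.t b (S.t a (S.t n (S.p (n - 1))))) ≤ S.t c (S.t b (S.t a (S.p a))) := by
    rwa [t_le, t_le, t_le]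
  -- The composite is trivial on the circle and lands above `p (d - 1)` by more than nothing and at
  -- most a turn, hence by exactly a turn. No inequality in the chain can be strict.
  have e := eq_add_two_pi_of_exp_eq hexp lo (up'.trans up)
  rw [← ha]
  refine le_antisymm up₁ ?_
  rw [← S.t_le a, ← S.t_le b, ← S.t_le c, e]
  exact up

/-- The same squeeze around the relation of length four; now the upper bound is evaluated exactly by
`t_p_pred`. -/
theorem t_q (n : ℤ) : S.t n (S.q n) = S.q (sigZ g n + 2) := by
  obtain ⟨a, ha⟩ : ∃ a, a = sigZ g n + 1 := ⟨_, rfl⟩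
  obtain ⟨b, hb⟩ : ∃ b, b = sigZ g a + 1 := ⟨_, rfl⟩
  obtain ⟨c, hc⟩ : ∃ c, c = sigZ g b + 1 := ⟨_, rfl⟩
  obtain ⟨d, hd⟩ : ∃ d, d = sigZ g c + 1 := ⟨_, rfl⟩
  have hlift := S.t_cycle_lift n ha hb hc
  have hcast : (d : Idx g) = (n : Idx g) := by
    refine cast_eq_cast_of_dvd S.two_le ?_
    rcases cycle_index n ha hb hc hd with h | h
    · exact ⟨1, by omega⟩
    · exact ⟨-1, by omega⟩
  have hexp : Circle.exp (S.t c (S.t b (S.t a (S.t n (S.q n))))) = Circle.exp (S.q d) := by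
    have := hlift.exp_apply (S.q n)
    simp only [Function.comp, id, exp_q] at this
    rw [this, exp_q, hcast]
  have up₁ := S.t_q_le n
  rw [show sigZ g n + 2 = a + 1 by omega] at up₁
  have lo : S.q d < S.t c (S.t b (S.t a (S.t n (S.q n)))) := by
    have h₁ := S.q_lt_t_q n
    have h₂ := S.q_lt_t_q a
    have h₃ := S.q_lt_t_q b
    have h₄ := S.q_lt_t_q c
    rw [← ha, ← S.t_lt a] at h₁
    rw [← hb] at h₂
    rw [← hc] at h₃
    rw [← hd] at h₄
    have h₅ := (S.t_lt b).2 (h₂.trans h₁)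
    exact h₄.trans ((S.t_lt c).2 (h₃.trans h₅))
  have up : S.t c (S.t b (S.t a (S.q (a + 1)))) ≤ S.q d + 2 * π := by
    rw [t_q_succ, p_add_per, t_add_two_pi, t_add_two_pi, show sigZ g a = b - 1 by omega, t_p_pred,
      ← hc, t_p, ← hd]
  have up' : S.t c (S.t b (S.t a (S.t n (S.q n)))) ≤ S.t c (S.t b (S.t a (S.q (a + 1)))) := by
    rwa [t_le, t_le, t_le]
  have e := eq_add_two_pi_of_exp_eq hexp lo (up'.trans up)
  rw [show sigZ g n + 2 = a + 1 by omega]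
  refine le_antisymm up₁ ?_
  rw [← S.t_le a, ← S.t_le b, ← S.t_le c, e]
  exact up

theorem t_q_succ_succ (n : ℤ) : S.t n (S.q (n + 2)) = S.q (sigZ g n + per g) := by
  have h := S.t_q (sigZ g n)
  rw [sigZ_sigZ] at h
  rw [← h, t_sig', q_add_per]

end SurfacePolygon

end BowenSeries

end

/-! ### The cross ratio, and existence and uniqueness of the points `G`. -/

noncomputable section

namespace BowenSeries

open Real

/-! ### The cross ratio of four points of the circle -/

/-- The cross ratio of the points `exp a`, `exp x`, `exp y`, `exp b`. -/
def crossRatio (a x y b : ℝ) : ℝ :=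
  sin ((y - a) / 2) / sin ((x - a) / 2) * (sin ((b - x) / 2) / sin ((b - y) / 2))

/-- The quotient is `cos d + sin d * cot v`, and the cotangent decreases. -/
theorem sin_div_sin_lt {u v d : ℝ} (hu : 0 < u) (huv : u < v) (hd : 0 < d) (hv : v + d < π) :
    sin (v + d) / sin v < sin (u + d) / sin u := by
  have h₁ := sin_pos_of_pos_of_lt_pi hu (by linarith)
  have h₂ := sin_pos_of_pos_of_lt_pi (hu.trans huv) (by linarith)
  have h₃ := sin_pos_of_pos_of_lt_pi hd (by linarith)
  have h₄ := sin_pos_of_pos_of_lt_pi (sub_pos.2 huv) (by linarith)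
  rw [div_lt_div_iff₀ h₂ h₁]
  have : sin (u + d) * sin v - sin (v + d) * sin u = sin d * sin (v - u) := by
    rw [sin_add, sin_add, sin_sub]
    ring
  nlinarith [mul_pos h₃ h₄]

/-- Monotonicity of the Hilbert metric: points are closer in a larger arc. Each end of the arc
affects one of the two factors. -/
theorem crossRatio_lt_crossRatio {a a' x y b b' : ℝ} (ha : a' ≤ a) (hx : a < x) (hxy : x < y)
    (hy : y < b) (hb : b ≤ b') (h : b' < a' + 2 * π) (hne : a' < a ∨ b < b') :
    crossRatio a' x y b' < crossRatio a x y b := by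
  have s₁ : ∀ {u v : ℝ}, u < v → v < u + 2 * π → 0 < sin ((v - u) / 2) := fun h₁ h₂ ↦
    sin_pos_of_pos_of_lt_pi (by linarith) (by linarith)
  have l₁ : ∀ c, c < a → a' ≤ c →
      sin ((y - c) / 2) / sin ((x - c) / 2) < sin ((y - a) / 2) / sin ((x - a) / 2) := by
    intro c hc hc'
    have := sin_div_sin_lt (u := (x - a) / 2) (v := (x - c) / 2) (d := (y - x) / 2)
      (by linarith) (by linarith) (by linarith) (by linarith)
    rwa [show (x - c) / 2 + (y - x) / 2 = (y - c) / 2 by ring,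
      show (x - a) / 2 + (y - x) / 2 = (y - a) / 2 by ring] at this
  have l₂ : ∀ c, b < c → c ≤ b' →
      sin ((c - x) / 2) / sin ((c - y) / 2) < sin ((b - x) / 2) / sin ((b - y) / 2) := by
    intro c hc hc'
    have := sin_div_sin_lt (u := (b - y) / 2) (v := (c - y) / 2) (d := (y - x) / 2)
      (by linarith) (by linarith) (by linarith) (by linarith)
    rwa [show (c - y) / 2 + (y - x) / 2 = (c - x) / 2 by ring,
      show (b - y) / 2 + (y - x) / 2 = (b - x) / 2 by ring] at this
  have pos₁ : 0 < sin ((y - a') / 2) / sin ((x - a') / 2) :=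
    div_pos (s₁ (by linarith) (by linarith)) (s₁ (by linarith) (by linarith))
  have pos₂ : 0 < sin ((b' - x) / 2) / sin ((b' - y) / 2) :=
    div_pos (s₁ (by linarith) (by linarith)) (s₁ (by linarith) (by linarith))
  unfold crossRatio
  rcases ha.lt_or_eq with ha' | rfl
  · refine mul_lt_mul (l₁ a' ha' le_rfl) ?_ pos₂ (pos₁.trans (l₁ a' ha' le_rfl)).le
    rcases hb.lt_or_eq with hb' | rfl
    · exact (l₂ b' hb' le_rfl).le
    · exact le_rfl
  · have hb' := hne.resolve_left (lt_irrefl _)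
    exact mul_lt_mul_of_pos_left (l₂ b' hb' le_rfl) pos₁

/-- Each point occurs once in a numerator and once in a denominator, so the distortion factors of
the chords cancel. -/
theorem IsLift.crossRatio_eq {f : ℝ → ℝ} {M : SU11} (hf : IsLift f (actS M)) {a x y b : ℝ}
    (hx : a < x) (hxy : x < y) (hy : y < b) (h : b < a + 2 * π) :
    crossRatio (f a) (f x) (f y) (f b) = crossRatio a x y b := by
  obtain ⟨m, hm, hsin⟩ := hf.exists_sin_eq
  have s₁ : ∀ {u v : ℝ}, u < v → v < u + 2 * π → sin ((v - u) / 2) ≠ 0 := fun h₁ h₂ ↦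
    (sin_pos_of_pos_of_lt_pi (by linarith) (by linarith)).ne'
  unfold crossRatio
  rw [hsin a y (by linarith) (by linarith), hsin a x (by linarith) (by linarith),
    hsin x b (by linarith) (by linarith), hsin y b (by linarith) (by linarith)]
  have := s₁ hx (by linarith)
  have := s₁ hy (by linarith)
  have := (hm a).ne'
  have := (hm b).ne'
  have := (hm x).ne'
  have := (hm y).ne'
  field_simp

variable {g : ℕ}

/-- Eliminates `τ` from the system once it is indexed by `n = σ(i)`. -/
theorem tau_sigZ_cast (hg : 2 ≤ g) (n : ℤ) :
    tau ((sigZ g n : ℤ) : Idx g) = ((sigZ g (n - 1) - 1 : ℤ) : Idx g) := by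
  rw [tau_cast hg]
  refine cast_eq_cast_of_dvd hg ?_
  unfold per
  rcases sigZ_cases g n with ⟨h, e⟩ | ⟨h, e⟩ <;>
  rcases sigZ_cases g (n - 1) with ⟨h', e'⟩ | ⟨h', e'⟩
  · grind
  · exact ⟨1, by linarith⟩
  · exact ⟨0, by linarith⟩
  · grind

theorem tau_sigZ_add_one_cast (hg : 2 ≤ g) (n : ℤ) :
    tau ((sigZ g n : ℤ) : Idx g) + 1 = ((sigZ g (n - 1) : ℤ) : Idx g) := by
  rw [tau_sigZ_cast hg]
  push_cast
  ring

theorem exp_add_ccw (x : ℝ) (y : Circle) : Circle.exp (x + ccw (Circle.exp x) y) = y := by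
  obtain ⟨z, rfl⟩ := Circle.exp_surjective y
  rw [ccw_exp, toIcoMod, zsmul_eq_mul, Circle.exp_eq_exp]
  exact ⟨-toIcoDiv Real.two_pi_pos 0 (z - x), by push_cast; ring⟩

namespace SurfacePolygon

variable (S : SurfacePolygon g)

/-! ### The system of equations on the universal cover -/

/-- The lift of the right hand side of the system that determines `G`. -/
def step (A : Idx g → Circle) (x : ℤ → ℝ) (n : ℤ) : ℝ :=
  open Classical in
  if A (sigZ g n : ℤ) = S.P (sigZ g n : ℤ) then S.t (sigZ g n) (x (sigZ g n - 2))
  else S.t (sigZ g (n - 1)) (x (sigZ g (n - 1) - 1))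

/-- `x` is periodic and `x n` lies between `p n` and `p (n + 1)`. -/
structure IsBounded (x : ℤ → ℝ) : Prop where
  le : ∀ n, S.p n ≤ x n
  le' : ∀ n, x n ≤ S.p (n + 1)
  add_per : ∀ n, x (n + per g) = x n + 2 * π

/-- `x` is a lift of a solution of the system that determines `G`. -/
structure IsLiftedSolution (A : Idx g → Circle) (x : ℤ → ℝ) : Prop extends S.IsBounded x where
  eq : ∀ n, x n = S.step A x n

variable {S} {A : Idx g → Circle} {x y : ℤ → ℝ}

theorem IsBounded.sub_per (hx : S.IsBounded x) (n : ℤ) : x (n - per g) = x n - 2 * π := by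
  have := hx.add_per (n - per g)
  rw [sub_add_cancel] at this
  linarith

variable (S) in
-- With the next three estimates: the first branch of `step` lands in `[q n, p (n + 1)]` and the
-- second in `[p n, q n]`. This gives the self map, and later the comparison of `d` with `x`.
theorem q_le_t_sig {n : ℤ} {y : ℝ} (h : S.p (sigZ g n - 2) ≤ y) :
    S.q n ≤ S.t (sigZ g n) y := by
  have hN := S.twelve_le_per
  have h₁ : S.q (sigZ g n + 2 - per g) ≤ S.p (sigZ g n - 2) := (q_lt_p (by omega)).le
  have h₂ := (S.t_le (sigZ g n)).2 (h₁.trans h)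
  rw [q_sub_per, t_sub_two_pi, t_q_succ_succ, sigZ_sigZ, q_add_per] at h₂
  linarith

variable (S) in
theorem t_sig_le_p {n : ℤ} {y : ℝ} (h : y ≤ S.p (sigZ g n - 1)) :
    S.t (sigZ g n) y ≤ S.p (n + 1) := by
  have h₂ := (S.t_le (sigZ g n)).2 h
  rwa [t_p_pred, sigZ_sigZ] at h₂

variable (S) in
theorem p_le_t_sig_pred {n : ℤ} {y : ℝ} (h : S.p (sigZ g (n - 1) - 1) ≤ y) :
    S.p n ≤ S.t (sigZ g (n - 1)) y := by
  have h₂ := (S.t_le (sigZ g (n - 1))).2 h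
  rwa [t_p_pred, sigZ_sigZ, sub_add_cancel] at h₂

variable (S) in
theorem t_sig_pred_le_q {n : ℤ} {y : ℝ} (h : y ≤ S.p (sigZ g (n - 1))) :
    S.t (sigZ g (n - 1)) y ≤ S.q n := by
  have h₂ := (S.t_le (sigZ g (n - 1))).2 h
  rwa [t_p, sigZ_sigZ, sub_add_cancel] at h₂

theorem IsBounded.le_pred (hx : S.IsBounded x) (n : ℤ) : x (n - 1) ≤ S.p n := by
  have := hx.le' (n - 1)
  rwa [sub_add_cancel] at this

theorem IsBounded.le_pred' (hx : S.IsBounded x) (n : ℤ) : x (n - 2) ≤ S.p (n - 1) := by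
  have := hx.le' (n - 2)
  rwa [show n - 2 + 1 = n - 1 by ring] at this

theorem IsBounded.step (hx : S.IsBounded x) : S.IsBounded (S.step A x) where
  le n := by
    unfold SurfacePolygon.step
    split_ifs with h
    · exact (p_lt_q le_rfl).le.trans (S.q_le_t_sig (hx.le _))
    · exact S.p_le_t_sig_pred (hx.le _)
  le' n := by
    unfold SurfacePolygon.step
    split_ifs with h
    · exact S.t_sig_le_p (hx.le_pred' _)
    · exact (S.t_sig_pred_le_q (hx.le_pred _)).trans (q_lt_p (by omega)).le
  add_per n := by
    have hN := S.twelve_le_per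
    have key : ∀ j x, S.t (j - per g) x = S.t j x + 4 * π := fun j x ↦ by
      have := S.t_add_per (j - per g) x
      rw [sub_add_cancel] at this
      linarith
    have e₁ : ((sigZ g n - per g : ℤ) : Idx g) = (sigZ g n : ℤ) :=
      cast_eq_cast_of_dvd S.two_le ⟨-1, by ring⟩
    unfold SurfacePolygon.step
    rw [show n + per g - 1 = n - 1 + per g by ring, sigZ_add_per, sigZ_add_per, e₁, key, key,
      show sigZ g n - per g - 2 = sigZ g n - 2 - per g by ring,
      show sigZ g (n - 1) - per g - 1 = sigZ g (n - 1) - 1 - per g by ring, hx.sub_per, hx.sub_per,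
      t_sub_two_pi, t_sub_two_pi]
    split_ifs <;> ring

theorem step_mono (h : ∀ n, x n ≤ y n) (n : ℤ) : S.step A x n ≤ S.step A y n := by
  unfold step
  split_ifs
  · exact (S.t_le _).2 (h _)
  · exact (S.t_le _).2 (h _)

variable (S A) in
/-- The lifted system has a solution, by the argument of Knaster and Tarski. -/
theorem exists_isLiftedSolution : ∃ x, S.IsLiftedSolution A x := by
  -- The pointwise supremum of all subsolutions is a subsolution; its image under `step` is another
  -- one, so maximality yields equality.
  set K : Set (ℤ → ℝ) := {x | S.IsBounded x ∧ ∀ n, x n ≤ S.step A x n} with hK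
  have hp : S.IsBounded S.p := ⟨fun n ↦ le_rfl, fun n ↦ p_le (by omega), S.p_add_per⟩
  have hne : S.p ∈ K := ⟨hp, hp.step.le⟩
  have hbdd : ∀ n, BddAbove ((fun x : ℤ → ℝ ↦ x n) '' K) := by
    rintro n
    refine ⟨S.p (n + 1), ?_⟩
    rintro _ ⟨x, hx, rfl⟩
    exact hx.1.le' n
  set z : ℤ → ℝ := fun n ↦ sSup ((fun x : ℤ → ℝ ↦ x n) '' K) with hz
  have hle : ∀ x ∈ K, ∀ n, x n ≤ z n := fun x hx n ↦ le_csSup (hbdd n) ⟨x, hx, rfl⟩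
  have hsup : ∀ n b, (∀ x ∈ K, x n ≤ b) → z n ≤ b := by
    intro n b hb
    refine csSup_le ⟨_, S.p, hne, rfl⟩ ?_
    rintro _ ⟨x, hx, rfl⟩
    exact hb x hx
  have hzb : S.IsBounded z := by
    refine ⟨hle _ hne, fun n ↦ hsup n _ fun x hx ↦ hx.1.le' n, fun n ↦ le_antisymm ?_ ?_⟩
    · refine hsup _ _ fun x hx ↦ ?_
      rw [hx.1.add_per]
      linarith [hle x hx n]
    · have : z n ≤ z (n + per g) - 2 * π := hsup _ _ fun x hx ↦ by
        have := hle x hx (n + per g)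
        rw [hx.1.add_per] at this
        linarith
      linarith
  have h₁ : ∀ n, z n ≤ S.step A z n := fun n ↦ hsup n _ fun x hx ↦
    (hx.2 n).trans (step_mono (hle x hx) n)
  have h₂ : S.step A z ∈ K := ⟨hzb.step, step_mono h₁⟩
  exact ⟨z, hzb, fun n ↦ le_antisymm (h₁ n) (hle _ h₂ n)⟩

/-- The two points `x n`, `y n`, if distinct, are closer in the Hilbert metric of the arc from
`q (n - 1)` to `q (n + 1)` than the points that determine them. -/
theorem IsLiftedSolution.exists_crossRatio_lt (hx : S.IsLiftedSolution A x)
    (hy : S.IsLiftedSolution A y) {n : ℤ} (h : x n < y n) :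
    ∃ m, x m < y m ∧ crossRatio (S.q (n - 1)) (x n) (y n) (S.q (n + 1)) <
      crossRatio (S.q (m - 1)) (x m) (y m) (S.q (m + 1)) := by
  have hN := S.twelve_le_per
  have hqx : ∀ k, S.q (k - 1) < x k := fun k ↦ (q_lt_p (by omega)).trans_le (hx.le k)
  have hyq : ∀ k, y k < S.q (k + 1) := fun k ↦ (hy.le' k).trans_lt (p_lt_q (by omega))
  have hqq : ∀ k, S.q (k + 1) < S.q (k - 1) + 2 * π := fun k ↦ by
    rw [← q_add_per]
    exact q_lt (by omega)
  have ex := hx.eq n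
  have ey := hy.eq n
  unfold step at ex ey
  split_ifs at ex ey with hA
  · set i := sigZ g n with hi
    have h' : x (i - 2) < y (i - 2) := by rwa [ex, ey, t_lt] at h
    refine ⟨i - 2, h', ?_⟩
    rw [← (S.isLift_t i).crossRatio_eq (hqx _) h' (hyq _) (hqq _), ← ex, ← ey]
    -- The image of the source arc is contained in the target arc with its left end strictly inside,
    -- so passing to the target arc decreases the cross ratio.
    have h₁ : S.q (n - 1) < S.t i (S.q (i - 2 - 1)) := by
      have h₁ : S.q (i + 2 - per g) < S.q (i - 2 - 1) := q_lt (by omega)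
      have h₂ : S.q (n - 1) < S.q n := q_lt (by omega)
      rw [← S.t_lt i, q_sub_per, t_sub_two_pi, t_q_succ_succ, hi, sigZ_sigZ, q_add_per] at h₁
      rw [hi]
      linarith
    have h₂ : S.t i (S.q (i - 2 + 1)) < S.q (n + 1) := by
      have h₁ : S.q (i - 2 + 1) < S.p i := q_lt_p (by omega)
      rwa [← S.t_lt i, t_p, hi, sigZ_sigZ] at h₁
    refine crossRatio_lt_crossRatio h₁.le ?_ h ?_ h₂.le (hqq n) (Or.inl h₁)
    · rw [ex, t_lt]
      exact hqx _
    · rw [ey, t_lt]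
      exact hyq _
  · set j := sigZ g (n - 1) with hj
    have h' : x (j - 1) < y (j - 1) := by rwa [ex, ey, t_lt] at h
    refine ⟨j - 1, h', ?_⟩
    rw [← (S.isLift_t j).crossRatio_eq (hqx _) h' (hyq _) (hqq _), ← ex, ← ey]
    have h₁ : S.q (n - 1) < S.t j (S.q (j - 1 - 1)) := by
      have h₁ : S.q (j + 2 - per g) < S.q (j - 1 - 1) := q_lt (by omega)
      rw [← S.t_lt j, q_sub_per, t_sub_two_pi, t_q_succ_succ, hj, sigZ_sigZ, q_add_per] at h₁
      rw [hj]
      linarith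
    -- In this branch the right ends coincide; strictness comes from the left end alone.
    have h₂ : S.t j (S.q (j - 1 + 1)) = S.q (n + 1) := by
      rw [sub_add_cancel, t_q, hj, sigZ_sigZ]
      congr 1
      ring
    refine crossRatio_lt_crossRatio h₁.le ?_ h ?_ h₂.le (hqq n) (Or.inl h₁)
    · rw [ex, t_lt]
      exact hqx _
    · rw [ey, t_lt]
      exact hyq _

/-- By periodicity, among the indices where the solutions differ one has the largest cross ratio;
`exists_crossRatio_lt` produces a larger one. -/
theorem IsLiftedSolution.eq_of_le (hx : S.IsLiftedSolution A x) (hy : S.IsLiftedSolution A y)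
    (h : ∀ n, x n ≤ y n) : x = y := by
  have hN := S.twelve_le_per
  by_contra hne
  set c : ℤ → ℝ := fun m ↦ crossRatio (S.q (m - 1)) (x m) (y m) (S.q (m + 1)) with hc
  have hred : ∀ m, x m < y m → ∃ k ∈ (Finset.Ico 0 (per g)).filter (fun k ↦ x k < y k),
      c k = c m := by
    intro m hm
    have key : ∀ (a : ℤ) (k : ℕ), c (a + k * per g) = c a ∧
        (x (a + k * per g) < y (a + k * per g) ↔ x a < y a) := by
      intro a k
      induction k with
      | zero => simp
      | succ k ih =>
        have e : a + (k + 1 : ℕ) * per g = a + k * per g + per g := by push_cast; ring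
        rw [e, hx.add_per, hy.add_per]
        refine ⟨?_, by rw [← ih.2]; simp⟩
        rw [← ih.1]
        simp only [hc]
        rw [show a + k * per g + per g - 1 = a + k * per g - 1 + per g by ring,
          show a + k * per g + per g + 1 = a + k * per g + 1 + per g by ring,
          q_add_per, q_add_per, hx.add_per, hy.add_per]
        simp only [crossRatio, add_sub_add_right_eq_sub]
    have key' : ∀ (a k : ℤ), c (a + k * per g) = c a ∧
        (x (a + k * per g) < y (a + k * per g) ↔ x a < y a) := by
      intro a k
      obtain ⟨k, rfl | rfl⟩ := k.eq_nat_or_neg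
      · exact key a k
      · have := key (a + -(k : ℤ) * per g) k
        rw [show a + -(k : ℤ) * per g + k * per g = a by ring] at this
        exact ⟨this.1.symm, this.2.symm⟩
    have h₂ := key' m (-(m / per g))
    have h₃ := Int.emod_add_mul_ediv m (per g)
    rw [show m + -(m / per g) * per g = m % per g by linarith] at h₂
    refine ⟨m % per g, ?_, h₂.1⟩
    rw [Finset.mem_filter, Finset.mem_Ico]
    exact ⟨⟨Int.emod_nonneg _ (by omega), Int.emod_lt_of_pos _ (by omega)⟩, h₂.2.2 hm⟩
  obtain ⟨m, hm⟩ : ∃ m, x m < y m := by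
    by_contra! hcon
    exact hne (funext fun n ↦ le_antisymm (h n) (hcon n))
  obtain ⟨k, hk, -⟩ := hred m hm
  obtain ⟨k, hk, hmax⟩ := Finset.exists_max_image _ c ⟨k, hk⟩
  obtain ⟨l, hl, hlt⟩ := hx.exists_crossRatio_lt hy (Finset.mem_filter.1 hk).2
  obtain ⟨l', hl', e⟩ := hred l hl
  have := hmax l' hl'
  rw [e] at this
  exact absurd hlt (not_lt.2 this)

/-- Increasing maps commute with `max`, so the pointwise maximum is a solution comparable to both.
-/
theorem IsLiftedSolution.eq_of_sol (hx : S.IsLiftedSolution A x)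
    (hy : S.IsLiftedSolution A y) : x = y := by
  have hmax : S.IsLiftedSolution A (fun n ↦ max (x n) (y n)) := by
    refine ⟨⟨fun n ↦ (hx.le n).trans (le_max_left _ _), fun n ↦ max_le (hx.le' n) (hy.le' n),
      fun n ↦ ?_⟩, fun n ↦ ?_⟩
    · rw [hx.add_per, hy.add_per, max_add_add_right]
    · rw [hx.eq n, hy.eq n]
      unfold step
      split_ifs
      · exact ((S.isLift_t _).mono.monotone.map_max).symm
      · exact ((S.isLift_t _).mono.monotone.map_max).symm
  have h₁ := hx.eq_of_le hmax fun n ↦ le_max_left _ _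
  have h₂ := hy.eq_of_le hmax fun n ↦ le_max_right _ _
  exact h₁.trans h₂.symm

/-! ### Solutions of the system and their lifts -/

theorem exists_lift_of_isSystemSolution (hA : S.IsExtremal A) {G : Idx g → Circle}
    (hG : S.IsSystemSolution A G) :
    ∃ x, S.IsLiftedSolution A x ∧ ∀ n : ℤ, Circle.exp (x n) = G n := by
  have hN := S.twelve_le_per
  have hp : ∀ n, S.p (n + 1) < S.p n + 2 * π := fun n ↦ by
    rw [← p_add_per]
    exact p_lt (by omega)
  set x : ℤ → ℝ := fun n ↦ S.p n + ccw (S.P n) (G n) with hx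
  have hexp : ∀ n : ℤ, Circle.exp (x n) = G n := fun n ↦ by
    simp only [hx]
    rw [← exp_p, exp_add_ccw]
  have hb : S.IsBounded x := by
    refine ⟨fun n ↦ le_add_of_nonneg_right (ccw_nonneg _ _), fun n ↦ ?_, fun n ↦ ?_⟩
    · have h₁ := (hG n).1
      have h₂ : ccw (S.P n) (S.P ((n : Idx g) + 1)) = S.p (n + 1) - S.p n := by
        have e : ((n : Idx g) + 1) = ((n + 1 : ℤ) : Idx g) := by push_cast; rfl
        rw [e, ← exp_p, ← exp_p, ccw_exp, toIcoMod_eq_self]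
        exact ⟨sub_nonneg.2 (p_le (by omega)), by linarith [hp n]⟩
      simp only [arcCC, Set.mem_ofPred_eq, h₂] at h₁
      simp only [hx]
      linarith
    · simp only [hx, p_add_per, cast_add_per S.two_le]
      ring
  refine ⟨x, ⟨hb, fun n ↦ ?_⟩, hexp⟩
  have hs := hb.step (A := A)
  -- Both sides lie between `p n` and `p (n + 1)`, less than a turn apart, so equality on the circle
  -- is enough.
  refine eq_of_exp_eq ?_ (by linarith [hb.le' n, hs.le n, hp n]) (by
    linarith [hb.le n, hs.le' n, hp n])
  rw [hexp]
  have hsig : sig ((sigZ g n : ℤ) : Idx g) = n := by rw [sig_cast S.two_le, sigZ_sigZ]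
  unfold step
  split_ifs with h
  · rw [exp_t, hexp, ← hsig, (hG _).2.1 h]
    push_cast
    rfl
  · have h' := (hA (sigZ g n : ℤ)).resolve_left h
    have := (hG _).2.2 h'
    rw [hsig, tau_sigZ_add_one_cast S.two_le, tau_sigZ_cast S.two_le] at this
    rw [exp_t, hexp, this]

theorem isSystemSolution_of_isLiftedSolution (hx : S.IsLiftedSolution A x)
    {G : Idx g → Circle} (hG : ∀ n : ℤ, Circle.exp (x n) = G n) : S.IsSystemSolution A G := by
  have hN := S.twelve_le_per
  intro i
  obtain ⟨n, -, -, rfl⟩ := exists_cast_eq S.two_le i 0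
  rw [zero_add]
  have hstep := hx.eq (sigZ g n)
  unfold step at hstep
  rw [sigZ_sigZ] at hstep
  refine ⟨?_, fun h ↦ ?_, fun h ↦ ?_⟩
  · have e : ((n : Idx g) + 1) = ((n + 1 : ℤ) : Idx g) := by push_cast; rfl
    rw [e, ← hG, ← exp_p, ← exp_p]
    refine exp_mem_arcCC (hx.le n) (hx.le' n) ?_
    rw [← p_add_per]
    exact p_lt (by omega)
  · rw [if_pos h] at hstep
    rw [sig_cast S.two_le, ← hG, hstep, exp_t, hG]
    push_cast
    rfl
  · have h' : A n ≠ S.P n := fun h' ↦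
      S.P_ne_Q (l := n) (m := n) le_rfl (by omega) (h'.symm.trans h)
    rw [if_neg h'] at hstep
    have h₁ := tau_sigZ_cast S.two_le (sigZ g n)
    have h₂ := tau_sigZ_add_one_cast S.two_le (sigZ g n)
    rw [sigZ_sigZ] at h₁ h₂
    rw [sig_cast S.two_le, h₁, ← h₁, h₂, h₁, ← hG, hstep, exp_t, hG]

variable (S) in
theorem existsUnique_isSystemSolution (hA : S.IsExtremal A) : ∃! G, S.IsSystemSolution A G := by
  have : NeZero (8 * g - 4) := ⟨by have := S.two_le; omega⟩
  obtain ⟨x, hx⟩ := S.exists_isLiftedSolution A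
  have hcong : ∀ (k a : ℤ), Circle.exp (x (a + k * per g)) = Circle.exp (x a) := by
    intro k a
    have : x (a + k * per g) = x a + k * (2 * π) := by
      induction k with
      | zero => simp
      | succ k ih =>
        rw [show a + ((k : ℤ) + 1) * per g = a + k * per g + per g by ring, hx.add_per, ih]
        push_cast
        ring
      | pred k ih =>
        rw [show a + (-(k : ℤ) - 1) * per g = a + -k * per g - per g by ring,
          hx.toIsBounded.sub_per, ih]
        push_cast
        ring
    rw [this, exp_add_int_mul]
  refine ⟨fun i ↦ Circle.exp (x i.val), isSystemSolution_of_isLiftedSolution hx ?_, ?_⟩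
  · intro n
    have h := Int.emod_add_mul_ediv n (per g)
    have : ((n : Idx g).val : ℤ) = n % per g := by
      rw [ZMod.val_intCast, natCast_sub_eq_per S.two_le]
    rw [this, ← hcong (n / per g) (n % per g)]
    congr 2
    linarith
  · intro G hG
    obtain ⟨y, hy, hyG⟩ := exists_lift_of_isSystemSolution hA hG
    funext i
    have h := hyG i.val
    rw [hy.eq_of_sol hx] at h
    rw [h]
    simp

end SurfacePolygon

end BowenSeries

end

/-! ### The lifts of `D` and `H` and their order relations. -/

noncomputable section

namespace BowenSeries

open Real

variable {g : ℕ}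

namespace SurfacePolygon

variable (S : SurfacePolygon g)

/-! ### The lifts of the points `D` and `H` -/

/-- The lift of the points `D n` determined by a lift `x` of the points `G n`. -/
def dLift (x : ℤ → ℝ) (n : ℤ) : ℝ := S.t (sigZ g (n - 1)) (x (sigZ g (n - 1) - 1))

/-- The lift of the points `H n` determined by a lift `x` of the points `G n`. -/
def hLift (x : ℤ → ℝ) (n : ℤ) : ℝ := S.t (sigZ g (n - 1)) (S.dLift x (sigZ g (n - 1)))

/-- The order relations and the images under the side pairings of the lifts `d`, `x`, `h` of the
points `D`, `G`, `H`. -/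
structure IsDual (x d h : ℤ → ℝ) : Prop where
  p_le_d : ∀ n, S.p n ≤ d n
  d_le_q : ∀ n, d n ≤ S.q n
  d_le_x : ∀ n, d n ≤ x n
  x_le_p : ∀ n, x n ≤ S.p (n + 1)
  q_le_h : ∀ n, S.q n ≤ h n
  h_le_d : ∀ n, h n ≤ d (n + 1)
  x_add_per : ∀ n, x (n + per g) = x n + 2 * π
  d_add_per : ∀ n, d (n + per g) = d n + 2 * π
  h_add_per : ∀ n, h (n + per g) = h n + 2 * π
  t_d : ∀ n, S.t n (d n) = h (sigZ g n + 1)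
  t_d_succ : ∀ n, S.t n (d (n + 1)) = x (sigZ g n - 1 + per g)
  t_x_pred : ∀ n, S.t n (x (n - 1)) = d (sigZ g n + 1)
  t_h : ∀ n, S.t n (h n) = S.t (sigZ g (sigZ g n + 1)) (x (sigZ g (sigZ g n + 1)))

variable {S} {A : Idx g → Circle} {x : ℤ → ℝ}

theorem t_dLift (n : ℤ) : S.t n (S.dLift x n) = S.hLift x (sigZ g n + 1) := by
  rw [hLift, add_sub_cancel_right, sigZ_sigZ]

theorem t_x_pred (n : ℤ) : S.t n (x (n - 1)) = S.dLift x (sigZ g n + 1) := by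
  rw [dLift, add_sub_cancel_right, sigZ_sigZ]

theorem t_sub_per (n : ℤ) (y : ℝ) : S.t (n - per g) y = S.t n y + 4 * π := by
  have := S.t_add_per (n - per g) y
  rw [sub_add_cancel] at this
  linarith

theorem IsBounded.t_dLift_succ (hx : S.IsBounded x) (n : ℤ) :
    S.t n (S.dLift x (n + 1)) = x (sigZ g n - 1 + per g) := by
  rw [dLift, add_sub_cancel_right, t_sig', hx.add_per]

theorem IsBounded.dLift_add_per (hx : S.IsBounded x) (n : ℤ) :
    S.dLift x (n + per g) = S.dLift x n + 2 * π := by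
  rw [dLift, show n + per g - 1 = n - 1 + per g by ring, sigZ_add_per, t_sub_per,
    show sigZ g (n - 1) - per g - 1 = sigZ g (n - 1) - 1 - per g by ring, hx.sub_per,
    t_sub_two_pi, dLift]
  ring

theorem IsBounded.dLift_sub_per (hx : S.IsBounded x) (n : ℤ) :
    S.dLift x (n - per g) = S.dLift x n - 2 * π := by
  have := hx.dLift_add_per (n - per g)
  rw [sub_add_cancel] at this
  linarith

theorem IsBounded.hLift_add_per (hx : S.IsBounded x) (n : ℤ) :
    S.hLift x (n + per g) = S.hLift x n + 2 * π := by
  rw [hLift, show n + per g - 1 = n - 1 + per g by ring, sigZ_add_per, t_sub_per,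
    hx.dLift_sub_per, t_sub_two_pi, hLift]
  ring

theorem IsBounded.p_le_dLift (hx : S.IsBounded x) (n : ℤ) : S.p n ≤ S.dLift x n :=
  S.p_le_t_sig_pred (hx.le _)

theorem IsBounded.dLift_le_q (hx : S.IsBounded x) (n : ℤ) : S.dLift x n ≤ S.q n :=
  S.t_sig_pred_le_q (hx.le_pred _)

theorem IsBounded.q_le_hLift (hx : S.IsBounded x) (n : ℤ) : S.q n ≤ S.hLift x n := by
  have h := (S.t_le (sigZ g (n - 1))).2 (hx.p_le_dLift (sigZ g (n - 1)))
  rwa [t_p, sigZ_sigZ, sub_add_cancel] at h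

theorem IsBounded.hLift_le_q (hx : S.IsBounded x) (n : ℤ) : S.hLift x n ≤ S.q (n + 1) := by
  have h := (S.t_le (sigZ g (n - 1))).2 (hx.dLift_le_q (sigZ g (n - 1)))
  rwa [t_q, sigZ_sigZ, show n - 1 + 2 = n + 1 by ring] at h

variable (S) in
/-- The relation of length four, on the universal cover. -/
theorem t_cycle (n : ℤ) {a b j : ℤ} (ha : a = sigZ g (n - 1)) (hb : b = sigZ g (a - 1))
    (hj : j = sigZ g (sigZ g n + 1)) (y : ℝ) :
    S.t n (S.t a (S.t b y)) = S.t j (y + S.p j - S.p (b - 1)) := by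
  have hcase : b - 1 = j + per g ∨ b - 1 = j - per g := by
    unfold per
    rcases sigZ_cases g n with ⟨h₁, e₁⟩ | ⟨h₁, e₁⟩ <;>
    rcases sigZ_cases g (n - 1) with ⟨h₂, e₂⟩ | ⟨h₂, e₂⟩ <;>
    rcases sigZ_cases g (a - 1) with ⟨h₃, e₃⟩ | ⟨h₃, e₃⟩ <;>
    rcases sigZ_cases g (sigZ g n + 1) with ⟨h₄, e₄⟩ | ⟨h₄, e₄⟩ <;> grind
  obtain ⟨k, hk⟩ : ∃ k : ℤ, S.p (b - 1) = S.p j + k * (2 * π) := by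
    rcases hcase with h | h
    · exact ⟨1, by rw [h, p_add_per]; push_cast; ring⟩
    · exact ⟨-1, by rw [h, p_sub_per]; push_cast; ring⟩
  have hcast : ((b - 1 : ℤ) : Idx g) = j := by
    refine cast_eq_cast_of_dvd S.two_le ?_
    rcases hcase with h | h
    · exact ⟨1, by omega⟩
    · exact ⟨-1, by omega⟩
  have sa : sigZ g a = n - 1 := by rw [ha, sigZ_sigZ]
  have sb : sigZ g b = a - 1 := by rw [hb, sigZ_sigZ]
  have sj : sigZ g j = sigZ g n + 1 := by rw [hj, sigZ_sigZ]
  have h₁ : IsLift (S.t n ∘ S.t a ∘ S.t b) (actS (S.T j)) := by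
    have h := (S.isLift_t n).comp ((S.isLift_t a).comp (S.isLift_t b))
    have e : actS (S.T n) ∘ actS (S.T a) ∘ actS (S.T b) = actS (S.T j) := by
      funext x
      obtain ⟨y, rfl⟩ : ∃ y, actS (S.T (sigZ g j : ℤ)) y = x := ⟨actS (S.T j) x, by
        rw [S.actS_T_actS_T_sig]⟩
      have hcyc := (S.T_cycle (sigZ g j : ℤ)).actS_eq y
      have e₁ : rho ((sigZ g j : ℤ) : Idx g) = b := by
        rw [rho_cast S.two_le, sigZ_sigZ, Int.cast_add, ← hcast]
        push_cast
        ring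
      have e₂ : rho (b : Idx g) = a := by rw [rho_cast S.two_le, sb, sub_add_cancel]
      have e₃ : rho (a : Idx g) = n := by rw [rho_cast S.two_le, sa, sub_add_cancel]
      rw [e₁, e₂, e₃, actS_mul, actS_mul, actS_mul] at hcyc
      have h₂ := S.actS_T_actS_T_sig (sigZ g j) y
      rw [sigZ_sigZ] at h₂
      rw [h₂]
      exact hcyc
    rwa [e] at h
  -- The point `p (b - 1)` travels through end points only, so both lifts can be evaluated there.
  have h₂ := h₁.eq_of_eq ((S.isLift_t j).add_const (-k)) (x₀ := S.p (b - 1)) (by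
    simp only [Function.comp]
    rw [t_p_pred, sb, sub_add_cancel, t_p, sa, sub_add_cancel, t_q, hk,
      (S.isLift_t j).add_int_mul, t_p, sj]
    rw [show sigZ g n + 1 + 1 = sigZ g n + 2 by ring]
    push_cast
    ring) y
  simp only [Function.comp] at h₂
  rw [h₂, ← (S.isLift_t j).add_int_mul, hk]
  congr 1
  push_cast
  ring

/-- `h n` arises from `x` by two side pairings. A third one, `t n`, reduces the product to a single
pairing by the relation of length four; the discrepancy of a period is absorbed by the periodicity
of `x`. -/
theorem IsBounded.t_hLift (hx : S.IsBounded x) (n : ℤ) :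
    S.t n (S.hLift x n) = S.t (sigZ g (sigZ g n + 1)) (x (sigZ g (sigZ g n + 1))) := by
  obtain ⟨a, ha⟩ : ∃ a, a = sigZ g (n - 1) := ⟨_, rfl⟩
  obtain ⟨b, hb⟩ : ∃ b, b = sigZ g (a - 1) := ⟨_, rfl⟩
  obtain ⟨j, hj⟩ : ∃ j, j = sigZ g (sigZ g n + 1) := ⟨_, rfl⟩
  have hcase : b - 1 = j + per g ∨ b - 1 = j - per g := by
    unfold per
    rcases sigZ_cases g n with ⟨h₁, e₁⟩ | ⟨h₁, e₁⟩ <;>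
    rcases sigZ_cases g (n - 1) with ⟨h₂, e₂⟩ | ⟨h₂, e₂⟩ <;>
    rcases sigZ_cases g (a - 1) with ⟨h₃, e₃⟩ | ⟨h₃, e₃⟩ <;>
    rcases sigZ_cases g (sigZ g n + 1) with ⟨h₄, e₄⟩ | ⟨h₄, e₄⟩ <;> grind
  rw [hLift, ← ha, dLift, ← hb, S.t_cycle n ha hb hj, ← hj]
  congr 1
  rcases hcase with h | h
  · rw [h, hx.add_per, p_add_per]
    ring
  · rw [h, hx.sub_per, p_sub_per]
    ring

/-- The two cases of the system are needed only for `d n ≤ x n` and `h n ≤ d (n + 1)`. In each case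
either equality holds or an end point separates the two sides. -/
theorem IsLiftedSolution.isDual (hx : S.IsLiftedSolution A x) :
    S.IsDual x (S.dLift x) (S.hLift x) where
  p_le_d := hx.p_le_dLift
  d_le_q := hx.dLift_le_q
  d_le_x n := by
    rw [hx.eq n]
    unfold step
    split_ifs with h
    · exact (hx.dLift_le_q n).trans (S.q_le_t_sig (hx.le _))
    · exact le_rfl
  x_le_p := hx.le'
  q_le_h := hx.q_le_hLift
  h_le_d n := by
    have hN := S.twelve_le_per
    obtain ⟨j, hj⟩ : ∃ j, j = sigZ g (sigZ g n + 1) := ⟨_, rfl⟩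
    have sj : sigZ g j = sigZ g n + 1 := by rw [hj, sigZ_sigZ]
    -- After applying `t n` the claim is `t j (x j) ≤ x (σ(j) - 2 + per g)`. The first branch for `x
    -- j` gives equality; in the second `x j = d j`, and its image `h (σ(j) + 1)` is at most `q
    -- (σ(j) + 2)`.
    rw [← S.t_le n, hx.t_hLift, hx.t_dLift_succ, ← hj, hx.eq j]
    unfold step
    split_ifs with h
    · rw [t_sig', ← hx.add_per, sj]
      exact le_of_eq (congrArg x (by ring))
    · change S.t j (S.dLift x j) ≤ _
      rw [t_dLift, sj]
      refine (hx.hLift_le_q _).trans (le_trans ?_ (hx.le _))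
      exact (q_lt_p (by omega)).le
  x_add_per := hx.add_per
  d_add_per := hx.dLift_add_per
  h_add_per := hx.hLift_add_per
  t_d := t_dLift
  t_d_succ := hx.t_dLift_succ
  t_x_pred := t_x_pred
  t_h := hx.t_hLift

theorem exp_dLift {G : Idx g → Circle} (hG : ∀ n : ℤ, Circle.exp (x n) = G n) (n : ℤ) :
    Circle.exp (S.dLift x n) = S.D G n := by
  rw [dLift, exp_t, hG, D, sig_cast S.two_le, tau_sigZ_cast S.two_le]
  congr 2
  push_cast
  ring

theorem exp_hLift {G : Idx g → Circle} (hG : ∀ n : ℤ, Circle.exp (x n) = G n) (n : ℤ) :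
    Circle.exp (S.hLift x n) = S.H G n := by
  have e₁ : sig ((n : Idx g) - 1) = (sigZ g (n - 1) : ℤ) := by
    rw [← sig_cast S.two_le]
    push_cast
    rfl
  have e₂ : tau (n : Idx g) = (sigZ g (sigZ g (n - 1) - 1) : ℤ) := by
    rw [tau_cast S.two_le]
    refine cast_eq_cast_of_dvd S.two_le ?_
    unfold per
    rcases sigZ_cases g (n - 1) with ⟨h₂, h₂'⟩ | ⟨h₂, h₂'⟩ <;>
    rcases sigZ_cases g (sigZ g (n - 1) - 1) with ⟨h₃, h₃'⟩ | ⟨h₃, h₃'⟩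
    · grind
    · exact ⟨1, by linarith⟩
    · exact ⟨0, by linarith⟩
    · grind
  rw [hLift, exp_t, dLift, exp_t, hG, H, U, actS_mul, e₁, e₂]
  push_cast
  rfl

end SurfacePolygon

end BowenSeries

end

/-! ### The domain and the map on the universal cover. -/

noncomputable section

namespace BowenSeries

open Real

variable {g : ℕ}

theorem exists_le_lt_of_periodic {f : ℤ → ℝ} (hf : StrictMono f) {N : ℤ}
    (hper : ∀ n, f (n + N) = f n + 2 * π) (y : ℝ) :
    (∃ n, f n ≤ y ∧ y < f (n + 1)) ∧ ∃ n, f n < y ∧ y ≤ f (n + 1) := by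
  have hpi := Real.pi_pos
  have hmul : ∀ k : ℤ, f (k * N) = f 0 + k * (2 * π) := by
    intro k
    induction k with
    | zero => simp
    | succ k ih =>
      rw [add_mul, one_mul, hper, ih]
      push_cast
      ring
    | pred k ih =>
      have := hper ((-(k : ℤ) - 1) * N)
      rw [show (-(k : ℤ) - 1) * N + N = -(k : ℤ) * N by ring, ih] at this
      push_cast at this ⊢
      linarith
  have h₁ : ∃ n, f n < y := by
    obtain ⟨k, hk⟩ := exists_int_lt ((y - f 0) / (2 * π))
    rw [lt_div_iff₀ (by positivity)] at hk
    exact ⟨k * N, by rw [hmul]; linarith⟩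
  have h₂ : ∃ n, y < f n := by
    obtain ⟨k, hk⟩ := exists_int_gt ((y - f 0) / (2 * π))
    rw [div_lt_iff₀ (by positivity)] at hk
    exact ⟨k * N, by rw [hmul]; linarith⟩
  obtain ⟨a, ha⟩ := h₁
  obtain ⟨b, hb⟩ := h₂
  constructor
  · obtain ⟨n, hn, hmax⟩ := Int.exists_greatest_of_bdd (P := fun n ↦ f n ≤ y)
      ⟨b, fun z hz ↦ (hf.lt_iff_lt.1 (hz.trans_lt hb)).le⟩ ⟨a, ha.le⟩
    exact ⟨n, hn, by by_contra! h; have := hmax _ h; omega⟩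
  · obtain ⟨n, hn, hmax⟩ := Int.exists_greatest_of_bdd (P := fun n ↦ f n < y)
      ⟨b, fun z hz ↦ (hf.lt_iff_lt.1 (hz.trans hb)).le⟩ ⟨a, ha⟩
    exact ⟨n, hn, by by_contra! h; have := hmax _ h; omega⟩

namespace SurfacePolygon

variable (S : SurfacePolygon g)

/-! ### The domain on the universal cover -/

/-- The lift of the union of the vertical strips. -/
def Col (x h : ℤ → ℝ) (u w : ℝ) : Prop := ∃ k,
  (S.p k ≤ u ∧ u ≤ S.q k) ∧ (h (k + 1 - per g) ≤ w ∧ w ≤ x (k - 2)) ∨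
  (S.q k ≤ u ∧ u ≤ S.p (k + 1)) ∧ (h (k + 1 - per g) ≤ w ∧ w ≤ x (k - 1))

/-- The lift of the union of rectangles. -/
def Row (x d h : ℤ → ℝ) (u w : ℝ) : Prop := ∃ i,
  (S.q (i + 2) ≤ u ∧ u ≤ S.p (i - 1 + per g)) ∧ (d i ≤ w ∧ w ≤ d (i + 1)) ∨
  (S.p (i - 1 + per g) ≤ u ∧ u ≤ S.p (i + per g)) ∧ (h i ≤ w ∧ w ≤ d (i + 1)) ∨
  (S.q (i + 1) ≤ u ∧ u ≤ S.q (i + 2)) ∧ (d i ≤ w ∧ w ≤ x i)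

variable {S} {x d h : ℤ → ℝ}

namespace IsDual

theorem d_strictMono (hd : S.IsDual x d h) : StrictMono d :=
  strictMono_int_of_lt_succ fun n ↦ (hd.d_le_q n).trans_lt
    ((S.q_lt_p_succ n).trans_le (hd.p_le_d (n + 1)))

theorem d_le_d (hd : S.IsDual x d h) {m n : ℤ} (hmn : m ≤ n) : d m ≤ d n := hd.d_strictMono.monotone hmn

theorem h_le_d' (hd : S.IsDual x d h) {m n : ℤ} (hmn : m < n) : h m ≤ d n := (hd.h_le_d m).trans (hd.d_le_d hmn)

theorem d_le_x' (hd : S.IsDual x d h) {m n : ℤ} (hmn : m ≤ n) : d m ≤ x n := (hd.d_le_d hmn).trans (hd.d_le_x n)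

theorem x_le_p' (hd : S.IsDual x d h) {m n : ℤ} (hmn : m < n) : x m ≤ S.p n := (hd.x_le_p m).trans (p_le hmn)

theorem x_le_d (hd : S.IsDual x d h) {m n : ℤ} (hmn : m < n) : x m ≤ d n := (hd.x_le_p' hmn).trans (hd.p_le_d n)

theorem x_sub_per (hd : S.IsDual x d h) (n : ℤ) : x (n - per g) = x n - 2 * π := by
  have := hd.x_add_per (n - per g)
  rw [sub_add_cancel] at this
  linarith

theorem d_sub_per (hd : S.IsDual x d h) (n : ℤ) : d (n - per g) = d n - 2 * π := by
  have := hd.d_add_per (n - per g)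
  rw [sub_add_cancel] at this
  linarith

theorem h_sub_per (hd : S.IsDual x d h) (n : ℤ) : h (n - per g) = h n - 2 * π := by
  have := hd.h_add_per (n - per g)
  rw [sub_add_cancel] at this
  linarith

/-- The part of the lifted domain over the interval from `d j` to `d (j + 1)`. -/
theorem cases_of_col (hd : S.IsDual x d h) {u w : ℝ} (hc : S.Col x h u w) {j : ℤ} (h₁ : d j ≤ w) (h₂ : w < d (j + 1)) :
    (S.q (j + 1) ≤ u ∧ u ≤ S.q (j + 2) ∧ w ≤ x j) ∨
    (S.q (j + 2) ≤ u ∧ u ≤ S.p (j - 1 + per g)) ∨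
    (S.p (j - 1 + per g) ≤ u ∧ u ≤ S.p (j + per g) ∧ h j ≤ w) ∨
    (S.q j ≤ u ∧ u ≤ S.q (j + 1) ∧ w = d j ∧ w = x (j - 1)) := by
  have hN := S.twelve_le_per
  obtain ⟨k, ⟨⟨a, b⟩, c, e⟩ | ⟨⟨a, b⟩, c, e⟩⟩ := hc
  · have k₁ : k < j + per g := by
      by_contra hlt
      have := hd.q_le_h (k + 1 - per g)
      have : d (j + 1) ≤ S.q (k + 1 - per g) := (hd.d_le_q _).trans (q_le (by omega))
      linarith
    have k₂ : j + 1 ≤ k := by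
      by_contra hlt
      have : x (k - 2) ≤ S.p (j - 1) := hd.x_le_p' (by omega)
      have := hd.p_le_d j
      have : S.p (j - 1) < S.p j := p_lt (by omega)
      linarith
    rcases k₂.lt_or_eq with k₂ | rfl
    · rcases (show j + 2 ≤ k by omega).lt_or_eq with k₃ | rfl
      · right
        rcases (show k ≤ j - 1 + per g by omega).lt_or_eq with k₄ | rfl
        · exact Or.inl ⟨(q_lt_p (by omega)).le.trans a, b.trans (q_lt_p k₄).le⟩
        · right; left
          exact ⟨a, b.trans (q_lt_p (by omega)).le, by rwa [show j - 1 + per g + 1 - per g = j by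
            ring] at c⟩
      · left
        exact ⟨(q_lt_p (by omega)).le.trans a, b, by rwa [add_sub_cancel_right] at e⟩
    -- This strip ends at height `x (j - 1) ≤ d j`, so it can contribute only its upper edge.
    · right; right; right
      rw [show j + 1 - 2 = j - 1 by ring] at e
      have := hd.x_le_d (m := j - 1) (n := j) (by omega)
      exact ⟨(q_lt_p (by omega)).le.trans a, b, by linarith, by linarith⟩
  · have k₁ : k < j + per g := by
      by_contra hlt
      have := hd.q_le_h (k + 1 - per g)
      have : d (j + 1) ≤ S.q (k + 1 - per g) := (hd.d_le_q _).trans (q_le (by omega))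
      linarith
    have k₂ : j ≤ k := by
      by_contra hlt
      have : x (k - 1) ≤ S.p (j - 1) := hd.x_le_p' (by omega)
      have := hd.p_le_d j
      have : S.p (j - 1) < S.p j := p_lt (by omega)
      linarith
    rcases k₂.lt_or_eq with k₂ | rfl
    · rcases (show j + 1 ≤ k by omega).lt_or_eq with k₃ | rfl
      · right
        rcases (show k ≤ j - 1 + per g by omega).lt_or_eq with k₄ | rfl
        · exact Or.inl ⟨(q_le (by omega)).trans a, b.trans (p_le (by omega))⟩
        · right; left
          exact ⟨(p_lt_q (by omega)).le.trans a, b.trans (p_le (by omega)), by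
            rwa [show j - 1 + per g + 1 - per g = j by ring] at c⟩
      · left
        exact ⟨a, b.trans (p_lt_q (by omega)).le, by rwa [add_sub_cancel_right] at e⟩
    · right; right; right
      have := hd.x_le_d (m := j - 1) (n := j) (by omega)
      exact ⟨a, b.trans (p_lt_q (by omega)).le, by linarith, by linarith⟩

theorem exists_d_le_lt (hd : S.IsDual x d h) (w : ℝ) : ∃ j, d j ≤ w ∧ w < d (j + 1) :=
  (exists_le_lt_of_periodic hd.d_strictMono hd.d_add_per w).1

theorem col_of_middle (hd : S.IsDual x d h) {i : ℤ} {u w : ℝ} (a : S.q (i + 2) ≤ u) (b : u ≤ S.p (i - 1 + per g))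
    (c : d i ≤ w) (e : w ≤ d (i + 1)) : S.Col x h u w := by
  have hN := S.twelve_le_per
  obtain ⟨k, k₁, k₂⟩ := (exists_le_lt_of_periodic S.p_strictMono S.p_add_per u).2
  have l₁ : i + 2 ≤ k := by
    by_contra hlt
    have : S.p (k + 1) < S.q (i + 2) := p_lt_q (by omega)
    linarith
  have l₂ : k < i - 1 + per g := S.p_strictMono.lt_iff_lt.1 (k₁.trans_le b)
  have e₁ : h (k + 1 - per g) ≤ w := (hd.h_le_d' (by omega)).trans c
  refine ⟨k, ?_⟩
  rcases lt_or_ge u (S.q k) with hu | hu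
  · have l₃ : i + 2 < k := S.q_strictMono.lt_iff_lt.1 (a.trans_lt hu)
    exact Or.inl ⟨⟨k₁.le, hu.le⟩, e₁, e.trans (hd.d_le_x' (by omega))⟩
  · exact Or.inr ⟨⟨hu, k₂⟩, e₁, e.trans (hd.d_le_x' (by omega))⟩

theorem col_of_right (hd : S.IsDual x d h) {i : ℤ} {u w : ℝ} (a : S.p (i - 1 + per g) ≤ u) (b : u ≤ S.p (i + per g))
    (c : h i ≤ w) (e : w ≤ d (i + 1)) : S.Col x h u w := by
  have hN := S.twelve_le_per
  have e₁ : h (i - 1 + per g + 1 - per g) ≤ w := by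
    rwa [show i - 1 + per g + 1 - per g = i by ring]
  refine ⟨i - 1 + per g, ?_⟩
  rcases le_total u (S.q (i - 1 + per g)) with hu | hu
  · exact Or.inl ⟨⟨a, hu⟩, e₁, e.trans (hd.d_le_x' (by omega))⟩
  · exact Or.inr ⟨⟨hu, b.trans (p_le (by omega))⟩, e₁, e.trans (hd.d_le_x' (by omega))⟩

theorem col_of_left (hd : S.IsDual x d h) {i : ℤ} {u w : ℝ} (a : S.q (i + 1) ≤ u) (b : u ≤ S.q (i + 2))
    (c : d i ≤ w) (e : w ≤ x i) : S.Col x h u w := by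
  have hN := S.twelve_le_per
  rcases le_total u (S.p (i + 2)) with hu | hu
  · refine ⟨i + 1, Or.inr ⟨⟨a, hu.trans (p_le (by omega))⟩, (hd.h_le_d' (by omega)).trans c, ?_⟩⟩
    rwa [add_sub_cancel_right]
  · refine ⟨i + 2, Or.inl ⟨⟨hu, b⟩, (hd.h_le_d' (by omega)).trans c, ?_⟩⟩
    rwa [add_sub_cancel_right]

theorem col_iff_row (hd : S.IsDual x d h) {u w : ℝ} : S.Col x h u w ↔ S.Row x d h u w := by
  constructor
  · intro hc
    obtain ⟨j, j₁, j₂⟩ := hd.exists_d_le_lt w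
    rcases hd.cases_of_col hc j₁ j₂ with ⟨a, b, c⟩ | ⟨a, b⟩ | ⟨a, b, c⟩ | ⟨a, b, c, e⟩
    · exact ⟨j, Or.inr (Or.inr ⟨⟨a, b⟩, j₁, c⟩)⟩
    · exact ⟨j, Or.inl ⟨⟨a, b⟩, j₁, j₂.le⟩⟩
    · exact ⟨j, Or.inr (Or.inl ⟨⟨a, b⟩, c, j₂.le⟩)⟩
    · refine ⟨j - 1, Or.inr (Or.inr ⟨⟨?_, ?_⟩, (hd.d_le_d (by omega)).trans j₁, e.le⟩)⟩
      · rwa [sub_add_cancel]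
      · rwa [show j - 1 + 2 = j + 1 by ring]
  · rintro ⟨i, ⟨⟨a, b⟩, c, e⟩ | ⟨⟨a, b⟩, c, e⟩ | ⟨⟨a, b⟩, c, e⟩⟩
    · exact hd.col_of_middle a b c e
    · exact hd.col_of_right a b c e
    · exact hd.col_of_left a b c e

/-- The lifted domain lies in the strip `u - 2π < w < u`. -/
theorem lt_of_col (hd : S.IsDual x d h) {u w : ℝ} (hc : S.Col x h u w) : u - 2 * π < w ∧ w < u := by
  have hN := S.twelve_le_per
  obtain ⟨k, ⟨⟨a, b⟩, c, e⟩ | ⟨⟨a, b⟩, c, e⟩⟩ := hc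
  · have h₁ := hd.q_le_h (k + 1 - per g)
    have h₂ : x (k - 2) ≤ S.p (k - 1) := hd.x_le_p' (by omega)
    have h₃ : S.p (k - 1) < S.p k := p_lt (by omega)
    have h₄ : S.q k < S.q (k + 1) := q_lt (by omega)
    rw [q_sub_per] at h₁
    constructor <;> linarith
  · have h₁ := hd.q_le_h (k + 1 - per g)
    have h₂ : x (k - 1) ≤ S.p k := hd.x_le_p' (by omega)
    have h₃ : S.p k < S.q k := p_lt_q le_rfl
    have h₄ : S.p (k + 1) < S.q (k + 1) := p_lt_q le_rfl
    rw [q_sub_per] at h₁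
    constructor <;> linarith

theorem col_add_int_mul (hd : S.IsDual x d h) {u w : ℝ} (hc : S.Col x h u w) (n : ℤ) :
    S.Col x h (u + n * (2 * π)) (w + n * (2 * π)) := by
  have step₁ : ∀ {u w}, S.Col x h u w → S.Col x h (u + 2 * π) (w + 2 * π) := by
    rintro u w ⟨k, hk⟩
    refine ⟨k + per g, ?_⟩
    rwa [show k + per g + 1 - per g = k + 1 - per g + per g by ring,
      show k + per g + 1 = k + 1 + per g by ring, show k + per g - 2 = k - 2 + per g by ring,
      show k + per g - 1 = k - 1 + per g by ring, p_add_per, q_add_per, p_add_per, hd.h_add_per,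
      hd.x_add_per, hd.x_add_per, add_le_add_iff_right, add_le_add_iff_right, add_le_add_iff_right,
      add_le_add_iff_right, add_le_add_iff_right, add_le_add_iff_right, add_le_add_iff_right]
  have step₂ : ∀ {u w}, S.Col x h u w → S.Col x h (u - 2 * π) (w - 2 * π) := by
    rintro u w ⟨k, hk⟩
    refine ⟨k - per g, ?_⟩
    rwa [show k - per g + 1 - per g = k + 1 - per g - per g by ring,
      show k - per g + 1 = k + 1 - per g by ring, show k - per g - 2 = k - 2 - per g by ring,
      show k - per g - 1 = k - 1 - per g by ring, p_sub_per, q_sub_per, p_sub_per, hd.h_sub_per _,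
      hd.x_sub_per, hd.x_sub_per, sub_le_sub_iff_right, sub_le_sub_iff_right, sub_le_sub_iff_right,
      sub_le_sub_iff_right, sub_le_sub_iff_right, sub_le_sub_iff_right, sub_le_sub_iff_right]
  induction n with
  | zero => simpa using hc
  | succ n ih =>
    have := step₁ ih
    push_cast at this ⊢
    convert this using 1 <;> ring
  | pred n ih =>
    have := step₂ ih
    push_cast at this ⊢
    convert this using 1 <;> ring

/-! ### The map on the universal cover -/

theorem t_bounds_middle {j : ℤ} {u : ℝ} :
    (S.q (sigZ g j + per g) ≤ S.t j u ↔ S.q (j + 2) ≤ u) ∧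
    (S.t j u ≤ S.p (sigZ g j + 1 + per g) ↔ u ≤ S.p (j - 1 + per g)) := by
  rw [← t_q_succ_succ, t_le, p_add_per, ← t_p_pred, ← t_add_two_pi, t_le, p_add_per]
  exact ⟨Iff.rfl, Iff.rfl⟩

/-- By `t_h` the left side is also the image of some `h i`: the edge along which two images meet
inside a strip. Then `h_le_d` places it below the top of that strip, as `d_le_x` places it above the
bottom in `le_t_h`. -/
theorem x_t_le (hd : S.IsDual x d h) (j : ℤ) : S.t j (x j) ≤ x (sigZ g j - 2 + per g) := by
  obtain ⟨i, hi⟩ : ∃ i, i = sigZ g (sigZ g j - 1) := ⟨_, rfl⟩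
  have si : sigZ g i = sigZ g j - 1 := by rw [hi, sigZ_sigZ]
  have h₁ := hd.t_h i
  rw [si, sub_add_cancel, sigZ_sigZ] at h₁
  rw [← h₁]
  refine ((S.t_le i).2 (hd.h_le_d i)).trans (le_of_eq ?_)
  rw [hd.t_d_succ, si]
  congr 1
  ring

theorem le_t_h (hd : S.IsDual x d h) (j : ℤ) : h (sigZ g j + 2) ≤ S.t j (h j) := by
  obtain ⟨i, hi⟩ : ∃ i, i = sigZ g (sigZ g j + 1) := ⟨_, rfl⟩
  have si : sigZ g i = sigZ g j + 1 := by rw [hi, sigZ_sigZ]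
  rw [hd.t_h, ← hi]
  refine le_trans (le_of_eq ?_) ((S.t_le i).2 (hd.d_le_x i))
  rw [hd.t_d, si]
  congr 1
  ring

theorem col_t (hd : S.IsDual x d h) {u w : ℝ} (hc : S.Col x h u w) {j : ℤ} (h₁ : d j ≤ w) (h₂ : w < d (j + 1)) :
    S.Col x h (S.t j u) (S.t j w) := by
  have hN := S.twelve_le_per
  have e₁ : h (sigZ g j + 1) ≤ S.t j w := by
    rw [← hd.t_d, t_le]
    exact h₁
  have e₂ : S.t j w ≤ x (sigZ g j - 1 + per g) := by
    rw [← hd.t_d_succ, t_le]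
    exact h₂.le
  rcases hd.cases_of_col hc h₁ h₂ with ⟨a, b, c⟩ | ⟨a, b⟩ | ⟨a, b, c⟩ | ⟨a, b, c, e⟩
  · rw [← S.t_le j, t_q_succ] at a
    rw [← S.t_le j, t_q_succ_succ] at b
    refine ⟨sigZ g j + per g, Or.inl ⟨⟨a, b⟩, ?_, ?_⟩⟩
    · rwa [show sigZ g j + per g + 1 - per g = sigZ g j + 1 by ring]
    · rw [show sigZ g j + per g - 2 = sigZ g j - 2 + per g by ring]
      exact ((S.t_le j).2 c).trans (hd.x_t_le j)
  · refine ⟨sigZ g j + per g, Or.inr ⟨⟨t_bounds_middle.1.2 a, ?_⟩, ?_, ?_⟩⟩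
    · rw [show sigZ g j + per g + 1 = sigZ g j + 1 + per g by ring]
      exact t_bounds_middle.2.2 b
    · rwa [show sigZ g j + per g + 1 - per g = sigZ g j + 1 by ring]
    · rwa [show sigZ g j + per g - 1 = sigZ g j - 1 + per g by ring]
  · rw [← S.t_le j, p_add_per, t_add_two_pi, t_p_pred, ← p_add_per] at a
    rw [← S.t_le j, p_add_per, t_add_two_pi, t_p, ← q_add_per] at b
    refine ⟨sigZ g j + 1 + per g, Or.inl ⟨⟨a, b⟩, ?_, ?_⟩⟩
    · rw [show sigZ g j + 1 + per g + 1 - per g = sigZ g j + 2 by ring]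
      exact (hd.le_t_h j).trans ((S.t_le j).2 c)
    · rwa [show sigZ g j + 1 + per g - 2 = sigZ g j - 1 + per g by ring]
  -- The upper edge of the left rectangle of index `j - 1`, when it lies at height `d j`, is moved
  -- by `t j`. It lands on the lower edges of the left and middle rectangles of index `σ(j) + 1`.
  · have e₃ : S.t j w = d (sigZ g j + 1) := by rw [e, hd.t_x_pred]
    have a' : S.q (sigZ g j + 2) ≤ S.t j u := by rwa [← t_q, t_le]
    have b' : S.t j u ≤ S.p (sigZ g j + per g) := by rwa [← t_q_succ, t_le]
    rcases le_total (S.t j u) (S.q (sigZ g j + 3)) with hu | hu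
    · refine hd.col_of_left (i := sigZ g j + 1) ?_ ?_ e₃.ge (e₃.trans_le (hd.d_le_x _))
      · rwa [add_assoc]
      · rwa [add_assoc]
    · refine hd.col_of_middle (i := sigZ g j + 1) ?_ ?_ e₃.ge
        (e₃.trans_le (hd.d_le_d (by omega)))
      · rwa [add_assoc]
      · rwa [add_sub_cancel_right]

/-- Every point of a strip that is not on its upper edge is in the image of the domain. -/
theorem exists_preimage_of_strip (hd : S.IsDual x d h) {k : ℤ} {u w : ℝ} (a : S.p k ≤ u) (b : u ≤ S.q k)
    (c : h (k + 1 - per g) ≤ w) (e : w < x (k - 2)) :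
    ∃ j u₀ w₀, S.Col x h u₀ w₀ ∧ d j ≤ w₀ ∧ w₀ < d (j + 1) ∧ S.t j u₀ = u ∧ S.t j w₀ = w := by
  obtain ⟨j, hj⟩ : ∃ j, j = sigZ g (k - per g) := ⟨_, rfl⟩
  have sj : sigZ g j = k - per g := by rw [hj, sigZ_sigZ]
  have hk : k = sigZ g j + per g := by omega
  -- This height divides the strip. The part below comes from the left rectangle of index `j`, the
  -- part above from the right rectangle of index `i`, which starts at this very height by `t_h`.
  rcases lt_or_ge w (S.t j (x j)) with hw | hw
  · obtain ⟨u₀, rfl⟩ := S.t_surjective j u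
    obtain ⟨w₀, rfl⟩ := S.t_surjective j w
    rw [hk, ← t_q_succ, t_le] at a
    rw [hk, ← t_q_succ_succ, t_le] at b
    rw [show k + 1 - per g = sigZ g j + 1 by omega, ← hd.t_d, t_le] at c
    rw [t_lt] at hw
    exact ⟨j, u₀, w₀, hd.col_of_left a b c hw.le, c, hw.trans_le (hd.x_le_d (by omega)), rfl, rfl⟩
  · obtain ⟨i, hi⟩ : ∃ i, i = sigZ g (k - per g - 1) := ⟨_, rfl⟩
    have si : sigZ g i = k - per g - 1 := by rw [hi, sigZ_sigZ]
    have hk' : k = sigZ g i + 1 + per g := by omega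
    have h₁ := hd.t_h i
    rw [si, sub_add_cancel, ← hj] at h₁
    rw [← h₁] at hw
    obtain ⟨u₀, rfl⟩ := S.t_surjective i u
    obtain ⟨w₀, rfl⟩ := S.t_surjective i w
    rw [hk', p_add_per, ← t_p_pred, ← t_add_two_pi, t_le, ← p_add_per] at a
    rw [hk', q_add_per, ← t_p, ← t_add_two_pi, t_le, ← p_add_per] at b
    rw [show k - 2 = sigZ g i - 1 + per g by omega, ← hd.t_d_succ, t_lt] at e
    rw [t_le] at hw
    exact ⟨i, u₀, w₀, hd.col_of_right a b hw e.le,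
      ((hd.d_le_q i).trans (hd.q_le_h i)).trans hw, e, rfl, rfl⟩

/-- Strips of the second kind are images of a single middle rectangle, so no division is needed. -/
theorem exists_preimage_of_strip' (hd : S.IsDual x d h) {k : ℤ} {u w : ℝ} (a : S.q k ≤ u) (b : u ≤ S.p (k + 1))
    (c : h (k + 1 - per g) ≤ w) (e : w < x (k - 1)) :
    ∃ j u₀ w₀, S.Col x h u₀ w₀ ∧ d j ≤ w₀ ∧ w₀ < d (j + 1) ∧ S.t j u₀ = u ∧ S.t j w₀ = w := by
  obtain ⟨j, hj⟩ : ∃ j, j = sigZ g (k - per g) := ⟨_, rfl⟩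
  have sj : sigZ g j = k - per g := by rw [hj, sigZ_sigZ]
  obtain ⟨u₀, rfl⟩ := S.t_surjective j u
  obtain ⟨w₀, rfl⟩ := S.t_surjective j w
  rw [show k = sigZ g j + per g by omega, t_bounds_middle.1] at a
  rw [show k + 1 = sigZ g j + 1 + per g by omega, t_bounds_middle.2] at b
  rw [show k + 1 - per g = sigZ g j + 1 by omega, ← hd.t_d, t_le] at c
  rw [show k - 1 = sigZ g j - 1 + per g by omega, ← hd.t_d_succ, t_lt] at e
  exact ⟨j, u₀, w₀, hd.col_of_middle a b c e.le, c, e, rfl, rfl⟩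

/-! ### Interior points -/

theorem le_of_col_of_lt_q {u w : ℝ} (hc : S.Col x h u w) {k : ℤ} (a : S.p k ≤ u)
    (b : u < S.q k) : w ≤ x (k - 2) := by
  obtain ⟨l, ⟨⟨a', b'⟩, -, e⟩ | ⟨⟨a', b'⟩, -, e⟩⟩ := hc
  · have h₁ : l ≤ k := by
      by_contra hlt
      have : S.q k < S.p l := q_lt_p (by omega)
      linarith
    have h₂ : k ≤ l := by
      by_contra hlt
      have : S.q l < S.p k := q_lt_p (by omega)
      linarith
    obtain rfl : l = k := by omega
    exact e
  · have h₁ : l < k := S.q_strictMono.lt_iff_lt.1 (a'.trans_lt b)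
    have h₂ : k ≤ l + 1 := S.p_strictMono.le_iff_le.1 (a.trans b')
    obtain rfl : l = k - 1 := by omega
    rwa [show k - 1 - 1 = k - 2 by ring] at e

theorem le_of_col_of_lt_p (hd : S.IsDual x d h) {u w : ℝ} (hc : S.Col x h u w) {k : ℤ} (a : S.q k ≤ u)
    (b : u < S.p (k + 1)) : w ≤ x (k - 1) := by
  obtain ⟨l, ⟨⟨a', b'⟩, -, e⟩ | ⟨⟨a', b'⟩, -, e⟩⟩ := hc
  · have h₁ : l < k + 1 := S.p_strictMono.lt_iff_lt.1 (a'.trans_lt b)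
    have h₂ : k ≤ l := S.q_strictMono.le_iff_le.1 (a.trans b')
    obtain rfl : l = k := by omega
    exact e.trans ((hd.x_le_d (n := l - 1) (by omega)).trans (hd.d_le_x _))
  · have h₁ : l ≤ k := by
      by_contra hlt
      have : S.p (k + 1) < S.q l := p_lt_q (by omega)
      linarith
    have h₂ : k ≤ l := by
      by_contra hlt
      have : S.p (l + 1) < S.q k := p_lt_q (by omega)
      linarith
    obtain rfl : l = k := by omega
    exact e

/-- A domain point straight above shows that the point is not on an upper edge. On the common side
of two strips the height of the right one gives the bound. -/
theorem exists_preimage_of_interior (hd : S.IsDual x d h) {u w : ℝ} (hc : S.Col x h u w) {w' : ℝ} (hw : w < w')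
    (hc' : S.Col x h u w') :
    ∃ j u₀ w₀, S.Col x h u₀ w₀ ∧ d j ≤ w₀ ∧ w₀ < d (j + 1) ∧ S.t j u₀ = u ∧ S.t j w₀ = w := by
  obtain ⟨k, ⟨⟨a, b⟩, c, e⟩ | ⟨⟨a, b⟩, c, e⟩⟩ := hc
  · rcases b.lt_or_eq with b' | rfl
    · exact hd.exists_preimage_of_strip a b c (hw.trans_le (le_of_col_of_lt_q hc' a b'))
    · exact hd.exists_preimage_of_strip' le_rfl (q_lt_p (by omega)).le c
        (hw.trans_le (hd.le_of_col_of_lt_p hc' le_rfl (q_lt_p (by omega))))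
  · rcases b.lt_or_eq with b' | rfl
    · exact hd.exists_preimage_of_strip' a b c (hw.trans_le (hd.le_of_col_of_lt_p hc' a b'))
    · have := le_of_col_of_lt_q hc' le_rfl (p_lt_q le_rfl)
      rw [show k + 1 - 2 = k - 1 by ring] at this
      exact hd.exists_preimage_of_strip' a b c (hw.trans_le this)

/-- The position of an interior point of the lifted domain over the interval from `d j` to
`d (j + 1)`. -/
theorem cases_of_interior (hd : S.IsDual x d h) {u w ε : ℝ} (hε : 0 < ε)
    (hc : ∀ u' w', |u' - u| < ε → |w' - w| < ε → S.Col x h u' w') {j : ℤ} (h₁ : d j ≤ w)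
    (h₂ : w < d (j + 1)) :
    (S.q (j + 1) ≤ u ∧ u ≤ S.q (j + 2) ∧ w < x j) ∨
    (S.q (j + 2) < u ∧ u < S.p (j - 1 + per g)) ∨
    (S.p (j - 1 + per g) ≤ u ∧ u ≤ S.p (j + per g) ∧ h j ≤ w) := by
  have hN := S.twelve_le_per
  obtain ⟨w', hw, hw', hw''⟩ : ∃ w', w < w' ∧ w' < w + ε ∧ w' < d (j + 1) := by
    obtain ⟨w', a, b⟩ := exists_between (lt_min (lt_add_of_pos_right w hε) h₂)
    exact ⟨w', a, b.trans_le (min_le_left _ _), b.trans_le (min_le_right _ _)⟩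
  have hq₁ : S.q (j + 1) < S.q (j + 2) := q_lt (by omega)
  have hq₀ : S.q j < S.q (j + 1) := q_lt (by omega)
  have hqp : S.q (j + 2) < S.p (j - 1 + per g) := q_lt_p (by omega)
  -- Moving `u` off the side `q (j + 2)` and raising `w` leaves the left rectangle as the only
  -- possibility, so `w < w' ≤ x j`.
  have left : S.q (j + 1) ≤ u → u ≤ S.q (j + 2) → w < x j := by
    intro a b
    have l₁ : max (S.q (j + 1)) (u - ε / 2) ≤ u := max_le a (by linarith)
    have l₂ : max (S.q (j + 1)) (u - ε / 2) < S.q (j + 2) := max_lt hq₁ (by linarith)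
    have l₃ := le_max_left (S.q (j + 1)) (u - ε / 2)
    have l₄ := le_max_right (S.q (j + 1)) (u - ε / 2)
    have hcol := hc (max (S.q (j + 1)) (u - ε / 2)) w' (by rw [abs_lt]; constructor <;> linarith)
      (by rw [abs_lt]; constructor <;> linarith)
    rcases hd.cases_of_col hcol (h₁.trans hw.le) hw'' with
      ⟨-, -, c⟩ | ⟨a', b'⟩ | ⟨a', b', c⟩ | ⟨a', b', c, e⟩ <;> linarith
  have right : u = S.p (j - 1 + per g) → h j ≤ w := by
    intro a
    have hp : S.p (j - 1 + per g) < S.p (j + per g) := p_lt (by omega)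
    have hcol := hc (u + ε / 2) w (by rw [abs_lt]; constructor <;> linarith)
      (by simpa using hε)
    rcases hd.cases_of_col hcol h₁ h₂ with
      ⟨-, b', -⟩ | ⟨a', b'⟩ | ⟨a', b', c⟩ | ⟨a', b', c, e⟩ <;> linarith
  have hcol := hc u w (by simpa using hε) (by simpa using hε)
  rcases hd.cases_of_col hcol h₁ h₂ with ⟨a, b, c⟩ | ⟨a, b⟩ | hC | ⟨a, b, c, e⟩
  · exact Or.inl ⟨a, b, left a b⟩
  · rcases a.lt_or_eq with a' | rfl
    · rcases b.lt_or_eq with b' | b'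
      · exact Or.inr (Or.inl ⟨a', b'⟩)
      · exact Or.inr (Or.inr ⟨b'.ge, b'.trans_le (p_le (by omega)), right b'⟩)
    · exact Or.inl ⟨hq₁.le, le_rfl, left hq₁.le le_rfl⟩
  · exact Or.inr (Or.inr hC)
  -- Points slightly above the degenerate edge, and left of `q (j + 1)`, are outside the domain.
  · exfalso
    have l₁ : max (S.q j) (u - ε / 2) ≤ u := max_le a (by linarith)
    have l₂ : max (S.q j) (u - ε / 2) < S.q (j + 1) := max_lt hq₀ (by linarith)
    have l₄ := le_max_right (S.q j) (u - ε / 2)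
    have hcol := hc (max (S.q j) (u - ε / 2)) w' (by rw [abs_lt]; constructor <;> linarith)
      (by rw [abs_lt]; constructor <;> linarith)
    rcases hd.cases_of_col hcol (h₁.trans hw.le) hw'' with
      ⟨a', -, c⟩ | ⟨a', b'⟩ | ⟨a', b', c⟩ | ⟨a', b', c, e⟩ <;> linarith

/-- The map is injective on the interior of the lifted domain. -/
theorem eq_of_t_eq (hd : S.IsDual x d h) {u₁ w₁ u₂ w₂ ε : ℝ} (hε : 0 < ε)
    (hc₁ : ∀ u' w', |u' - u₁| < ε → |w' - w₁| < ε → S.Col x h u' w')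
    (hc₂ : ∀ u' w', |u' - u₂| < ε → |w' - w₂| < ε → S.Col x h u' w') {i j : ℤ}
    (hi : d i ≤ w₁) (hi' : w₁ < d (i + 1)) (hj : d j ≤ w₂) (hj' : w₂ < d (j + 1))
    (hu : S.t i u₁ = S.t j u₂) (hw : S.t i w₁ = S.t j w₂) : i = j := by
  wlog hij : sigZ g j ≤ sigZ g i generalizing u₁ w₁ u₂ w₂ i j
  · exact (this hc₂ hc₁ hj hj' hi hi' hu.symm hw.symm (not_le.1 hij).le).symm
  rcases hij.lt_or_eq with hij | hij
  swap
  · rw [← sigZ_sigZ g i, ← hij, sigZ_sigZ]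
  exfalso
  -- The image of slice `i` begins at `p (σ(i) + per g)`, and over its first interval it stays below
  -- `t i (x i)`. The image of slice `j` ends at `q (σ(j) + 1 + per g)`, and over its last interval
  -- it stays above `t j (h j)`. An overlap forces `σ(i) = σ(j) + 1`, when these two heights agree
  -- by `t_h`.
  have key : S.p (sigZ g i + per g) ≤ S.t i u₁ ∧ (S.t i u₁ ≤ S.q (sigZ g i + per g) →
      S.t i w₁ < S.t i (x i)) := by
    have e₁ : S.p (sigZ g i + per g) < S.q (sigZ g i + per g) := p_lt_q le_rfl
    rcases hd.cases_of_interior hε hc₁ hi hi' with ⟨a, b, c⟩ | ⟨a, b⟩ | ⟨a, b, c⟩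
    · refine ⟨?_, fun _ ↦ (S.t_lt i).2 c⟩
      rw [← t_q_succ, t_le]
      exact a
    · rw [← S.t_lt i, t_q_succ_succ] at a
      exact ⟨e₁.le.trans a.le, fun h' ↦ absurd a h'.not_gt⟩
    · rw [← S.t_le i, p_add_per, t_add_two_pi, t_p_pred, ← p_add_per] at a
      have e₂ : S.q (sigZ g i + per g) < S.p (sigZ g i + 1 + per g) := q_lt_p (by omega)
      exact ⟨(e₁.trans e₂).le.trans a, fun h' ↦ absurd (e₂.trans_le a) h'.not_gt⟩
  have key' : S.t j u₂ ≤ S.q (sigZ g j + 1 + per g) ∧ (S.p (sigZ g j + 1 + per g) ≤ S.t j u₂ →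
      S.t j (h j) ≤ S.t j w₂) := by
    have e₁ : S.p (sigZ g j + 1 + per g) < S.q (sigZ g j + 1 + per g) := p_lt_q le_rfl
    rcases hd.cases_of_interior hε hc₂ hj hj' with ⟨a, b, c⟩ | ⟨a, b⟩ | ⟨a, b, c⟩
    · rw [← S.t_le j, t_q_succ_succ] at b
      have e₂ : S.q (sigZ g j + per g) < S.p (sigZ g j + 1 + per g) := q_lt_p (by omega)
      exact ⟨b.trans (e₂.trans e₁).le, fun h' ↦ absurd (b.trans_lt e₂) h'.not_gt⟩
    · rw [← S.t_lt j, p_add_per, t_add_two_pi, t_p_pred, ← p_add_per] at b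
      exact ⟨b.le.trans e₁.le, fun h' ↦ absurd b h'.not_gt⟩
    · refine ⟨?_, fun _ ↦ (S.t_le j).2 c⟩
      rwa [← S.t_le j, p_add_per, t_add_two_pi, t_p, ← q_add_per] at b
  have hs : sigZ g i = sigZ g j + 1 := by
    by_contra hne
    have : S.q (sigZ g j + 1 + per g) < S.p (sigZ g i + per g) := q_lt_p (by omega)
    linarith [key.1, key'.1]
  have h₁ := key'.2 (by rw [← hu, ← hs]; exact key.1)
  have h₂ := key.2 (by rw [hu, hs]; exact key'.1)
  rw [hd.t_h, ← hs, sigZ_sigZ] at h₁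
  linarith

end IsDual

end SurfacePolygon

end BowenSeries

end

/-! ### Descent from the universal cover to the torus. -/

noncomputable section

namespace BowenSeries

open Real Topology

variable {g : ℕ}

theorem isClosed_arcCC (a b : Circle) : IsClosed (arcCC a b) := by
  obtain ⟨x, rfl⟩ := Circle.exp_surjective a
  obtain ⟨y, h₁, h₂, rfl⟩ := exists_exp_eq_mem_Ico b x
  have : arcCC (Circle.exp x) (Circle.exp y) = Circle.exp '' Set.Icc x y := by
    ext z
    constructor
    · intro hz
      obtain ⟨w, h₃, h₄, h₅⟩ := exists_lift_of_mem_arcCC h₁ h₂ hz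
      exact ⟨w, ⟨h₃, h₄⟩, h₅⟩
    · rintro ⟨w, ⟨h₃, h₄⟩, rfl⟩
      exact exp_mem_arcCC h₃ h₄ h₂
  rw [this]
  exact (isCompact_Icc.image Circle.exp.continuous).isClosed

/-- The orbit of a set under the maps `f i`. -/
def orbitSet {ι X : Type*} (f : ι → X → X) (E : Set X) : Set X :=
  ⋃ l : List ι, (fun y ↦ l.foldr f y) '' E

theorem countable_orbitSet {ι X : Type*} [Countable ι] (f : ι → X → X) {E : Set X}
    (hE : E.Countable) : (orbitSet f E).Countable :=
  Set.countable_iUnion fun _ ↦ hE.image _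

theorem subset_orbitSet {ι X : Type*} (f : ι → X → X) (E : Set X) : E ⊆ orbitSet f E :=
  fun y hy ↦ Set.mem_iUnion.2 ⟨[], y, hy, rfl⟩

theorem apply_mem_orbitSet {ι X : Type*} (f : ι → X → X) {E : Set X} {y : X}
    (hy : y ∈ orbitSet f E) (i : ι) : f i y ∈ orbitSet f E := by
  obtain ⟨l, z, hz, rfl⟩ := Set.mem_iUnion.1 hy
  exact Set.mem_iUnion.2 ⟨i :: l, z, hz, rfl⟩

namespace SurfacePolygon

variable {S : SurfacePolygon g}

theorem natExt_eq_or (S : SurfacePolygon g) (A : Idx g → Circle) (z : Circle × Circle) :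
    (∃ i, S.natExt A z = (actS (S.T i) z.1, actS (S.T i) z.2)) ∨ S.natExt A z = z := by
  unfold natExt
  split_ifs with h
  · exact Or.inl ⟨_, rfl⟩
  · exact Or.inr rfl

variable {x d h : ℤ → ℝ} {G : Idx g → Circle}

/-- Governs a change of lifts: the argument contributes `k` turns and the index `-2 * k`. -/
theorem t_add_int_mul_per (n k : ℤ) (y : ℝ) :
    S.t (n + k * per g) (y + k * (2 * π)) = S.t n y - k * (2 * π) := by
  rw [(S.isLift_t _).add_int_mul]
  suffices H : S.t (n + k * per g) y = S.t n y - k * (4 * π) by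
    rw [H]
    ring
  induction k with
  | zero => simp
  | succ k ih =>
    rw [show n + ((k : ℤ) + 1) * per g = n + k * per g + per g by ring, t_add_per, ih]
    push_cast
    ring
  | pred k ih =>
    rw [show n + (-(k : ℤ) - 1) * per g = n + -k * per g - per g by ring, t_sub_per, ih]
    push_cast
    ring

namespace IsDual

theorem d_add_int_mul_per (hd : S.IsDual x d h) (n k : ℤ) :
    d (n + k * per g) = d n + k * (2 * π) := by
  induction k with
  | zero => simp
  | succ k ih =>
    rw [show n + ((k : ℤ) + 1) * per g = n + k * per g + per g by ring, hd.d_add_per, ih]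
    push_cast
    ring
  | pred k ih =>
    rw [show n + (-(k : ℤ) - 1) * per g = n + -k * per g - per g by ring, hd.d_sub_per, ih]
    push_cast
    ring

theorem d_succ_lt (hd : S.IsDual x d h) (n : ℤ) : d (n + 1) < d n + 2 * π := by
  rw [← hd.d_add_per]
  exact hd.d_strictMono (by have := S.twelve_le_per; omega)

/-- The map on the torus in terms of the lifts of the side pairings. -/
theorem natExt_exp (hd : S.IsDual x d h) (hD : ∀ n : ℤ, Circle.exp (d n) = S.D G n) {j : ℤ}
    (u : ℝ) {w : ℝ} (h₁ : d j ≤ w) (h₂ : w < d (j + 1)) :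
    S.natExt (S.D G) (Circle.exp u, Circle.exp w) =
      (Circle.exp (S.t j u), Circle.exp (S.t j w)) := by
  have hcast : ∀ m : ℤ, ((m : Idx g) + 1) = ((m + 1 : ℤ) : Idx g) := fun m ↦ by push_cast; rfl
  have hex : ∃ i : Idx g, (Circle.exp u, Circle.exp w).2 ∈ arcCO (S.D G i) (S.D G (i + 1)) := by
    refine ⟨j, ?_⟩
    rw [hcast, ← hD, ← hD]
    exact exp_mem_arcCO h₁ h₂ (hd.d_succ_lt j)
  -- The index in `natExt` is obtained by choice, so its uniqueness is needed to compute the map.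
  have huniq : ∀ i : Idx g, Circle.exp w ∈ arcCO (S.D G i) (S.D G (i + 1)) → i = j := by
    intro i hi
    obtain ⟨m, -, -, rfl⟩ := exists_cast_eq S.two_le i 0
    rw [zero_add] at hi ⊢
    rw [hcast, ← hD, ← hD, mem_arcCO_exp (hd.d_le_d (by omega)) (hd.d_succ_lt m)] at hi
    obtain ⟨n, h₃, h₄⟩ := hi
    have e₁ := hd.d_add_int_mul_per j n
    have e₂ := hd.d_add_int_mul_per (j + 1) n
    have l₁ : m < j + 1 + n * per g := hd.d_strictMono.lt_iff_lt.1 (by linarith)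
    have l₂ : j + n * per g < m + 1 := hd.d_strictMono.lt_iff_lt.1 (by linarith)
    exact cast_eq_cast_of_dvd S.two_le ⟨n, by rw [show m = j + n * per g by omega]; ring⟩
  rw [natExt, dif_pos hex, exp_t, exp_t, huniq _ hex.choose_spec]

theorem strip_lt (hd : S.IsDual x d h) (k : ℤ) :
    h (k + 1 - per g) < x (k - 2) ∧ x (k - 2) < h (k + 1 - per g) + 2 * π ∧
      h (k + 1 - per g) < x (k - 1) ∧ x (k - 1) < h (k + 1 - per g) + 2 * π := by
  have hN := S.twelve_le_per
  have h₁ : h (k + 1 - per g) ≤ d (k + 2 - per g) := hd.h_le_d' (by omega)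
  have h₂ : d (k + 2 - per g) < d (k - 2) := hd.d_strictMono (by omega)
  have h₃ := hd.d_le_x (k - 2)
  have h₄ : x (k - 2) ≤ d (k - 1) := hd.x_le_d (by omega)
  have h₅ := hd.d_le_x (k - 1)
  have h₆ : x (k - 1) ≤ S.p k := hd.x_le_p' (by omega)
  have h₇ := hd.q_le_h (k + 1 - per g)
  have h₈ : S.p k < S.q (k + 1) := p_lt_q (by omega)
  rw [q_sub_per] at h₇
  refine ⟨?_, ?_, ?_, ?_⟩ <;> linarith

theorem exp_h_sub_per (hd : S.IsDual x d h) (hH : ∀ n : ℤ, Circle.exp (h n) = S.H G n) (k : ℤ) :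
    S.H G ((k : Idx g) + 1) = Circle.exp (h (k + 1 - per g)) := by
  have : ((k : Idx g) + 1) = ((k + 1 : ℤ) : Idx g) := by push_cast; rfl
  rw [this, ← hH, hd.h_sub_per, Circle.exp_sub_two_pi]

theorem exp_mem_verticalStrips (hd : S.IsDual x d h) (hG : ∀ n : ℤ, Circle.exp (x n) = G n)
    (hH : ∀ n : ℤ, Circle.exp (h n) = S.H G n) {u w : ℝ} (hc : S.Col x h u w) :
    (Circle.exp u, Circle.exp w) ∈ S.verticalStrips G := by
  have hN := S.twelve_le_per
  obtain ⟨k, hk⟩ := hc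
  obtain ⟨s₁, s₂, s₃, s₄⟩ := hd.strip_lt k
  have e₁ : ((k : Idx g) + 1) = ((k + 1 : ℤ) : Idx g) := by push_cast; rfl
  have e₂ : ((k : Idx g) - 2) = ((k - 2 : ℤ) : Idx g) := by push_cast; rfl
  have e₃ : ((k : Idx g) - 1) = ((k - 1 : ℤ) : Idx g) := by push_cast; rfl
  refine Set.mem_iUnion.2 ⟨k, ?_⟩
  rw [hd.exp_h_sub_per hH, e₁, e₂, e₃, ← hG, ← hG, ← exp_p, ← exp_p, ← exp_q]
  rcases hk with ⟨⟨a, b⟩, c, e⟩ | ⟨⟨a, b⟩, c, e⟩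
  · refine Or.inl ⟨exp_mem_arcCC a b ?_, exp_mem_arcCC c e s₂⟩
    rw [← p_add_per]
    exact q_lt_p (by omega)
  · refine Or.inr ⟨exp_mem_arcCC a b ?_, exp_mem_arcCC c e s₄⟩
    rw [← q_add_per]
    exact p_lt_q (by omega)

theorem exists_col_of_mem (hd : S.IsDual x d h) (hG : ∀ n : ℤ, Circle.exp (x n) = G n)
    (hH : ∀ n : ℤ, Circle.exp (h n) = S.H G n) {z : Circle × Circle}
    (hz : z ∈ S.verticalStrips G) :
    ∃ u w, S.Col x h u w ∧ z = (Circle.exp u, Circle.exp w) := by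
  have hN := S.twelve_le_per
  obtain ⟨i, hi⟩ := Set.mem_iUnion.1 hz
  obtain ⟨k, -, -, rfl⟩ := exists_cast_eq S.two_le i 0
  rw [zero_add] at hi
  obtain ⟨s₁, s₂, s₃, s₄⟩ := hd.strip_lt k
  have e₁ : ((k : Idx g) + 1) = ((k + 1 : ℤ) : Idx g) := by push_cast; rfl
  have e₂ : ((k : Idx g) - 2) = ((k - 2 : ℤ) : Idx g) := by push_cast; rfl
  have e₃ : ((k : Idx g) - 1) = ((k - 1 : ℤ) : Idx g) := by push_cast; rfl
  rw [hd.exp_h_sub_per hH, e₁, e₂, e₃, ← hG, ← hG, ← exp_p, ← exp_p, ← exp_q] at hi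
  rcases hi with ⟨h₁, h₂⟩ | ⟨h₁, h₂⟩
  · obtain ⟨u, a, b, hu⟩ := exists_lift_of_mem_arcCC (p_lt_q le_rfl).le (by
      rw [← p_add_per]
      exact q_lt_p (by omega)) h₁
    obtain ⟨w, c, e, hw⟩ := exists_lift_of_mem_arcCC s₁.le s₂ h₂
    exact ⟨u, w, ⟨k, Or.inl ⟨⟨a, b⟩, c, e⟩⟩, Prod.ext hu.symm hw.symm⟩
  · obtain ⟨u, a, b, hu⟩ := exists_lift_of_mem_arcCC (q_lt_p (by omega)).le (by
      rw [← q_add_per]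
      exact p_lt_q (by omega)) h₁
    obtain ⟨w, c, e, hw⟩ := exists_lift_of_mem_arcCC s₃.le s₄ h₂
    exact ⟨u, w, ⟨k, Or.inr ⟨⟨a, b⟩, c, e⟩⟩, Prod.ext hu.symm hw.symm⟩

theorem row_bounds (hd : S.IsDual x d h) (i : ℤ) :
    S.q (i + 2) ≤ S.p (i - 1 + per g) ∧ S.p (i - 1 + per g) < S.q (i + 2) + 2 * π ∧
    S.p (i - 1 + per g) ≤ S.p (i + per g) ∧ S.p (i + per g) < S.p (i - 1 + per g) + 2 * π ∧
    S.q (i + 1) ≤ S.q (i + 2) ∧ S.q (i + 2) < S.q (i + 1) + 2 * π ∧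
    d (i + 1) < h i + 2 * π ∧ x i < d i + 2 * π := by
  have hN := S.twelve_le_per
  have h₁ := hd.d_le_q (i + 1)
  have h₂ := hd.q_le_h i
  have h₃ : S.q (i + 1) < S.q (i + per g) := q_lt (by omega)
  have h₄ := hd.x_le_d (m := i) (n := i + per g) (by omega)
  have h₅ : S.p (i - 1 + per g) < S.q (i + 2 + per g) := p_lt_q (by omega)
  have h₆ : S.p (i + per g) < S.p (i - 1 + per g + per g) := p_lt (by omega)
  have h₇ : S.q (i + 2) < S.q (i + 1 + per g) := q_lt (by omega)
  have h₈ := (hd.x_le_d (m := i) (n := i + 1) (by omega)).trans_lt (hd.d_succ_lt i)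
  rw [q_add_per] at h₃ h₅ h₇
  rw [p_add_per (n := i - 1 + per g)] at h₆
  exact ⟨(q_lt_p (by omega)).le, h₅, p_le (by omega), h₆, q_le (by omega), h₇, by linarith, h₈⟩

theorem mem_omegaD_iff (hd : S.IsDual x d h) (hG : ∀ n : ℤ, Circle.exp (x n) = G n)
    (hD : ∀ n : ℤ, Circle.exp (d n) = S.D G n) (hH : ∀ n : ℤ, Circle.exp (h n) = S.H G n)
    (z : Circle × Circle) :
    z ∈ S.omegaD G ↔ ∃ u w, S.Row x d h u w ∧ z = (Circle.exp u, Circle.exp w) := by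
  have hrow : ∀ i : ℤ,
      (arcCC (S.Q (i + 2)) (S.P (i - 1)) ×ˢ arcCC (S.D G i) (S.D G (i + 1)) ∪
      arcCC (S.P (i - 1)) (S.P i) ×ˢ arcCC (S.H G i) (S.D G (i + 1)) ∪
      arcCC (S.Q (i + 1)) (S.Q (i + 2)) ×ˢ arcCC (S.D G i) (G i)) =
      (arcCC (Circle.exp (S.q (i + 2))) (Circle.exp (S.p (i - 1 + per g))) ×ˢ
        arcCC (Circle.exp (d i)) (Circle.exp (d (i + 1))) ∪
      arcCC (Circle.exp (S.p (i - 1 + per g))) (Circle.exp (S.p (i + per g))) ×ˢ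
        arcCC (Circle.exp (h i)) (Circle.exp (d (i + 1))) ∪
      arcCC (Circle.exp (S.q (i + 1))) (Circle.exp (S.q (i + 2))) ×ˢ
        arcCC (Circle.exp (d i)) (Circle.exp (x i))) := by
    intro i
    rw [hD, hD, hH, hG, exp_p, exp_p, exp_q, exp_q, cast_add_per S.two_le, cast_add_per S.two_le]
    push_cast
    rfl
  constructor
  · intro hz
    obtain ⟨i, hi⟩ := Set.mem_iUnion.1 hz
    obtain ⟨k, -, -, rfl⟩ := exists_cast_eq S.two_le i 0
    rw [zero_add, hrow] at hi
    obtain ⟨b₁, b₂, b₃, b₄, b₅, b₆, b₇, b₈⟩ := hd.row_bounds k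
    rcases hi with (⟨h₁, h₂⟩ | ⟨h₁, h₂⟩) | ⟨h₁, h₂⟩
    · obtain ⟨u, a, b, hu⟩ := exists_lift_of_mem_arcCC b₁ b₂ h₁
      obtain ⟨w, c, e, hw⟩ := exists_lift_of_mem_arcCC (hd.d_le_d (by omega)) (hd.d_succ_lt k) h₂
      exact ⟨u, w, ⟨k, Or.inl ⟨⟨a, b⟩, c, e⟩⟩, Prod.ext hu.symm hw.symm⟩
    · obtain ⟨u, a, b, hu⟩ := exists_lift_of_mem_arcCC b₃ b₄ h₁
      obtain ⟨w, c, e, hw⟩ := exists_lift_of_mem_arcCC (hd.h_le_d k) b₇ h₂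
      exact ⟨u, w, ⟨k, Or.inr (Or.inl ⟨⟨a, b⟩, c, e⟩)⟩, Prod.ext hu.symm hw.symm⟩
    · obtain ⟨u, a, b, hu⟩ := exists_lift_of_mem_arcCC b₅ b₆ h₁
      obtain ⟨w, c, e, hw⟩ := exists_lift_of_mem_arcCC (hd.d_le_x k) b₈ h₂
      exact ⟨u, w, ⟨k, Or.inr (Or.inr ⟨⟨a, b⟩, c, e⟩)⟩, Prod.ext hu.symm hw.symm⟩
  · rintro ⟨u, w, ⟨k, hk⟩, rfl⟩
    obtain ⟨b₁, b₂, b₃, b₄, b₅, b₆, b₇, b₈⟩ := hd.row_bounds k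
    refine Set.mem_iUnion.2 ⟨k, ?_⟩
    rw [hrow]
    rcases hk with ⟨⟨a, b⟩, c, e⟩ | ⟨⟨a, b⟩, c, e⟩ | ⟨⟨a, b⟩, c, e⟩
    · exact Or.inl (Or.inl ⟨exp_mem_arcCC a b b₂, exp_mem_arcCC c e (hd.d_succ_lt k)⟩)
    · exact Or.inl (Or.inr ⟨exp_mem_arcCC a b b₄, exp_mem_arcCC c e b₇⟩)
    · exact Or.inr ⟨exp_mem_arcCC a b b₆, exp_mem_arcCC c e b₈⟩

theorem omegaD_eq (hd : S.IsDual x d h) (hG : ∀ n : ℤ, Circle.exp (x n) = G n)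
    (hD : ∀ n : ℤ, Circle.exp (d n) = S.D G n) (hH : ∀ n : ℤ, Circle.exp (h n) = S.H G n) :
    S.omegaD G = S.verticalStrips G := by
  ext z
  rw [hd.mem_omegaD_iff hG hD hH]
  constructor
  · rintro ⟨u, w, hr, rfl⟩
    exact hd.exp_mem_verticalStrips hG hH (hd.col_iff_row.2 hr)
  · intro hz
    obtain ⟨u, w, hc, rfl⟩ := hd.exists_col_of_mem hG hH hz
    exact ⟨u, w, hd.col_iff_row.1 hc, rfl⟩

/-- Membership in the domain, for lifts in the strip that contains the lifted domain. -/
theorem col_of_mem (hd : S.IsDual x d h) (hG : ∀ n : ℤ, Circle.exp (x n) = G n)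
    (hH : ∀ n : ℤ, Circle.exp (h n) = S.H G n) {u w : ℝ}
    (hz : (Circle.exp u, Circle.exp w) ∈ S.verticalStrips G) (h₁ : u - 2 * π < w) (h₂ : w < u) :
    S.Col x h u w := by
  obtain ⟨u', w', hc, he⟩ := hd.exists_col_of_mem hG hH hz
  obtain ⟨n, rfl⟩ := Circle.exp_eq_exp.1 (congrArg Prod.fst he)
  have hc' := hd.col_add_int_mul hc n
  obtain ⟨l₁, l₂⟩ := hd.lt_of_col hc'
  have e : w = w' + n * (2 * π) := by
    apply eq_of_exp_eq
    · rw [exp_add_int_mul]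
      exact congrArg Prod.snd he
    · linarith
    · linarith
  rwa [e]

theorem exists_ball_of_mem_interior (hd : S.IsDual x d h) (hG : ∀ n : ℤ, Circle.exp (x n) = G n)
    (hH : ∀ n : ℤ, Circle.exp (h n) = S.H G n) {u w : ℝ} (hc : S.Col x h u w)
    (hz : (Circle.exp u, Circle.exp w) ∈ interior (S.verticalStrips G)) :
    ∃ ε > 0, ∀ u' w', |u' - u| < ε → |w' - w| < ε → S.Col x h u' w' := by
  obtain ⟨l₁, l₂⟩ := hd.lt_of_col hc
  have hcont : Continuous fun v : ℝ × ℝ ↦ (Circle.exp v.1, Circle.exp v.2) := by fun_prop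
  have h₁ : ∀ᶠ v : ℝ × ℝ in 𝓝 (u, w), (Circle.exp v.1, Circle.exp v.2) ∈ S.verticalStrips G :=
    hcont.continuousAt.eventually (mem_interior_iff_mem_nhds.1 hz)
  have h₂ : ∀ᶠ v : ℝ × ℝ in 𝓝 (u, w), v.1 - 2 * π < v.2 :=
    (isOpen_lt (by fun_prop) (by fun_prop)).mem_nhds l₁
  have h₃ : ∀ᶠ v : ℝ × ℝ in 𝓝 (u, w), v.2 < v.1 :=
    (isOpen_lt (by fun_prop) (by fun_prop)).mem_nhds l₂
  obtain ⟨ε, hε, H⟩ := Metric.eventually_nhds_iff.1 (h₁.and (h₂.and h₃))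
  refine ⟨ε, hε, fun u' w' hu hw ↦ ?_⟩
  obtain ⟨a, b, c⟩ := H (y := (u', w')) (by
    rw [Prod.dist_eq, max_lt_iff, Real.dist_eq, Real.dist_eq]
    exact ⟨hu, hw⟩)
  exact hd.col_of_mem hG hH a b c

theorem isClosed_verticalStrips (S : SurfacePolygon g) (G : Idx g → Circle) :
    IsClosed (S.verticalStrips G) := by
  have : NeZero (8 * g - 4) := ⟨by have := S.two_le; omega⟩
  exact isClosed_iUnion_of_finite fun i ↦
    ((isClosed_arcCC _ _).prod (isClosed_arcCC _ _)).union
      ((isClosed_arcCC _ _).prod (isClosed_arcCC _ _))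

theorem mem_image_of_preimage (hd : S.IsDual x d h) (hG : ∀ n : ℤ, Circle.exp (x n) = G n)
    (hD : ∀ n : ℤ, Circle.exp (d n) = S.D G n) (hH : ∀ n : ℤ, Circle.exp (h n) = S.H G n)
    {u w : ℝ}
    (he : ∃ j u₀ w₀, S.Col x h u₀ w₀ ∧ d j ≤ w₀ ∧ w₀ < d (j + 1) ∧ S.t j u₀ = u ∧ S.t j w₀ = w) :
    (Circle.exp u, Circle.exp w) ∈ S.natExt (S.D G) '' S.verticalStrips G := by
  obtain ⟨j, u₀, w₀, hc, h₁, h₂, rfl, rfl⟩ := he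
  exact ⟨_, hd.exp_mem_verticalStrips hG hH hc, hd.natExt_exp hD u₀ h₁ h₂⟩

theorem mapsTo (hd : S.IsDual x d h) (hG : ∀ n : ℤ, Circle.exp (x n) = G n)
    (hD : ∀ n : ℤ, Circle.exp (d n) = S.D G n) (hH : ∀ n : ℤ, Circle.exp (h n) = S.H G n) :
    Set.MapsTo (S.natExt (S.D G)) (S.verticalStrips G) (S.verticalStrips G) := by
  intro z hz
  obtain ⟨u, w, hc, rfl⟩ := hd.exists_col_of_mem hG hH hz
  obtain ⟨j, h₁, h₂⟩ := hd.exists_d_le_lt w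
  rw [hd.natExt_exp hD u h₁ h₂]
  exact hd.exp_mem_verticalStrips hG hH (hd.col_t hc h₁ h₂)

/-- The image contains every vertical fibre of a strip except possibly its upper end, which the
closure restores; conversely the domain is closed. -/
theorem closure_image (hd : S.IsDual x d h) (hG : ∀ n : ℤ, Circle.exp (x n) = G n)
    (hD : ∀ n : ℤ, Circle.exp (d n) = S.D G n) (hH : ∀ n : ℤ, Circle.exp (h n) = S.H G n) :
    closure (S.natExt (S.D G) '' S.verticalStrips G) = S.verticalStrips G := by
  apply Set.Subset.antisymm
  · exact closure_minimal (hd.mapsTo hG hD hH).image_subset (isClosed_verticalStrips S G)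
  · intro z hz
    obtain ⟨u, w, hc, rfl⟩ := hd.exists_col_of_mem hG hH hz
    have hcont : Continuous fun v : ℝ ↦ (Circle.exp u, Circle.exp v) := by fun_prop
    obtain ⟨k, ⟨⟨a, b⟩, c, e⟩ | ⟨⟨a, b⟩, c, e⟩⟩ := hc
    · refine map_mem_closure hcont (s := Set.Ico (h (k + 1 - per g)) (x (k - 2))) ?_ ?_
      · rw [closure_Ico (hd.strip_lt k).1.ne]
        exact ⟨c, e⟩
      · rintro v ⟨c', e'⟩
        exact hd.mem_image_of_preimage hG hD hH (hd.exists_preimage_of_strip a b c' e')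
    · refine map_mem_closure hcont (s := Set.Ico (h (k + 1 - per g)) (x (k - 1))) ?_ ?_
      · rw [closure_Ico (hd.strip_lt k).2.2.1.ne]
        exact ⟨c, e⟩
      · rintro v ⟨c', e'⟩
        exact hd.mem_image_of_preimage hG hD hH (hd.exists_preimage_of_strip' a b c' e')

theorem interior_subset_image (hd : S.IsDual x d h) (hG : ∀ n : ℤ, Circle.exp (x n) = G n)
    (hD : ∀ n : ℤ, Circle.exp (d n) = S.D G n) (hH : ∀ n : ℤ, Circle.exp (h n) = S.H G n) :
    interior (S.verticalStrips G) ⊆ S.natExt (S.D G) '' S.verticalStrips G := by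
  intro z hz
  obtain ⟨u, w, hc, rfl⟩ := hd.exists_col_of_mem hG hH (interior_subset hz)
  obtain ⟨ε, hε, H⟩ := hd.exists_ball_of_mem_interior hG hH hc hz
  exact hd.mem_image_of_preimage hG hD hH
    (hd.exists_preimage_of_interior hc (w' := w + ε / 2) (by linarith)
      (H _ _ (by simpa using hε) (by rw [abs_lt]; constructor <;> linarith)))

theorem injOn_interior (hd : S.IsDual x d h) (hG : ∀ n : ℤ, Circle.exp (x n) = G n)
    (hD : ∀ n : ℤ, Circle.exp (d n) = S.D G n) (hH : ∀ n : ℤ, Circle.exp (h n) = S.H G n) :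
    Set.InjOn (S.natExt (S.D G)) (interior (S.verticalStrips G)) := by
  intro z₁ hz₁ z₂ hz₂ he
  obtain ⟨u₁, w₁, hc₁, rfl⟩ := hd.exists_col_of_mem hG hH (interior_subset hz₁)
  obtain ⟨u₂, w₂, hc₂, rfl⟩ := hd.exists_col_of_mem hG hH (interior_subset hz₂)
  obtain ⟨i, hi, hi'⟩ := hd.exists_d_le_lt w₁
  obtain ⟨j, hj, hj'⟩ := hd.exists_d_le_lt w₂
  rw [hd.natExt_exp hD u₁ hi hi', hd.natExt_exp hD u₂ hj hj'] at he
  obtain ⟨n, hn⟩ := Circle.exp_eq_exp.1 (congrArg Prod.fst he)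
  have hm := congrArg Prod.snd he
  simp only at hn hm
  rw [← exp_add_int_mul (S.t j w₂) n] at hm
  -- The lift of the second point is shifted so that the first coordinates of the images agree on
  -- the line; the strip `u - 2π < w < u` then makes the second coordinates agree too.
  have hu : S.t i u₁ = S.t (j + -n * per g) (u₂ + (-n : ℤ) * (2 * π)) := by
    rw [t_add_int_mul_per, hn]
    push_cast
    ring
  have hw : S.t i w₁ = S.t (j + -n * per g) (w₂ + (-n : ℤ) * (2 * π)) := by
    have l₁ := hd.lt_of_col (hd.col_t hc₁ hi hi')
    have l₂ := hd.lt_of_col (hd.col_t hc₂ hj hj')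
    rw [t_add_int_mul_per]
    push_cast
    rw [eq_of_exp_eq hm (by linarith) (by linarith)]
    ring
  rw [← exp_add_int_mul u₂ (-n), ← exp_add_int_mul w₂ (-n)] at hz₂ ⊢
  have hj₁ := hd.d_add_int_mul_per j (-n)
  have hj₂ := hd.d_add_int_mul_per (j + 1) (-n)
  obtain ⟨ε₁, hε₁, H₁⟩ := hd.exists_ball_of_mem_interior hG hH hc₁ hz₁
  obtain ⟨ε₂, hε₂, H₂⟩ := hd.exists_ball_of_mem_interior hG hH (hd.col_add_int_mul hc₂ (-n)) hz₂
  have hij : i = j + -n * per g := hd.eq_of_t_eq (lt_min hε₁ hε₂)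
    (fun u' w' a b ↦ H₁ u' w' (a.trans_le (min_le_left _ _)) (b.trans_le (min_le_left _ _)))
    (fun u' w' a b ↦ H₂ u' w' (a.trans_le (min_le_right _ _)) (b.trans_le (min_le_right _ _)))
    hi hi' (by linarith)
    (by rw [show j + -n * per g + 1 = j + 1 + -n * per g by ring]; linarith) hu hw
  rw [← hij] at hu hw
  rw [(S.isLift_t i).mono.injective hu, (S.isLift_t i).mono.injective hw]

/-- Away from the lines that carry the edges all inequalities of a strip are strict, and
`Circle.exp` is an open map. -/
theorem mem_interior_of_not_mem (hd : S.IsDual x d h) (hG : ∀ n : ℤ, Circle.exp (x n) = G n)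
    (hH : ∀ n : ℤ, Circle.exp (h n) = S.H G n) {z : Circle × Circle}
    (hz : z ∈ S.verticalStrips G) (h₁ : z.1 ∉ Set.range S.P ∪ Set.range S.Q)
    (h₂ : z.2 ∉ Set.range G ∪ Set.range (S.H G)) : z ∈ interior (S.verticalStrips G) := by
  obtain ⟨u, w, ⟨k, hk⟩, rfl⟩ := hd.exists_col_of_mem hG hH hz
  have nP : ∀ n, u ≠ S.p n := fun n hn ↦ h₁ (Or.inl ⟨n, by rw [hn]; exact (S.exp_p n).symm⟩)
  have nQ : ∀ n, u ≠ S.q n := fun n hn ↦ h₁ (Or.inr ⟨n, by rw [hn]; exact (S.exp_q n).symm⟩)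
  have nG : ∀ n, w ≠ x n := fun n hn ↦ h₂ (Or.inl ⟨n, by rw [hn]; exact (hG n).symm⟩)
  have nH : ∀ n, w ≠ h n := fun n hn ↦ h₂ (Or.inr ⟨n, by rw [hn]; exact (hH n).symm⟩)
  have key : ∀ a b c e : ℝ, a < u → u < b → c < w → w < e →
      (∀ u' w', a ≤ u' → u' ≤ b → c ≤ w' → w' ≤ e → S.Col x h u' w') →
      (Circle.exp u, Circle.exp w) ∈ interior (S.verticalStrips G) := by
    intro a b c e ha hb hc he H
    have ho := isLocalHomeomorph_circleExp.isOpenMap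
    refine mem_interior.2 ⟨(Circle.exp '' Set.Ioo a b) ×ˢ (Circle.exp '' Set.Ioo c e), ?_,
      (ho _ isOpen_Ioo).prod (ho _ isOpen_Ioo), ⟨u, ⟨ha, hb⟩, rfl⟩, ⟨w, ⟨hc, he⟩, rfl⟩⟩
    rintro ⟨_, _⟩ ⟨⟨u', hu', rfl⟩, ⟨w', hw', rfl⟩⟩
    exact hd.exp_mem_verticalStrips hG hH (H u' w' hu'.1.le hu'.2.le hw'.1.le hw'.2.le)
  rcases hk with ⟨⟨a, b⟩, c, e⟩ | ⟨⟨a, b⟩, c, e⟩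
  · exact key _ _ _ _ (a.lt_of_ne (nP _).symm) (b.lt_of_ne (nQ _)) (c.lt_of_ne (nH _).symm)
      (e.lt_of_ne (nG _)) fun u' w' a' b' c' e' ↦ ⟨k, Or.inl ⟨⟨a', b'⟩, c', e'⟩⟩
  · exact key _ _ _ _ (a.lt_of_ne (nQ _).symm) (b.lt_of_ne (nP _)) (c.lt_of_ne (nH _).symm)
      (e.lt_of_ne (nG _)) fun u' w' a' b' c' e' ↦ ⟨k, Or.inr ⟨⟨a', b'⟩, c', e'⟩⟩

theorem isBijectivityDomain (hd : S.IsDual x d h) (hG : ∀ n : ℤ, Circle.exp (x n) = G n)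
    (hD : ∀ n : ℤ, Circle.exp (d n) = S.D G n) (hH : ∀ n : ℤ, Circle.exp (h n) = S.H G n) :
    IsBijectivityDomain (S.natExt (S.D G)) (S.verticalStrips G) where
  mapsTo := hd.mapsTo hG hD hH
  closure_image := hd.closure_image hG hD hH
  injOn_interior := hd.injOn_interior hG hD hH
  interior_subset_image := hd.interior_subset_image hG hD hH
  bijOn := by
    have : NeZero (8 * g - 4) := ⟨by have := S.two_le; omega⟩
    -- `E` contains the coordinates of all edges of strips. Its orbit under words in the side
    -- pairings is countable, and invariant in both directions because `T (sig i)` inverts `T i`;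
    -- outside it only interior points remain.
    set E : Set Circle :=
      (Set.range S.P ∪ Set.range S.Q) ∪ (Set.range G ∪ Set.range (S.H G)) with hE
    have hEc : E.Countable :=
      (((Set.finite_range _).union (Set.finite_range _)).union
        ((Set.finite_range _).union (Set.finite_range _))).countable
    set f : Idx g → Circle → Circle := fun i ↦ actS (S.T i) with hf
    have hinv : ∀ i y, f i y ∈ orbitSet f E ↔ y ∈ orbitSet f E := by
      refine fun i y ↦ ⟨fun hy ↦ ?_, fun hy ↦ apply_mem_orbitSet f hy i⟩
      have := apply_mem_orbitSet f hy (sig i)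
      simp only [hf] at this
      rwa [← actS_mul, (S.T_inv i).actS_eq] at this
    have hmap : ∀ z, ((S.natExt (S.D G) z).1 ∈ orbitSet f E ↔ z.1 ∈ orbitSet f E) ∧
        ((S.natExt (S.D G) z).2 ∈ orbitSet f E ↔ z.2 ∈ orbitSet f E) := by
      intro z
      rcases S.natExt_eq_or (S.D G) z with ⟨i, e⟩ | e
      · rw [e]
        exact ⟨hinv i z.1, hinv i z.2⟩
      · rw [e]
        exact ⟨Iff.rfl, Iff.rfl⟩
    have hint : S.verticalStrips G \ {z | z.1 ∈ orbitSet f E ∨ z.2 ∈ orbitSet f E} ⊆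
        interior (S.verticalStrips G) := by
      rintro z ⟨hz, hz'⟩
      rw [Set.mem_ofPred_eq, not_or] at hz'
      exact hd.mem_interior_of_not_mem hG hH hz
        (fun hn ↦ hz'.1 (subset_orbitSet f E (Or.inl hn)))
        (fun hn ↦ hz'.2 (subset_orbitSet f E (Or.inr hn)))
    refine ⟨orbitSet f E, countable_orbitSet f hEc, ?_, ?_, ?_⟩
    · rintro z ⟨hz, hz'⟩
      refine ⟨hd.mapsTo hG hD hH hz, ?_⟩
      rwa [Set.mem_ofPred_eq, (hmap z).1, (hmap z).2]
    · exact (hd.injOn_interior hG hD hH).mono hint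
    · intro z hz
      obtain ⟨y, hy, rfl⟩ := hd.interior_subset_image hG hD hH (hint hz)
      refine ⟨y, ⟨hy, ?_⟩, rfl⟩
      have := hz.2
      rwa [Set.mem_ofPred_eq, (hmap y).1, (hmap y).2] at this

end IsDual

end SurfacePolygon

end BowenSeries

end

theorem mainTheorem4 {g : ℕ} (S : BowenSeries.SurfacePolygon g)
    (A : BowenSeries.Idx g → Circle) (hA : S.IsExtremal A) :
    (∃! G : BowenSeries.Idx g → Circle, S.IsSystemSolution A G) ∧
    ∀ G : BowenSeries.Idx g → Circle, S.IsSystemSolution A G →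
      (∀ i, S.D G i ∈ BowenSeries.arcCC (S.P i) (S.Q i)) ∧
      S.omegaD G = S.verticalStrips G ∧
      BowenSeries.IsBijectivityDomain (S.natExt (S.D G)) (S.omegaD G) := by
  refine ⟨S.existsUnique_isSystemSolution hA, fun G hsol ↦ ?_⟩
  obtain ⟨x, hx, hG⟩ := BowenSeries.SurfacePolygon.exists_lift_of_isSystemSolution hA hsol
  have hd := hx.isDual
  have hD := BowenSeries.SurfacePolygon.exp_dLift (S := S) hG
  have hH := BowenSeries.SurfacePolygon.exp_hLift (S := S) hG
  have hΩ := hd.omegaD_eq hG hD hH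
  refine ⟨fun i ↦ ?_, hΩ, hΩ ▸ hd.isBijectivityDomain hG hD hH⟩
  obtain ⟨n, -, -, rfl⟩ := BowenSeries.exists_cast_eq S.two_le i 0
  rw [zero_add, ← hD, ← S.exp_p, ← S.exp_q]
  refine BowenSeries.exp_mem_arcCC (hd.p_le_d n) (hd.d_le_q n) ?_
  rw [← S.p_add_per]
  exact BowenSeries.SurfacePolygon.q_lt_p (by have := S.twelve_le_per; omega)
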